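/- All graphs are finite, simple and without loops. A graph property $\Phi$ is a function that assigns to every graph a value in $\{0,1\}$ and takes the same value on isomorphic graphs; it is computable if there is an algorithm that decides, given a graph $H$, whether $\Phi(H)=1$. The matching number of a graph is the size of a largest matching in it. For a graph $G$ and a set $A\subseteq E(G)$ let $G[A]$ be the graph obtained from $(V(G),A)$ by deleting all isolated vertices. In the problem $\#\mathrm{EdgeSub}(\Phi)$ the input is a graph $G$ and a positive integer $k$, the task is to compute $$\#\{A\subseteq E(G) : |A|=k \text{ and } \Phi(G[A])=1\},$$ and the parameter is $k$. **Proposition.** Let $\Phi$ be a computable graph property. Suppose that there is an integer $M>0$ such that for every $k$ at least one of the following holds: every graph $H$ with exactly $k$ edges and $\Phi(H)=1$ has matching number at most $M$, or every graph $H$ with exactly $k$ edges and $\Phi(H)=0$ has matching number at most $M$. Then $\#\mathrm{EdgeSub}(\Phi)$ is fixed-parameter tractable, that is, there are a computable function $f:\mathbb{N}\to\mathbb{N}$ and an algorithm (a deterministic Turing machine) that solves every instance $x=(G,k)$, encoded as a string of length $|x|$, in time $f(k)\cdot |x|^{O(1)}$. -/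

import Mathlib

open Computability

/-- A graph property: a predicate on finite simple graphs that only depends on the isomorphism
class of the graph. -/
structure GraphProperty where
  /-- the graph satisfies the property -/
  Holds : ∀ {V : Type} [Finite V], SimpleGraph V → Prop
  /-- the property is invariant under isomorphism -/
  iso_invariant : ∀ {V W : Type} [Finite V] [Finite W] (G : SimpleGraph V) (H : SimpleGraph W),
    Nonempty (G ≃g H) → (Holds G ↔ Holds H)

/-- The matching number of a finite graph: the largest number of edges of a matching. -/
noncomputable def matchingNumber {V : Type} [Finite V] (G : SimpleGraph V) : ℕ :=
  sSup {m : ℕ | ∃ S : G.Subgraph, S.IsMatching ∧ S.edgeSet.ncard = m}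

/-- For an edge set `A`, the graph with edge set `A` from which all isolated vertices have been
deleted. -/
def edgeSubgraph {V : Type} (A : Set (Sym2 V)) :
    SimpleGraph (SimpleGraph.fromEdgeSet A).support :=
  (SimpleGraph.fromEdgeSet A).induce (SimpleGraph.fromEdgeSet A).support

/-- The set of all `k`-element sets `A` of edges of `G` such that `G[A]` satisfies `Φ`. -/
def edgeSubs (Φ : GraphProperty) (k : ℕ) {V : Type} [Finite V] (G : SimpleGraph V) :
    Set (Set (Sym2 V)) :=
  {A | A ⊆ G.edgeSet ∧ A.ncard = k ∧ Φ.Holds (edgeSubgraph A)}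

/-! ### Encodings by binary strings -/

open Classical in
/-- The rows of the adjacency matrix of a graph on `Fin n`, one after the other. -/
noncomputable def adjBits {n : ℕ} (G : SimpleGraph (Fin n)) : List Bool :=
  (List.product (List.finRange n) (List.finRange n)).map fun p => decide (G.Adj p.1 p.2)

/-- The encoding `1ⁿ 0 a` of a graph with `n` vertices and adjacency matrix `a`. -/
noncomputable def encodeGraph {n : ℕ} (G : SimpleGraph (Fin n)) : List Bool :=
  List.replicate n true ++ false :: adjBits G

theorem replicate_true_append_inj {a b : ℕ} {l l' : List Bool}
    (h : List.replicate a true ++ false :: l = List.replicate b true ++ false :: l') :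
    a = b ∧ l = l' := by
  induction a generalizing b with
  | zero => cases b <;> simp_all [List.replicate_succ]
  | succ a ih =>
    cases b with
    | zero => simp [List.replicate_succ] at h
    | succ b =>
      simp only [List.replicate_succ, List.cons_append, List.cons.injEq, true_and] at h
      obtain ⟨h1, h2⟩ := ih h
      exact ⟨by omega, h2⟩

theorem adjBits_injective {n : ℕ} : Function.Injective (adjBits (n := n)) := by
  classical
  intro G H h
  unfold adjBits at h
  rw [List.map_inj_left] at h
  ext i j
  simpa using h (i, j) (by simp [List.mem_finRange])

/-- A graph property is computable if it is decidable by an algorithm whether a given binary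
string encodes a graph satisfying the property. -/
def GraphProperty.IsComputable (Φ : GraphProperty) : Prop :=
  ComputablePred fun w : List Bool =>
    ∃ (n : ℕ) (G : SimpleGraph (Fin n)), encodeGraph G = w ∧ Φ.Holds G

/-! ### Parameterized counting problems -/

/-- A parameterized counting problem: instances encoded by binary strings, the number that has to
be computed for each instance, and the parameter of each instance. -/
structure ParamCountingProblem where
  /-- the instances -/
  Inst : Type
  /-- the encoding of instances -/
  encode : Inst → List Bool
  encode_injective : Function.Injective encode
  /-- the number to be computed -/
  count : Inst → ℕ
  /-- the parameterization -/
  param : Inst → ℕ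

/-- Fixed-parameter tractability: there are a Turing machine, a computable function `f` and a
polynomial `p` such that on every instance `x` the machine halts after at most
`f (param x) * p (|x|)` steps with the binary representation of `count x` as output. -/
def ParamCountingProblem.IsFPT (P : ParamCountingProblem) : Prop :=
  ∃ (T : Turing.TM2ComputableAux Bool Bool) (f : ℕ → ℕ) (p : Polynomial ℕ),
    Computable f ∧
    ∀ x : P.Inst,
      Nonempty (Turing.TM2OutputsInTime T.tm
        ((P.encode x).map T.inputAlphabet.symm)
        (some ((encodeNat (P.count x)).map T.outputAlphabet.symm))
        (f (P.param x) * p.eval (P.encode x).length))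

/-- An input of the problem of counting edge subgraphs: a graph and a positive integer. -/
structure EdgeSubInstance where
  /-- the number of vertices of the graph -/
  n : ℕ
  /-- the graph -/
  graph : SimpleGraph (Fin n)
  /-- the number of edges of the subgraphs to be counted -/
  k : ℕ
  k_pos : 0 < k

/-- The encoding `1ᵏ 0 w` of the pair of `k` and a graph with encoding `w`. -/
noncomputable def EdgeSubInstance.encode (x : EdgeSubInstance) : List Bool :=
  List.replicate x.k true ++ false :: encodeGraph x.graph

theorem EdgeSubInstance.encode_injective : Function.Injective EdgeSubInstance.encode := by
  rintro ⟨n, G, k, hk⟩ ⟨n', G', k', hk'⟩ h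
  obtain ⟨h1, h2⟩ := replicate_true_append_inj h
  obtain ⟨h3, h4⟩ := replicate_true_append_inj h2
  simp only at h1 h3 h4
  subst h1 h3
  rw [adjBits_injective h4]

/-- The problem `#EdgeSub(Φ)`: given a graph `G` and a positive integer `k`, compute the number of
`k`-edge subsets `A` of the edges of `G` such that `G[A]` satisfies `Φ`; the parameter is `k`. -/
noncomputable def sharpEdgeSub (Φ : GraphProperty) : ParamCountingProblem where
  Inst := EdgeSubInstance
  encode := EdgeSubInstance.encode
  encode_injective := EdgeSubInstance.encode_injective
  count x := (edgeSubs Φ x.k x.graph).ncard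
  param x := x.k

/-! Why the theorem holds. The disjoint union of `k` edges, `SimpleGraph.edges k`, has matching
number `k`, the largest value possible with `k` edges. Call a `k`-edge graph exceptional if `Φ`
differs on it from its value on `k` disjoint edges. One of the two values of `Φ` is taken only on
graphs of matching number at most `M`. If this is not the value on exceptional graphs, it is the
value on `k` disjoint edges, so `k ≤ M`. Either way, exceptional graphs have matching number at most
`M` (`matchingNumber_le_of_holds_ne`). The required number is therefore the number of exceptional
subgraphs of `G`, or the binomial coefficient of `|E(G)|` over `k` minus that number
(`ncard_edgeSubs`).

The endpoints of a maximum matching form a vertex cover, so an exceptional graph has a cover with at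
most `D = 2M` vertices. Such a cover is not unique. It is replaced by the core, which depends only
on the graph, is still a cover, and has at most `T = D + D * D` vertices. Given the increasing
enumeration of the core, the graph is described by one label per vertex: the index of the vertex in
the core, if any, and its registered core neighbours. This description is bijective
(`Label.bijOn_describes`), and the number of labels depends on `M` only. The multiplicities of the
labels determine the graph up to isomorphism and isolated vertices, hence its number of edges, its
core condition and its `Φ`-value (`Label.describes_iff`).

For a fixed enumeration, labellings with prescribed multiplicities are counted by the coefficients
of a product over the vertices of sums over the fitting labels. A large power of two in place of the
indeterminate turns the coefficients into digits (`Label.kron_eq`, `sum_pow_div_mod`), and the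
relevant digits are added up (`Label.sum_kron_digits`). The relevant multiplicities are less than `4
^ k`, so the values of `Φ` that matter form a finite table that is computable from `k`
(`exists_table`).

Once the table is known, the count is an arithmetic expression with sums and products over bounded
ranges whose shape depends on `M` only. Such expressions are evaluated in polynomial time
(`Prog.Arith.exists_arithProg`). Time is measured on register programs that compile to Turing
machines step by step. The table itself is produced by a program whose running time is bounded by a
computable function of `k` (`Prog.exists_prog_computable`), and a polynomial in the table size plus
the input length splits into a factor for `k` times a polynomial in the input length. -/

/-! ### A structured programming language on registers holding binary strings -/

/-- Structured programs. The program `case r P Q R` pops register `r` and runs `P`, `Q` or `R`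
when the register was empty, had `false` on top, had `true` on top; `loop r P Q` pops register
`r` and runs `P` or `Q` according to the popped bit, until the register is empty. -/
inductive Prog
  | skip
  | push (r : ℕ) (b : Bool)
  | seq (P Q : Prog)
  | case (r : ℕ) (P Q R : Prog)
  | loop (r : ℕ) (P Q : Prog)

namespace Prog

infixr:60 " ;; " => Prog.seq

/-- The contents of the registers. -/
abbrev Store := ℕ → List Bool

/-- `Run P S t S'`: the program `P` transforms the store `S` into `S'` in exactly `t` steps. -/
inductive Run : Prog → Store → ℕ → Store → Prop
  | skip (S) : Run skip S 0 S
  | push (r b S) : Run (push r b) S 1 (Function.update S r (b :: S r))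
  | seq {P Q S S' S'' t t'} : Run P S t S' → Run Q S' t' S'' → Run (seq P Q) S (t + t') S''
  -- The costs are those of the flat code below: a branch pays for the pop and for the closing jump,
  -- a loop iteration for the pop and the jump back, and leaving a loop for the pop alone.
  | caseNil {r P Q R S S' t} : S r = [] → Run P S t S' → Run (case r P Q R) S (t + 2) S'
  | caseFalse {r P Q R S l S' t} : S r = false :: l → Run Q (Function.update S r l) t S' →
      Run (case r P Q R) S (t + 2) S'
  | caseTrue {r P Q R S l S' t} : S r = true :: l → Run R (Function.update S r l) t S' →
      Run (case r P Q R) S (t + 2) S'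
  | loopNil {r P Q S} : S r = [] → Run (loop r P Q) S 1 S
  | loopFalse {r P Q S l S' S'' t t'} : S r = false :: l → Run P (Function.update S r l) t S' →
      Run (loop r P Q) S' t' S'' → Run (loop r P Q) S (t + t' + 2) S''
  | loopTrue {r P Q S l S' S'' t t'} : S r = true :: l → Run Q (Function.update S r l) t S' →
      Run (loop r P Q) S' t' S'' → Run (loop r P Q) S (t + t' + 2) S''

/-! ### Flat code -/

/-- Instructions of flat code; jump targets are absolute addresses. -/
inductive Instr
  | push (r : ℕ) (b : Bool)
  | jump (a : ℕ)
  | pop (r : ℕ) (a b c : ℕ)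

/-- The number of instructions of the flat code of a program. -/
def size : Prog → ℕ
  | skip => 0
  | push _ _ => 1
  | seq P Q => P.size + Q.size
  | case _ P Q R => P.size + Q.size + R.size + 4
  | loop _ P Q => P.size + Q.size + 3

/-- The flat code of a program that starts at the address `o`. -/
def code : Prog → ℕ → List Instr
  | skip, _ => []
  | push r b, _ => [.push r b]
  | seq P Q, o => P.code o ++ Q.code (o + P.size)
  | case r P Q R, o =>
    let e := o + P.size + Q.size + R.size + 4
    .pop r (o + 1) (o + P.size + 2) (o + P.size + Q.size + 3) :: (P.code (o + 1) ++
      .jump e :: (Q.code (o + P.size + 2) ++ .jump e :: (R.code (o + P.size + Q.size + 3) ++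
        [.jump e])))
  | loop r P Q, o =>
    .pop r (o + P.size + Q.size + 3) (o + 1) (o + P.size + 2) :: (P.code (o + 1) ++
      .jump o :: (Q.code (o + P.size + 2) ++ [.jump o]))

theorem length_code (P : Prog) (o : ℕ) : (P.code o).length = P.size := by
  induction P generalizing o <;> simp [code, size, *] <;> omega

/-- Execution of one instruction at address `pc`. -/
def Instr.exec : Instr → ℕ × Store → ℕ × Store
  | .push r b, (pc, S) => (pc + 1, Function.update S r (b :: S r))
  | .jump a, (_, S) => (a, S)
  | .pop r a b c, (_, S) =>
    match S r with
    | [] => (a, S)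
    | false :: l => (b, Function.update S r l)
    | true :: l => (c, Function.update S r l)

/-- One step of flat code; the execution ends when the address leaves the code. -/
def flatStep (c : List Instr) (x : ℕ × Store) : Option (ℕ × Store) :=
  (getElem? c x.1).map fun i => i.exec x

/-- `Steps f n a b`: `n` steps of `f` lead from `a` to `b`. -/
inductive Steps {α : Type*} (f : α → Option α) : ℕ → α → α → Prop
  | refl (a) : Steps f 0 a a
  | head {n a b c} : f a = some b → Steps f n b c → Steps f (n + 1) a c

theorem Steps.trans {α : Type*} {f : α → Option α} {m n : ℕ} {a b c : α} (h : Steps f m a b)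
    (h' : Steps f n b c) : Steps f (m + n) a c := by
  induction h with
  | refl => simpa using h'
  | head h1 _ ih => rw [Nat.add_right_comm]; exact .head h1 (ih h')

theorem Steps.one {α : Type*} {f : α → Option α} {a b : α} (h : f a = some b) : Steps f 1 a b :=
  .head h (.refl _)


/-- The code `l` is placed at the address `o` of the code `c`. -/
def Placed (c : List Instr) (o : ℕ) (l : List Instr) : Prop :=
  ∀ i, i < l.length → getElem? c (o + i) = getElem? l i

theorem Placed.left {c : List Instr} {o : ℕ} {l l' : List Instr} (h : Placed c o (l ++ l')) :
    Placed c o l := fun i hi => by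
  rw [h i (by simp; omega), List.getElem?_append_left hi]

theorem Placed.right {c : List Instr} {o : ℕ} {l l' : List Instr} (h : Placed c o (l ++ l')) :
    Placed c (o + l.length) l' := fun i hi => by
  rw [Nat.add_assoc, h _ (by simp; omega), List.getElem?_append_right (by omega)]
  congr 1; omega

theorem Placed.head {c : List Instr} {o : ℕ} {a : Instr} {l : List Instr}
    (h : Placed c o (a :: l)) : getElem? c o = some a := by
  simpa using h 0 (by simp)

theorem Placed.tail {c : List Instr} {o : ℕ} {a : Instr} {l : List Instr}
    (h : Placed c o (a :: l)) : Placed c (o + 1) l :=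
  Placed.right (l := [a]) h

/-- Compilation preserves the number of steps exactly, so time bounds for programs become time
bounds for machines. The address is generalized because jump targets are absolute; after an
iteration a loop returns to its own address, where the induction hypothesis for the remaining run
applies. -/
theorem Run.steps_code {P : Prog} {S S' : Store} {t : ℕ} (h : Run P S t S') (c : List Instr)
    (o : ℕ) (hc : Placed c o (P.code o)) :
    Steps (flatStep c) t (o, S) (o + P.size, S') := by
  induction h generalizing o with
  | skip S => exact .refl _
  | push r b S =>
    exact .one (by simp [flatStep, hc.head, Instr.exec, size])
  | @seq P Q S S' S'' t t' _ _ ih1 ih2 =>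
    have h2 := hc.right
    rw [length_code] at h2
    have := (ih1 o hc.left).trans (ih2 _ h2)
    rwa [Nat.add_assoc] at this
  | @caseNil r P Q R S S' t hr _ ih =>
    have h1 := hc.tail.left
    have h2 := hc.tail.right
    rw [length_code] at h2
    have s1 : flatStep c (o, S) = some (o + 1, S) := by
      simp [flatStep, hc.head, Instr.exec, hr]
    have s2 : flatStep c (o + 1 + P.size, S') = some (o + (case r P Q R).size, S') := by
      simp [flatStep, h2.head, Instr.exec, size]; omega
    exact .head s1 ((ih _ h1).trans (.one s2))
  | @caseFalse r P Q R S l S' t hr _ ih =>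
    have h1 := hc.tail.right.tail.left
    have h2 := hc.tail.right.tail.right
    have e : o + 1 + P.size + 1 = o + P.size + 2 := by omega
    rw [length_code, e] at h1
    rw [length_code, length_code, e] at h2
    have s1 : flatStep c (o, S) = some (o + P.size + 2, Function.update S r l) := by
      simp [flatStep, hc.head, Instr.exec, hr]
    have s2 : flatStep c (o + P.size + 2 + Q.size, S') = some (o + (case r P Q R).size, S') := by
      simp [flatStep, h2.head, Instr.exec, size]; omega
    exact .head s1 ((ih _ h1).trans (.one s2))
  | @caseTrue r P Q R S l S' t hr _ ih =>
    have h1 := hc.tail.right.tail.right.tail.left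
    have h2 := hc.tail.right.tail.right.tail.right
    have e : o + 1 + P.size + 1 + Q.size + 1 = o + P.size + Q.size + 3 := by omega
    rw [length_code, length_code, e] at h1
    rw [length_code, length_code, length_code, e] at h2
    have s1 : flatStep c (o, S) = some (o + P.size + Q.size + 3, Function.update S r l) := by
      simp [flatStep, hc.head, Instr.exec, hr]
    have s2 : flatStep c (o + P.size + Q.size + 3 + R.size, S') =
        some (o + (case r P Q R).size, S') := by
      simp [flatStep, h2.head, Instr.exec, size]; omega
    exact .head s1 ((ih _ h1).trans (.one s2))
  | @loopNil r P Q S hr =>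
    exact .one (by simp [flatStep, hc.head, Instr.exec, hr, size]; omega)
  | @loopFalse r P Q S l S' S'' t t' hr _ _ ih1 ih2 =>
    have h1 := hc.tail.left
    have h2 := hc.tail.right
    rw [length_code] at h2
    have s1 : flatStep c (o, S) = some (o + 1, Function.update S r l) := by
      simp [flatStep, hc.head, Instr.exec, hr]
    have s2 : flatStep c (o + 1 + P.size, S') = some (o, S') := by
      simp [flatStep, h2.head, Instr.exec]
    have := Steps.head s1 ((ih1 _ h1).trans (.head s2 (ih2 o hc)))
    convert this using 1; omega
  | @loopTrue r P Q S l S' S'' t t' hr _ _ ih1 ih2 =>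
    have h1 := hc.tail.right.tail.left
    have h2 := hc.tail.right.tail.right
    have e : o + 1 + P.size + 1 = o + P.size + 2 := by omega
    rw [length_code, e] at h1
    rw [length_code, length_code, e] at h2
    have s1 : flatStep c (o, S) = some (o + P.size + 2, Function.update S r l) := by
      simp [flatStep, hc.head, Instr.exec, hr]
    have s2 : flatStep c (o + P.size + 2 + Q.size, S') = some (o, S') := by
      simp [flatStep, h2.head, Instr.exec]
    have := Steps.head s1 ((ih1 _ h1).trans (.head s2 (ih2 o hc)))
    convert this using 1; omega

/-! ### Turing machines that execute flat code -/

/-- All registers that are used by an instruction are less than `d`. -/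
def Instr.RegLt (d : ℕ) : Instr → Prop
  | .push r _ => r < d
  | .jump _ => True
  | .pop r _ _ _ => r < d

/-- All registers that are used by a program are less than `d`. -/
def RegLt (d : ℕ) : Prog → Prop
  | skip => True
  | push r _ => r < d
  | seq P Q => P.RegLt d ∧ Q.RegLt d
  | case r P Q R => r < d ∧ P.RegLt d ∧ Q.RegLt d ∧ R.RegLt d
  | loop r P Q => r < d ∧ P.RegLt d ∧ Q.RegLt d

theorem RegLt.mono {d d' : ℕ} (h : d ≤ d') {P : Prog} (hP : P.RegLt d) : P.RegLt d' := by
  induction P <;> simp only [RegLt] at hP ⊢ <;> grind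

theorem exists_regLt (P : Prog) : ∃ d, P.RegLt d := by
  induction P with
  | skip => exact ⟨0, trivial⟩
  | push r b => exact ⟨r + 1, Nat.lt_succ_self r⟩
  | seq P Q h1 h2 =>
    obtain ⟨a, h1⟩ := h1
    obtain ⟨b, h2⟩ := h2
    exact ⟨a + b, h1.mono (by omega), h2.mono (by omega)⟩
  | case r P Q R h1 h2 h3 =>
    obtain ⟨a, h1⟩ := h1
    obtain ⟨b, h2⟩ := h2
    obtain ⟨c, h3⟩ := h3
    exact ⟨a + b + c + r + 1, by omega, h1.mono (by omega), h2.mono (by omega),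
      h3.mono (by omega)⟩
  | loop r P Q h1 h2 =>
    obtain ⟨a, h1⟩ := h1
    obtain ⟨b, h2⟩ := h2
    exact ⟨a + b + r + 1, by omega, h1.mono (by omega), h2.mono (by omega)⟩

theorem RegLt.code {d : ℕ} {P : Prog} (h : P.RegLt d) (o : ℕ) :
    ∀ i ∈ P.code o, i.RegLt d := by
  induction P generalizing o with
  | skip => simp [Prog.code]
  | push r b => simpa [Prog.code, Instr.RegLt, RegLt] using h
  | seq P Q h1 h2 =>
    intro i hi
    rcases List.mem_append.1 hi with hi | hi
    exacts [h1 h.1 _ _ hi, h2 h.2 _ _ hi]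
  | case r P Q R h1 h2 h3 =>
    intro i hi
    simp only [Prog.code, List.mem_cons, List.mem_append, List.not_mem_nil, or_false] at hi
    rcases hi with rfl | hi | rfl | hi | rfl | hi | rfl
    exacts [h.1, h1 h.2.1 _ _ hi, trivial, h2 h.2.2.1 _ _ hi, trivial, h3 h.2.2.2 _ _ hi, trivial]
  | loop r P Q h1 h2 =>
    intro i hi
    simp only [Prog.code, List.mem_cons, List.mem_append, List.not_mem_nil, or_false] at hi
    rcases hi with rfl | hi | rfl | hi | rfl
    exacts [h.1, h1 h.2.1 _ _ hi, trivial, h2 h.2.2 _ _ hi, trivial]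

open Turing

/-- The statement of a Turing machine with `d + 1` stacks that executes one instruction. -/
def Instr.stmt (d L : ℕ) : Instr →
    ℕ → TM2.Stmt (fun _ : Fin (d + 1) => Bool) (Fin (L + 1)) (Option Bool)
  | .push r b, pc => .push (Fin.ofNat _ r) (fun _ => b) (.goto fun _ => Fin.ofNat _ (pc + 1))
  | .jump a, _ => .goto fun _ => Fin.ofNat _ a
  | .pop r a b c, _ => .pop (Fin.ofNat _ r) (fun _ x => x) (.goto fun s =>
      match s with
      | none => Fin.ofNat _ a
      | some false => Fin.ofNat _ b
      | some true => Fin.ofNat _ c)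

/-- The Turing machine that executes flat code. -/
def codeTM (c : List Instr) (d : ℕ) (i o : Fin (d + 1)) : FinTM2 where
  K := Fin (d + 1)
  k₀ := i
  k₁ := o
  Γ _ := Bool
  Λ := Fin (c.length + 1)
  main := 0
  σ := Option Bool
  initialState := none
  m l := match getElem? c l.val with
    -- The additional label is the address just behind the code. The internal state is reset before
    -- halting because the configuration `haltList` requires the initial state.
    | none => .load (fun _ => none) .halt
    | some x => x.stmt d c.length l

/-- The configuration of the Turing machine for a configuration of flat code. -/
def toCfg (c : List Instr) (d : ℕ) (i o : Fin (d + 1)) (s : Option Bool) (x : ℕ × Store) :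
    (codeTM c d i o).Cfg where
  l := some (Fin.ofNat (c.length + 1) x.1)
  var := s
  stk := fun r : Fin (d + 1) => x.2 r.val

theorem update_comp_val {d : ℕ} (S : Store) {r : ℕ} (hr : r < d + 1) (l : List Bool) :
    (fun k : Fin (d + 1) => Function.update S r l k) =
      Function.update (fun k : Fin (d + 1) => S k) (Fin.ofNat _ r) l := by
  funext k
  by_cases h : (k : ℕ) = r
  · subst h; simp
  · rw [Function.update_of_ne h, Function.update_of_ne]
    rintro rfl
    simp [Nat.mod_eq_of_lt hr] at h

theorem step_codeTM {c : List Instr} {d : ℕ} (hd : ∀ x ∈ c, x.RegLt (d + 1)) (i o : Fin (d + 1))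
    (s : Option Bool) {x y : ℕ × Store} (h : flatStep c x = some y) :
    ∃ s', (codeTM c d i o).step (toCfg c d i o s x) = some (toCfg c d i o s' y) := by
  obtain ⟨pc, S⟩ := x
  simp only [flatStep, Option.map_eq_some_iff] at h
  obtain ⟨a, ha, rfl⟩ := h
  have hpc : pc < c.length + 1 := by
    have := (List.getElem?_eq_some_iff.1 ha).1; omega
  have hm : (codeTM c d i o).m (Fin.ofNat (c.length + 1) pc) = a.stmt d c.length pc := by
    simp only [codeTM, Fin.val_ofNat, Nat.mod_eq_of_lt hpc, ha]
  have ha' := hd a (List.mem_of_getElem? ha)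
  -- Abstracting the statement lets the step of the machine be unfolded definitionally before the
  -- instruction is known.
  have key : ∀ st : TM2.Stmt (fun _ : Fin (d + 1) => Bool) (Fin (c.length + 1)) (Option Bool),
      (codeTM c d i o).m (Fin.ofNat (c.length + 1) pc) = st →
      (codeTM c d i o).step (toCfg c d i o s (pc, S)) =
        some (TM2.stepAux st s (fun k : Fin (d + 1) => S k.val)) := by
    rintro _ rfl; rfl
  rw [key _ hm]
  cases a with
  | push r b =>
    refine ⟨s, congrArg some ?_⟩
    simp only [Instr.stmt, TM2.stepAux, Instr.exec, toCfg]
    rw [update_comp_val S ha']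
    congr 3
    simp [Nat.mod_eq_of_lt (show r < d + 1 from ha')]
  | jump a => exact ⟨s, rfl⟩
  | pop r a b e =>
    refine ⟨(S r).head?, congrArg some ?_⟩
    have hr : (Fin.ofNat (d + 1) r).val = r := Nat.mod_eq_of_lt ha'
    simp only [Instr.stmt, TM2.stepAux, Instr.exec, toCfg, hr]
    rcases hl : S r with _ | ⟨_ | _, l⟩
    · have : Function.update (fun k : Fin (d + 1) => S k) (Fin.ofNat _ r) [] =
          fun k : Fin (d + 1) => S k.val := by
        rw [← update_comp_val S ha', ← hl, Function.update_eq_self]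
      simp only [List.head?_nil, List.tail_nil]
      exact congrArg (TM2.Cfg.mk _ _) this
    · simp only [List.head?_cons, List.tail_cons]
      exact congrArg (TM2.Cfg.mk _ _) (update_comp_val S ha' l).symm
    · simp only [List.head?_cons, List.tail_cons]
      exact congrArg (TM2.Cfg.mk _ _) (update_comp_val S ha' l).symm

theorem steps_codeTM {c : List Instr} {d : ℕ} (hd : ∀ x ∈ c, x.RegLt (d + 1)) (i o : Fin (d + 1))
    {t : ℕ} {x y : ℕ × Store} (h : Steps (flatStep c) t x y) (s : Option Bool) :
    ∃ s', Steps (codeTM c d i o).step t (toCfg c d i o s x) (toCfg c d i o s' y) := by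
  induction h generalizing s with
  | refl a => exact ⟨s, .refl _⟩
  | head h1 _ ih =>
    obtain ⟨s1, h1⟩ := step_codeTM hd i o s h1
    obtain ⟨s2, h2⟩ := ih s1
    exact ⟨s2, .head h1 h2⟩

theorem Steps.iterate {α : Type*} {f : α → Option α} {t : ℕ} {a b : α} (h : Steps f t a b) :
    (flip bind f)^[t] (some a) = some b := by
  induction h with
  | refl => rfl
  | head h1 _ ih =>
    rw [Function.iterate_succ_apply]
    have : flip bind f (some _) = some _ := h1
    rw [this, ih]

/-- The store in which the register `r` contains `w` and all other registers are empty. -/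
def single (r : ℕ) (w : List Bool) : Store := Function.update (fun _ => []) r w

/-- The extra step is the halting step. All registers except the output have to be empty at the end,
as all stacks but one are empty in `haltList`. -/
theorem Run.outputsInTime {P : Prog} {d : ℕ} (hP : P.RegLt (d + 1)) (i o : Fin (d + 1))
    {w v : List Bool} {t : ℕ} (h : Run P (single i w) t (single o v)) :
    Nonempty (TM2OutputsInTime (codeTM (P.code 0) d i o) w (some v) (t + 1)) := by
  have h1 := h.steps_code (P.code 0) 0 fun i _ => by simp
  obtain ⟨s, h2⟩ := steps_codeTM (hP.code 0) i o h1 none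
  have hlast : (codeTM (P.code 0) d i o).step
      (toCfg (P.code 0) d i o s (0 + P.size, single o v)) =
        some (haltList (codeTM (P.code 0) d i o) v) := by
    have hm : (codeTM (P.code 0) d i o).m (Fin.ofNat ((P.code 0).length + 1) (0 + P.size)) =
        .load (fun _ => none) .halt := by
      have : getElem? (P.code 0) (Fin.ofNat ((P.code 0).length + 1) (0 + P.size)).val = none := by
        simp [length_code]
      simp only [codeTM, this]
    have key : ∀ st : TM2.Stmt (fun _ : Fin (d + 1) => Bool) (Fin ((P.code 0).length + 1))
        (Option Bool), (codeTM (P.code 0) d i o).m (Fin.ofNat _ (0 + P.size)) = st →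
        (codeTM (P.code 0) d i o).step (toCfg (P.code 0) d i o s (0 + P.size, single o v)) =
          some (TM2.stepAux st s (fun k : Fin (d + 1) => single o v k.val)) := by
      rintro _ rfl; rfl
    rw [key _ hm]
    simp only [TM2.stepAux, haltList]
    congr 2
    funext k
    have hk : ∀ k : Fin (d + 1), single o v k.val = if k = o then v else [] := by
      intro k
      simp [single, Function.update_apply, Fin.val_inj]
    rw [hk]
    by_cases hko : k = o
    · subst hko
      simp [codeTM]
      rfl
    · rw [if_neg hko, dif_neg]
      exacts [rfl, hko]
  have hfirst : toCfg (P.code 0) d i o none (0, single i w) =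
      initList (codeTM (P.code 0) d i o) w := by
    simp only [toCfg, initList]
    congr 1
    funext k
    have hk : ∀ k : Fin (d + 1), single i w k.val = if k = i then w else [] := by
      intro k
      simp [single, Function.update_apply, Fin.val_inj]
    rw [hk]
    by_cases hko : k = i
    · subst hko
      simp [codeTM]
      rfl
    · rw [if_neg hko, dif_neg]
      exacts [rfl, hko]
  have h3 := (h2.trans (.one hlast)).iterate
  rw [hfirst] at h3
  exact ⟨⟨⟨t + 1, h3⟩, le_rfl⟩⟩

end Prog

namespace Prog

/-! ### The running time of a program is computable -/

/-- Execution of one instruction on a list of registers. -/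
def Instr.execList : Instr → ℕ × List (List Bool) → ℕ × List (List Bool)
  | .push r b, x => (x.1 + 1, x.2.set r (b :: x.2.getD r []))
  | .jump a, x => (a, x.2)
  | .pop r a b c, x =>
    List.casesOn (motive := fun _ => ℕ × List (List Bool)) (x.2.getD r []) (a, x.2) fun y l =>
      bif y then (c, x.2.set r l) else (b, x.2.set r l)

theorem Instr.primrec_execList (a : Instr) : Primrec a.execList := by
  have hget : ∀ r : ℕ, Primrec fun x : ℕ × List (List Bool) => x.2.getD r [] := fun r =>
    (Primrec.list_getD []).comp Primrec.snd (Primrec.const r)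
  cases a with
  | push r b =>
    exact (Primrec.succ.comp Primrec.fst).pair (Primrec.list_set.comp Primrec.snd
      ((Primrec.const r).pair (Primrec.list_cons.comp (Primrec.const b) (hget r))))
  | jump a => exact (Primrec.const a).pair Primrec.snd
  | pop r a b c =>
    have hset : ∀ e : ℕ, Primrec fun y : (ℕ × List (List Bool)) × Bool × List Bool =>
        (e, y.1.2.set r y.2.2) := fun e =>
      (Primrec.const e).pair (Primrec.list_set.comp (Primrec.snd.comp Primrec.fst)
        ((Primrec.const r).pair (Primrec.snd.comp Primrec.snd)))
    exact Primrec.list_casesOn (hget r) ((Primrec.const a).pair Primrec.snd)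
      (Primrec.cond (Primrec.fst.comp Primrec.snd) (hset c) (hset b)).to₂

/-- One step of flat code on a list of registers. -/
def flatStepList (c : List Instr) (x : ℕ × List (List Bool)) : Option (ℕ × List (List Bool)) :=
  (getElem? c x.1).map fun i => i.execList x

theorem primrec_flatStepList (c : List Instr) : Primrec (flatStepList c) := by
  have key : Primrec fun y : ℕ × (ℕ × List (List Bool)) =>
      (getElem? c y.1).map fun i => i.execList y.2 := by
    induction c with
    | nil => exact (Primrec.const none).of_eq fun y => by simp
    | cons a c ih =>
      refine (Primrec.nat_casesOn (f := fun y : ℕ × (ℕ × List (List Bool)) => y.1)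
        (g := fun y => some (a.execList y.2))
        (h := fun y n => (getElem? c n).map fun i => i.execList y.2) Primrec.fst
        (Primrec.option_some.comp (a.primrec_execList.comp Primrec.snd)) ?_).of_eq ?_
      · exact (ih.comp (Primrec.snd.pair (Primrec.snd.comp Primrec.fst))).to₂
      · rintro ⟨_ | n, y⟩ <;> simp
  exact key.comp (Primrec.fst.pair Primrec.id)

/-- The store given by a list of registers. -/
def ofList (L : List (List Bool)) : Store := fun r => L.getD r []

theorem update_ofList (L : List (List Bool)) {r : ℕ} (hr : r < L.length) (l : List Bool) :
    Function.update (ofList L) r l = ofList (L.set r l) := by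
  funext k
  by_cases h : k = r
  · subst h; simp [ofList, List.getD, hr]
  · rw [Function.update_of_ne h]
    simp [ofList, List.getD, List.getElem?_set_ne (Ne.symm h)]

theorem flatStep_ofList {c : List Instr} {d : ℕ} (hd : ∀ x ∈ c, x.RegLt d) (pc : ℕ)
    (L : List (List Bool)) (hL : L.length = d) :
    flatStep c (pc, ofList L) = (flatStepList c (pc, L)).map fun y => (y.1, ofList y.2) := by
  simp only [flatStep, flatStepList, Option.map_map]
  rcases h : getElem? c pc with _ | a
  · rfl
  · have ha := hd a (List.mem_of_getElem? h)
    simp only [Option.map_some, Function.comp_apply]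
    cases a with
    | push r b =>
      simp only [Instr.exec, Instr.execList]
      rw [update_ofList _ (by rw [hL]; exact ha)]
      rfl
    | jump a => rfl
    | pop r a b e =>
      have hr : r < L.length := by rw [hL]; exact ha
      simp only [Instr.exec, Instr.execList]
      have : ofList L r = L.getD r [] := rfl
      rw [this]
      rcases L.getD r [] with _ | ⟨_ | _, l⟩
      · rfl
      · simp [update_ofList _ hr]
      · simp [update_ofList _ hr]

theorem length_of_flatStepList {c : List Instr} {x y : ℕ × List (List Bool)}
    (h : flatStepList c x = some y) : y.2.length = x.2.length := by
  simp only [flatStepList, Option.map_eq_some_iff] at h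
  obtain ⟨a, -, rfl⟩ := h
  cases a with
  | push r b => simp [Instr.execList]
  | jump a => rfl
  | pop r a b c =>
    simp only [Instr.execList]
    rcases x.2.getD r [] with _ | ⟨_ | _, l⟩ <;> simp

theorem steps_ofList {c : List Instr} {d : ℕ} (hd : ∀ x ∈ c, x.RegLt d) {t : ℕ}
    {x y : ℕ × Store} (h : Steps (flatStep c) t x y) (L : List (List Bool)) (hL : L.length = d)
    (hx : x.2 = ofList L) :
    ∃ L' : List (List Bool), Steps (flatStepList c) t (x.1, L) (y.1, L') := by
  induction h generalizing L with
  | refl a => exact ⟨L, .refl _⟩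
  | @head n a b e h1 _ ih =>
    obtain ⟨pc, S⟩ := a
    simp only at hx
    subst hx
    rw [flatStep_ofList hd pc L hL, Option.map_eq_some_iff] at h1
    obtain ⟨⟨pc', L'⟩, h2, rfl⟩ := h1
    obtain ⟨L'', h3⟩ := ih L' ((length_of_flatStepList h2).trans hL) rfl
    exact ⟨L'', .head h2 h3⟩

/-- Flat code on a list of registers can be simulated primitive recursively for a given number of
steps; lists replace stores here because a store is a function on all of `ℕ`. As every run halts,
unbounded search finds the first time at which the simulation is undefined. A run of length `t`
still has a configuration after `t` steps, so this time is an upper bound. -/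
theorem exists_computable_time (P : Prog) (w : ℕ → List Bool) (hw : Computable w)
    (h : ∀ k, ∃ t S', Run P (single 0 (w k)) t S') :
    ∃ τ : ℕ → ℕ, Computable τ ∧ ∀ k t S', Run P (single 0 (w k)) t S' → t ≤ τ k := by
  obtain ⟨d, hd⟩ := P.exists_regLt
  set c := P.code 0
  -- There is one register more than the program needs, so that the input register exists even if `d
  -- = 0`.
  let init : ℕ → List (List Bool) := fun k => w k :: List.replicate d []
  have hinit : ∀ k, single 0 (w k) = ofList (init k) := by
    intro k
    funext r
    rcases r with _ | r
    · simp [single, ofList, init]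
    · by_cases hr : r < d <;>
        simp [single, ofList, init, List.getD, hr]
  let it : ℕ → ℕ → Option (ℕ × List (List Bool)) := fun k t =>
    (fun o : Option (ℕ × List (List Bool)) => o.bind (flatStepList c))^[t] (some (0, init k))
  have hit : Computable fun x : ℕ × ℕ => it x.1 x.2 := by
    have h1 : Primrec fun y : List Bool × ℕ =>
        (fun o : Option (ℕ × List (List Bool)) => o.bind (flatStepList c))^[y.2]
          (some (0, y.1 :: List.replicate d [])) :=
      Primrec.nat_iterate Primrec.snd
        (Primrec.option_some.comp ((Primrec.const 0).pair
          (Primrec.list_cons.comp Primrec.fst (Primrec.const _))))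
        ((Primrec.option_bind₁ (primrec_flatStepList c)).comp Primrec.snd).to₂
    exact h1.to_comp.comp ((hw.comp Computable.fst).pair Computable.snd)
  have hsteps : ∀ k t S', Run P (single 0 (w k)) t S' →
      ∃ L', it k t = some (P.size, L') := by
    intro k t S' hr
    have h1 := hr.steps_code c 0 fun i _ => by simp [c]
    obtain ⟨L', h2⟩ := steps_ofList (d := d + 1) (fun x hx => (hd.mono (Nat.le_succ d)).code 0 x hx)
      h1 (init k) (by simp [init]) (hinit k)
    have h3 := h2.iterate
    rw [Nat.zero_add] at h3
    exact ⟨L', h3⟩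
  have hhalt : ∀ k, ∃ t, it k t = none := by
    intro k
    obtain ⟨t, S', hr⟩ := h k
    obtain ⟨L', h1⟩ := hsteps k t S' hr
    refine ⟨t + 1, ?_⟩
    simp only [it] at h1 ⊢
    rw [Function.iterate_succ_apply', h1]
    simp [flatStepList, c, length_code]
  have hnone : ∀ k t t', t ≤ t' → it k t = none → it k t' = none := by
    intro k t t' htt h1
    obtain ⟨j, rfl⟩ := Nat.exists_eq_add_of_le htt
    induction j with
    | zero => exact h1
    | succ j ih =>
      have := ih (by omega)
      simp only [it] at this ⊢
      rw [← Nat.add_assoc, Function.iterate_succ_apply', this]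
      rfl
  refine ⟨fun k => Nat.find (hhalt k), ?_, ?_⟩
  · have hp : Computable₂ fun k t => !(it k t).isSome :=
      (Primrec.not.comp Primrec.option_isSome).to_comp.comp hit
    refine (Partrec.rfind hp.partrec₂).of_eq_tot fun k => ?_
    refine Nat.mem_rfind.2 ⟨?_, fun {m} hm => ?_⟩
    · have := Nat.find_spec (hhalt k)
      change true ∈ Part.some (!(it k (Nat.find (hhalt k))).isSome)
      rw [this]
      exact Part.mem_some _
    · have := Nat.find_min (hhalt k) hm
      change false ∈ Part.some (!(it k m).isSome)
      rw [Option.isSome_iff_ne_none.2 this]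
      exact Part.mem_some _
  · intro k t S' hr
    obtain ⟨L', h1⟩ := hsteps k t S' hr
    by_contra hlt
    have := hnone k _ t (not_le.1 hlt).le (Nat.find_spec (hhalt k))
    rw [h1] at this
    exact absurd this (by simp)

end Prog

/-! ### Upper bounds for running times, and basic register programs -/

namespace Prog

/-- `RunsIn P S T S'`: the program `P` transforms the store `S` into `S'` in at most `T` steps. -/
def RunsIn (P : Prog) (S : Store) (T : ℕ) (S' : Store) : Prop := ∃ t ≤ T, Run P S t S'

namespace RunsIn

variable {P Q R : Prog} {S S' S'' : Store} {T T' : ℕ} {r : ℕ} {L : List (List Bool)}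
  {l : List Bool}

theorem mono (h : RunsIn P S T S') (hT : T ≤ T') : RunsIn P S T' S' :=
  let ⟨t, ht, h⟩ := h
  ⟨t, ht.trans hT, h⟩

theorem skip : RunsIn skip S 0 S := ⟨0, le_rfl, .skip S⟩

theorem seq (h : RunsIn P S T S') (h' : RunsIn Q S' T' S'') : RunsIn (P ;; Q) S (T + T') S'' :=
  let ⟨t, ht, h⟩ := h
  let ⟨t', ht', h'⟩ := h'
  ⟨t + t', by omega, h.seq h'⟩

theorem push (b : Bool) (hr : r < L.length) :
    RunsIn (push r b) (ofList L) 1 (ofList (L.set r (b :: L.getD r []))) :=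
  ⟨1, le_rfl, by rw [← update_ofList L hr]; exact .push _ _ _⟩

theorem caseNil (h : L.getD r [] = []) (hP : RunsIn P (ofList L) T S') :
    RunsIn (case r P Q R) (ofList L) (T + 2) S' :=
  let ⟨t, ht, hP⟩ := hP
  ⟨t + 2, by omega, .caseNil h hP⟩

theorem caseFalse (hr : r < L.length) (h : L.getD r [] = false :: l)
    (hQ : RunsIn Q (ofList (L.set r l)) T S') : RunsIn (case r P Q R) (ofList L) (T + 2) S' :=
  let ⟨t, ht, hQ⟩ := hQ
  ⟨t + 2, by omega, .caseFalse h (by rwa [update_ofList L hr])⟩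

theorem caseTrue (hr : r < L.length) (h : L.getD r [] = true :: l)
    (hR : RunsIn R (ofList (L.set r l)) T S') : RunsIn (case r P Q R) (ofList L) (T + 2) S' :=
  let ⟨t, ht, hR⟩ := hR
  ⟨t + 2, by omega, .caseTrue h (by rwa [update_ofList L hr])⟩

theorem loopNil (h : L.getD r [] = []) : RunsIn (loop r P Q) (ofList L) 1 (ofList L) :=
  ⟨1, le_rfl, .loopNil h⟩

theorem loopFalse (hr : r < L.length) (h : L.getD r [] = false :: l)
    (hP : RunsIn P (ofList (L.set r l)) T S') (h' : RunsIn (loop r P Q) S' T' S'') :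
    RunsIn (loop r P Q) (ofList L) (T + T' + 2) S'' :=
  let ⟨t, ht, hP⟩ := hP
  let ⟨t', ht', h'⟩ := h'
  ⟨t + t' + 2, by omega, .loopFalse h (by rwa [update_ofList L hr]) h'⟩

theorem loopTrue (hr : r < L.length) (h : L.getD r [] = true :: l)
    (hQ : RunsIn Q (ofList (L.set r l)) T S') (h' : RunsIn (loop r P Q) S' T' S'') :
    RunsIn (loop r P Q) (ofList L) (T + T' + 2) S'' :=
  let ⟨t, ht, hQ⟩ := hQ
  let ⟨t', ht', h'⟩ := h'
  ⟨t + t' + 2, by omega, .loopTrue h (by rwa [update_ofList L hr]) h'⟩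

end RunsIn

/-- Registers beyond the end of the list count as empty. This is how scratch registers are
introduced before a subroutine and forgotten after it. -/
theorem ofList_append_replicate (L : List (List Bool)) (n : ℕ) :
    ofList (L ++ List.replicate n []) = ofList L := by
  funext r
  by_cases h : r < L.length
  · simp [ofList, List.getD, List.getElem?_append_left h]
  · simp only [ofList, List.getD, List.getElem?_append_right (not_lt.1 h), List.getElem?_replicate,
      List.getElem?_eq_none (not_lt.1 h)]
    split_ifs <;> rfl

/-! ### Renaming registers -/

/-- Add `d` to all register numbers. -/
def shift (d : ℕ) : Prog → Prog
  | .skip => .skip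
  | .push r b => .push (d + r) b
  | .seq P Q => .seq (P.shift d) (Q.shift d)
  | .case r P Q R => .case (d + r) (P.shift d) (Q.shift d) (R.shift d)
  | .loop r P Q => .loop (d + r) (P.shift d) (Q.shift d)

/-- The store that agrees with `S` below `d`, and with a shift of `S'` from `d` on. -/
def glue (d : ℕ) (S S' : Store) : Store := fun r => if r < d then S r else S' (r - d)

@[simp] theorem glue_add (d : ℕ) (S S' : Store) (r : ℕ) : glue d S S' (d + r) = S' r := by
  simp [glue]

theorem glue_of_lt {d r : ℕ} (S S' : Store) (h : r < d) : glue d S S' r = S r := by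
  simp [glue, h]

theorem update_glue (d : ℕ) (S S' : Store) (r : ℕ) (l : List Bool) :
    Function.update (glue d S S') (d + r) l = glue d S (Function.update S' r l) := by
  funext k
  simp only [Function.update_apply, glue]
  split_ifs <;> first | rfl | omega

/-- Subroutine calls rest on this: a program moved up by `d` registers runs as before and leaves the
registers below `d` untouched. -/
theorem Run.shift {P : Prog} {S S' : Store} {t : ℕ} (h : Run P S t S') (d : ℕ) (S₀ : Store) :
    Run (P.shift d) (glue d S₀ S) t (glue d S₀ S') := by
  induction h with
  | skip S => exact .skip _
  | push r b S => rw [← update_glue, ← glue_add d S₀ S r]; exact .push _ _ _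
  | seq _ _ h1 h2 => exact .seq h1 h2
  | caseNil hr _ ih => exact .caseNil (by rwa [glue_add]) ih
  | caseFalse hr _ ih => exact .caseFalse (by rwa [glue_add]) (by rwa [update_glue])
  | caseTrue hr _ ih => exact .caseTrue (by rwa [glue_add]) (by rwa [update_glue])
  | loopNil hr => exact .loopNil (by rwa [glue_add])
  | loopFalse hr _ _ h1 h2 => exact .loopFalse (by rwa [glue_add]) (by rwa [update_glue]) h2
  | loopTrue hr _ _ h1 h2 => exact .loopTrue (by rwa [glue_add]) (by rwa [update_glue]) h2

theorem RunsIn.shift {P : Prog} {S S' : Store} {T : ℕ} (h : RunsIn P S T S') (d : ℕ)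
    (S₀ : Store) : RunsIn (P.shift d) (glue d S₀ S) T (glue d S₀ S') :=
  let ⟨t, ht, h⟩ := h
  ⟨t, ht, h.shift d S₀⟩

theorem glue_ofList (A L : List (List Bool)) :
    glue A.length (ofList A) (ofList L) = ofList (A ++ L) := by
  funext r
  by_cases h : r < A.length
  · rw [glue_of_lt _ _ h]
    simp [ofList, List.getD, List.getElem?_append_left h]
  · obtain ⟨k, rfl⟩ := Nat.exists_eq_add_of_le (not_lt.1 h)
    rw [glue_add]
    simp [ofList, List.getD, List.getElem?_append_right]

theorem RunsIn.shift_ofList {P : Prog} {L L' : List (List Bool)} {T : ℕ}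
    (h : RunsIn P (ofList L) T (ofList L')) (A : List (List Bool)) :
    RunsIn (P.shift A.length) (ofList (A ++ L)) T (ofList (A ++ L')) := by
  rw [← glue_ofList, ← glue_ofList]; exact h.shift _ _

/-! ### Moving and copying -/

/-- Move the content of `a` to `b`, reversing it. -/
def move (a b : ℕ) : Prog := loop a (.push b false) (.push b true)

theorem runsIn_move_store {a b : ℕ} (hab : a ≠ b) (S : Store) :
    RunsIn (move a b) S (3 * (S a).length + 1)
      (Function.update (Function.update S a []) b ((S a).reverse ++ S b)) := by
  generalize hl : S a = l
  induction l generalizing S with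
  | nil =>
    refine ⟨1, le_rfl, ?_⟩
    rw [← hl, Function.update_eq_self, hl, List.reverse_nil, List.nil_append,
      Function.update_eq_self]
    exact .loopNil hl
  | cons x l ih =>
    obtain ⟨t, ht, h⟩ := ih (Function.update (Function.update S a l) b (x :: S b))
      (by rw [Function.update_of_ne hab, Function.update_self])
    have h1 : Run (.push b x) (Function.update S a l) 1
        (Function.update (Function.update S a l) b (x :: S b)) := by
      have := Run.push b x (Function.update S a l)
      rwa [Function.update_of_ne hab.symm] at this
    have e : Function.update (Function.update (Function.update (Function.update S a l) b
        (x :: S b)) a []) b (l.reverse ++ Function.update (Function.update S a l) b (x :: S b) b) =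
        Function.update (Function.update S a []) b ((x :: l).reverse ++ S b) := by
      funext k
      simp only [Function.update_apply]
      split_ifs <;> simp
    rw [e] at h
    cases x
    · exact ⟨_, by simp; omega, .loopFalse hl h1 h⟩
    · exact ⟨_, by simp; omega, .loopTrue hl h1 h⟩

theorem runsIn_move {a b : ℕ} {L : List (List Bool)} (ha : a < L.length) (hb : b < L.length)
    (hab : a ≠ b) :
    RunsIn (move a b) (ofList L) (3 * (L.getD a []).length + 1)
      (ofList ((L.set a []).set b ((L.getD a []).reverse ++ L.getD b []))) := by
  have := runsIn_move_store hab (ofList L)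
  rwa [update_ofList L ha, update_ofList _ (by simpa using hb)] at this

/-- Copy register `a` to register `b`, with the help of the empty register `c`. -/
def copyTo (a b c : ℕ) : Prog :=
  move a c ;; loop c (.push a false ;; .push b false) (.push a true ;; .push b true)

/-- The string is reversed on the way to `c` and again on the way back, so both copies have the
original order. A bit costs 3 steps on the way out and 4 on the way back. -/
theorem runsIn_copyTo_store {a b c : ℕ} (hab : a ≠ b) (hac : a ≠ c) (hbc : b ≠ c) (S : Store)
    (hS : S c = []) :
    RunsIn (copyTo a b c) S (7 * (S a).length + 2) (Function.update S b (S a ++ S b)) := by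
  have h : ∀ (l : List Bool) (S : Store), S c = l → RunsIn (loop c (.push a false ;; .push b false)
      (.push a true ;; .push b true)) S (4 * l.length + 1)
      (Function.update (Function.update (Function.update S c []) a (l.reverse ++ S a)) b
        (l.reverse ++ S b)) := by
    intro l
    induction l with
    | nil =>
      intro S hl
      refine ⟨1, le_rfl, ?_⟩
      rw [← hl, Function.update_eq_self, hl, List.reverse_nil, List.nil_append,
        List.nil_append, Function.update_eq_self, Function.update_eq_self]
      exact .loopNil hl
    | cons x l ih =>
      intro S hl
      obtain ⟨t, ht, h⟩ := ih (Function.update (Function.update (Function.update S c l) a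
        (x :: S a)) b (x :: S b))
        (by rw [Function.update_of_ne hbc.symm, Function.update_of_ne hac.symm,
          Function.update_self])
      have h1 : Run (.push a x ;; .push b x) (Function.update S c l) (1 + 1)
          (Function.update (Function.update (Function.update S c l) a (x :: S a)) b (x :: S b)) := by
        have h2 := Run.push a x (Function.update S c l)
        rw [Function.update_of_ne hac] at h2
        have h3 := Run.push b x (Function.update (Function.update S c l) a (x :: S a))
        rw [Function.update_of_ne hab.symm, Function.update_of_ne hbc] at h3
        exact h2.seq h3
      have e : ∀ S' : Store, S' = Function.update (Function.update (Function.update S c l) a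
          (x :: S a)) b (x :: S b) →
          Function.update (Function.update (Function.update S' c []) a (l.reverse ++ S' a)) b
          (l.reverse ++ S' b) = Function.update (Function.update (Function.update S c []) a
            ((x :: l).reverse ++ S a)) b ((x :: l).reverse ++ S b) := by
        rintro _ rfl
        funext k
        simp only [Function.update_apply]
        split_ifs <;> simp_all
      rw [e _ rfl] at h
      cases x
      · exact ⟨_, by simp; omega, .loopFalse hl h1 h⟩
      · exact ⟨_, by simp; omega, .loopTrue hl h1 h⟩
  have h1 := (runsIn_move_store hac S).seq (h (S a).reverse _ (by simp [hS]))
  have e : Function.update (Function.update (Function.update (Function.update (Function.update S a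
      []) c ((S a).reverse ++ S c)) c []) a ((S a).reverse.reverse ++
        Function.update (Function.update S a []) c ((S a).reverse ++ S c) a)) b
      ((S a).reverse.reverse ++ Function.update (Function.update S a []) c
        ((S a).reverse ++ S c) b) = Function.update S b (S a ++ S b) := by
    funext k
    simp only [Function.update_apply]
    split_ifs <;> simp_all
  rw [e] at h1
  exact h1.mono (by simp; omega)

theorem runsIn_copyTo {a b c : ℕ} {L : List (List Bool)} (hab : a ≠ b) (hac : a ≠ c) (hbc : b ≠ c)
    (hb : b < L.length) (hc : L.getD c [] = []) :
    RunsIn (copyTo a b c) (ofList L) (7 * (L.getD a []).length + 2)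
      (ofList (L.set b (L.getD a [] ++ L.getD b []))) := by
  have := runsIn_copyTo_store hab hac hbc (ofList L) hc
  rwa [update_ofList L hb] at this

/-- Empty the register `a`. -/
def clear (a : ℕ) : Prog := loop a .skip .skip

theorem runsIn_clear {a : ℕ} {L : List (List Bool)} (ha : a < L.length) :
    RunsIn (clear a) (ofList L) (2 * (L.getD a []).length + 1) (ofList (L.set a [])) := by
  generalize hl : L.getD a [] = l
  induction l generalizing L with
  | nil =>
    have : L.set a [] = L := by
      rw [← hl, List.getD_eq_getElem _ _ ha, List.set_getElem_self]
    rw [this]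
    exact .loopNil hl
  | cons x l ih =>
    have h2 := ih (L := L.set a l) (by simpa) (by simp [List.getD, ha])
    rw [List.set_set] at h2
    cases x
    · exact (RunsIn.loopFalse ha hl .skip h2).mono (by simp; omega)
    · exact (RunsIn.loopTrue ha hl .skip h2).mono (by simp; omega)

/-- Pop a block of `true`s and the `false` that ends it from register `0`, and push the `true`s to
register `1`. -/
def takeOnes : Prog :=
  .push 2 true ;; loop 2 .skip (.case 0 .skip .skip (.push 1 true ;; .push 2 true))

/-- Register `2` serves as the flag of a while loop: the test pops it, and it is pushed again only
if another `true` was found. The second alternative covers the empty list, whose head is `0` by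
default in `Turing.ToPartrec.Code`. -/
theorem runsIn_takeOnes_loop (n : ℕ) (l l' m : List Bool)
    (hl : l = List.replicate n true ++ false :: l' ∨ n = 0 ∧ l = [] ∧ l' = []) :
    RunsIn (loop 2 .skip (.case 0 .skip .skip (.push 1 true ;; .push 2 true)))
      (ofList [l, m, [true]]) (6 * n + 5) (ofList [l', List.replicate n true ++ m, []]) := by
  induction n generalizing l m with
  | zero =>
    rcases hl with rfl | ⟨-, rfl, rfl⟩
    · exact RunsIn.loopTrue (r := 2) (by simp) rfl
        (RunsIn.caseFalse (r := 0) (by simp) rfl RunsIn.skip) (RunsIn.loopNil rfl)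
    · exact RunsIn.loopTrue (r := 2) (by simp) rfl
        (RunsIn.caseNil (r := 0) rfl RunsIn.skip) (RunsIn.loopNil rfl)
  | succ n ih =>
    rcases hl with rfl | ⟨h, -⟩
    · have := ih _ (true :: m) (.inl rfl)
      rw [show List.replicate n true ++ true :: m = List.replicate (n + 1) true ++ m by
        rw [List.replicate_succ']; simp] at this
      exact (RunsIn.loopTrue (r := 2) (by simp) rfl (RunsIn.caseTrue (r := 0) (by simp) rfl
        ((RunsIn.push (r := 1) true (by simp)).seq (RunsIn.push (r := 2) true (by simp))))
        this).mono (by omega)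
    · omega

theorem runsIn_takeOnes (n : ℕ) (l l' m : List Bool)
    (hl : l = List.replicate n true ++ false :: l' ∨ n = 0 ∧ l = [] ∧ l' = []) :
    RunsIn takeOnes (ofList [l, m]) (6 * n + 6) (ofList [l', List.replicate n true ++ m]) := by
  rw [← ofList_append_replicate [l, m] 1, ← ofList_append_replicate [l', _] 1]
  exact ((RunsIn.push (r := 2) true (by simp)).seq
    (runsIn_takeOnes_loop n l l' m hl)).mono (by omega)

/-! ### Computable functions -/

/-- The encoding of a list of natural numbers in a register. -/
def enc : List ℕ → List Bool
  | [] => []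
  | n :: v => List.replicate n true ++ false :: enc v

theorem enc_eq (v : List ℕ) :
    enc v = List.replicate v.headI true ++ false :: enc v.tail ∨
      v.headI = 0 ∧ enc v = [] ∧ enc v.tail = [] := by
  cases v <;> simp [enc]

/-- Move register `1` to register `0`, which has to be empty. -/
def lower : Prog := move 1 2 ;; move 2 0

theorem runsIn_lower (l : List Bool) :
    RunsIn lower (ofList [[], l]) (6 * l.length + 2) (ofList [l]) := by
  have h1 := runsIn_move (a := 1) (b := 2) (L := [[], l, []]) (by simp) (by simp) (by simp)
  have h2 := runsIn_move (a := 2) (b := 0) (L := [[], [], l.reverse ++ []])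
    (by simp) (by simp) (by simp)
  have h3 := h1.seq h2
  simp only [List.append_nil] at h3
  rw [← ofList_append_replicate [[], l] 1, ← ofList_append_replicate [l] 2]
  have e : (([[], [], l.reverse].set 2 []).set 0
      (([[], [], l.reverse].getD 2 []).reverse ++ [[], [], l.reverse].getD 0 [])) =
      [l, [], []] := by simp
  rw [e] at h3
  exact h3.mono (by simp; omega)

-- Induction on the code, with one program per constructor. Only termination is needed here, because
-- `exists_computable_time` supplies a time bound afterwards.
open Turing.ToPartrec in
theorem exists_prog_code (c : Code) : ∃ P : Prog, ∀ v w, w ∈ c.eval v →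
    ∃ T, RunsIn P (ofList [enc v]) T (ofList [enc w]) := by
  induction c with
  | zero' =>
    refine ⟨.push 0 false, fun v w h => ⟨1, ?_⟩⟩
    simp only [Code.zero'_eval, Part.pure_eq_some, Part.mem_some_iff] at h
    subst h
    exact RunsIn.push (r := 0) false (by simp)
  | succ =>
    refine ⟨takeOnes ;; clear 0 ;; .push 0 false ;; .push 0 true ;; move 1 0, fun v w h => ?_⟩
    simp only [Code.succ_eval, Part.pure_eq_some, Part.mem_some_iff] at h
    subst h
    have h1 := runsIn_takeOnes _ _ _ [] (enc_eq v)
    have h2 := h1.seq ((runsIn_clear (a := 0) (by simp)).seq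
      ((RunsIn.push (r := 0) false (by simp)).seq ((RunsIn.push (r := 0) true (by simp)).seq
        (runsIn_move (a := 1) (b := 0) (by simp) (by simp) (by simp)))))
    obtain ⟨t, -, h2⟩ := h2
    refine ⟨t, t, le_rfl, ?_⟩
    convert h2 using 1
    · exact (ofList_append_replicate [enc v] 1).symm
    rw [← ofList_append_replicate [enc _] 1]
    congr 1
    simp [enc, List.replicate_succ']
  | tail =>
    refine ⟨takeOnes ;; clear 1, fun v w h => ?_⟩
    simp only [Code.tail_eval, Part.pure_eq_some, Part.mem_some_iff] at h
    subst h
    rw [← ofList_append_replicate [enc v] 1, ← ofList_append_replicate [enc v.tail] 1]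
    exact ⟨_, (runsIn_takeOnes _ _ _ [] (enc_eq v)).seq (runsIn_clear (a := 1) (by simp))⟩
  | cons f fs ihf ihs =>
    obtain ⟨P, hP⟩ := ihf
    obtain ⟨Q, hQ⟩ := ihs
    -- Register `0` preserves `v` while `P` works above it. The head of the result of `P` is then
    -- exchanged with `v`, waits in register `0` in unary while `Q` works on `v`, and is finally put
    -- in front of the result of `Q`.
    refine ⟨copyTo 0 1 2 ;; P.shift 1 ;; takeOnes.shift 1 ;; clear 1 ;; move 0 3 ;; move 2 0 ;;
      move 3 1 ;; Q.shift 1 ;; .push 1 false ;; move 0 1 ;; lower, fun v w h => ?_⟩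
    simp only [Code.cons_eval, Part.bind_eq_bind, Part.mem_bind_iff, Part.pure_eq_some,
      Part.mem_some_iff] at h
    obtain ⟨a, ha, b, hb, rfl⟩ := h
    obtain ⟨T1, h1⟩ := hP v a ha
    obtain ⟨T2, h2⟩ := hQ v b hb
    have s1 := runsIn_copyTo (a := 0) (b := 1) (c := 2) (L := [enc v, []]) (by simp) (by simp)
      (by simp) (by simp) rfl
    have e1 : ofList [enc v, []] = ofList [enc v] := ofList_append_replicate [enc v] 1
    have e2 : ofList ([enc v, []].set 1 ([enc v, []].getD 0 [] ++ [enc v, []].getD 1 [])) =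
        ofList [enc v, enc v] := by simp
    rw [e1, e2] at s1
    have s2 : RunsIn (P.shift 1) (ofList [enc v, enc v]) T1 (ofList [enc v, enc a]) :=
      h1.shift_ofList [enc v]
    have s3 : RunsIn (takeOnes.shift 1) (ofList [enc v, enc a]) (6 * a.headI + 6)
        (ofList [enc v, enc a.tail, List.replicate a.headI true]) := by
      have := (runsIn_takeOnes _ _ _ [] (enc_eq a)).shift_ofList [enc v]
      rw [List.append_nil] at this
      rw [← ofList_append_replicate [enc v, enc a] 1]
      exact this
    have s4 := runsIn_clear (a := 1) (L := [enc v, enc a.tail, List.replicate a.headI true, []])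
      (by simp)
    have s5 := runsIn_move (a := 0) (b := 3) (L := [enc v, [], List.replicate a.headI true, []])
      (by simp) (by simp) (by simp)
    have s6 := runsIn_move (a := 2) (b := 0)
      (L := [[], [], List.replicate a.headI true, (enc v).reverse ++ []])
      (by simp) (by simp) (by simp)
    have s7 := runsIn_move (a := 3) (b := 1)
      (L := [(List.replicate a.headI true).reverse ++ [], [], [], (enc v).reverse ++ []])
      (by simp) (by simp) (by simp)
    have e7 : ([(List.replicate a.headI true).reverse ++ [], [], [],
        (enc v).reverse ++ []].set 3 []).set 1
        (((enc v).reverse ++ []).reverse ++ []) =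
        [List.replicate a.headI true, enc v] ++ List.replicate 2 [] := by simp
    have s7' := s7
    rw [show [(List.replicate a.headI true).reverse ++ [], [], [],
        (enc v).reverse ++ []].getD 3 [] = (enc v).reverse ++ [] from rfl,
      show [(List.replicate a.headI true).reverse ++ [], [], [],
        (enc v).reverse ++ []].getD 1 [] = [] from rfl, e7, ofList_append_replicate] at s7'
    have s8 : RunsIn (Q.shift 1) (ofList [List.replicate a.headI true, enc v]) T2
        (ofList [List.replicate a.headI true, enc b]) :=
      h2.shift_ofList [List.replicate a.headI true]
    have s9 := RunsIn.push (r := 1) (L := [List.replicate a.headI true, enc b]) false (by simp)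
    have s10 := runsIn_move (a := 0) (b := 1) (L := [List.replicate a.headI true, false :: enc b])
      (by simp) (by simp) (by simp)
    have s11 : RunsIn lower (ofList [[], (List.replicate a.headI true).reverse ++ false :: enc b])
        (6 * (List.replicate a.headI true ++ false :: enc b).length + 2)
        (ofList [enc (a.headI :: b)]) := by
      rw [List.reverse_replicate]
      exact runsIn_lower _
    rw [ofList_append_replicate [enc v, enc a.tail, List.replicate a.headI true] 1 |>.symm] at s3
    exact ⟨_, s1.seq <| s2.seq <| s3.seq <| s4.seq <| s5.seq <| s6.seq <| s7'.seq <| s8.seq <|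
      s9.seq <| s10.seq s11⟩
  | comp f g ihf ihg =>
    obtain ⟨P, hP⟩ := ihf
    obtain ⟨Q, hQ⟩ := ihg
    refine ⟨Q ;; P, fun v w h => ?_⟩
    rw [Code.comp_eval] at h
    replace h : w ∈ (g.eval v).bind f.eval := h
    replace h := Part.mem_bind_iff.1 h
    obtain ⟨a, ha, hw⟩ := h
    obtain ⟨T1, h1⟩ := hQ v a ha
    obtain ⟨T2, h2⟩ := hP a w hw
    exact ⟨_, h1.seq h2⟩
  | case f g ihf ihg =>
    obtain ⟨P, hP⟩ := ihf
    obtain ⟨Q, hQ⟩ := ihg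
    -- The pop does the work: an empty register and a leading `false` both mean that the head is
    -- zero and leave the tail, while popping a leading `true` decrements the head.
    refine ⟨.case 0 P P Q, fun v w h => ?_⟩
    rw [Code.case_eval] at h
    rcases v with _ | ⟨_ | n, v⟩
    · obtain ⟨T, hT⟩ := hP _ w h
      exact ⟨_, .caseNil rfl hT⟩
    · obtain ⟨T, hT⟩ := hP _ w h
      exact ⟨_, .caseFalse (r := 0) (by simp) rfl hT⟩
    · obtain ⟨T, hT⟩ := hQ _ w h
      exact ⟨_, .caseTrue (r := 0) (by simp) rfl hT⟩
  | fix f ih =>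
    obtain ⟨P, hP⟩ := ih
    -- Register `0` is the flag for another iteration and the argument lives in register `1`. The
    -- flag is set again exactly if the head of the result of `P` is nonzero; in both cases the head
    -- is removed.
    refine ⟨move 0 2 ;; move 2 1 ;; .push 0 true ;; loop 0 .skip (P.shift 1 ;; .case 1 .skip .skip
      (takeOnes.shift 1 ;; clear 2 ;; .push 0 true)) ;; lower, fun v w h => ?_⟩
    have hloop : ∃ T, RunsIn (loop 0 .skip (P.shift 1 ;; .case 1 .skip .skip
        (takeOnes.shift 1 ;; clear 2 ;; .push 0 true))) (ofList [[true], enc v]) T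
        (ofList [[], enc w]) := by
      rw [Code.fix_eval] at h
      refine PFun.fixInduction' (C := fun v => ∃ T, RunsIn (loop 0 .skip (P.shift 1 ;;
        .case 1 .skip .skip (takeOnes.shift 1 ;; clear 2 ;; .push 0 true)))
        (ofList [[true], enc v]) T (ofList [[], enc w])) h ?_ ?_
      · intro a ha
        rw [Part.mem_map_iff] at ha
        obtain ⟨b, hb, hb'⟩ := ha
        obtain ⟨T, hT⟩ := hP a b hb
        have s1 : RunsIn (P.shift 1) (ofList [[], enc a]) T (ofList [[], enc b]) :=
          hT.shift_ofList [[]]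
        split_ifs at hb' with h0
        · cases hb'
          rcases b with _ | ⟨_ | n, b⟩
          · exact ⟨_, .loopTrue (r := 0) (by simp) rfl (s1.seq (.caseNil (r := 1) rfl .skip))
              (.loopNil rfl)⟩
          · exact ⟨_, .loopTrue (r := 0) (by simp) rfl
              (s1.seq (.caseFalse (r := 1) (by simp) rfl .skip)) (.loopNil rfl)⟩
          · simp at h0
      · intro a₀ a₁ _ ha ⟨T', hT'⟩
        rw [Part.mem_map_iff] at ha
        obtain ⟨b, hb, hb'⟩ := ha
        obtain ⟨T, hT⟩ := hP a₀ b hb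
        have s1 : RunsIn (P.shift 1) (ofList [[], enc a₀]) T (ofList [[], enc b]) :=
          hT.shift_ofList [[]]
        split_ifs at hb' with h0
        cases hb'
        rcases b with _ | ⟨_ | n, b⟩
        · simp at h0
        · simp at h0
        · have s2 := (runsIn_takeOnes n _ (enc b) [] (.inl rfl)).shift_ofList [[]]
          have s3 := runsIn_clear (a := 2) (L := [[], enc b, List.replicate n true ++ []])
            (by simp)
          have s4 := RunsIn.push (r := 0) (L := [[], enc b, []]) true (by simp)
          have s5 := s2.seq (s3.seq s4)
          have e1 : ofList ([[]] ++ [List.replicate n true ++ false :: enc b, []]) =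
              ofList [[], List.replicate n true ++ false :: enc b] :=
            ofList_append_replicate [[], List.replicate n true ++ false :: enc b] 1
          have e2 : ofList ([[], enc b, []].set 0 (true :: [[], enc b, []].getD 0 [])) =
              ofList [[true], enc b] := ofList_append_replicate [[true], enc b] 1
          rw [e1, e2] at s5
          exact ⟨_, .loopTrue (r := 0) (by simp) rfl
            (s1.seq (.caseTrue (r := 1) (by simp) rfl s5)) hT'⟩
    obtain ⟨T, hT⟩ := hloop
    have s1 := runsIn_move (a := 0) (b := 2) (L := [enc v, [], []]) (by simp) (by simp) (by simp)
    have s2 := runsIn_move (a := 2) (b := 1) (L := [[], [], (enc v).reverse ++ []])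
      (by simp) (by simp) (by simp)
    have s3 := RunsIn.push (r := 0) (L := [[], enc v, []]) true (by simp)
    have e1 : ([[], [], (enc v).reverse ++ []].set 2 []).set 1
        (((enc v).reverse ++ []).reverse ++ []) = [[], enc v, []] := by simp
    have s2' := s2
    rw [show [[], [], (enc v).reverse ++ []].getD 2 [] = (enc v).reverse ++ [] from rfl,
      show [[], [], (enc v).reverse ++ []].getD 1 [] = [] from rfl, e1] at s2'
    have e2 : ofList ([[], enc v, []].set 0 (true :: [[], enc v, []].getD 0 [])) =
        ofList [[true], enc v] := ofList_append_replicate [[true], enc v] 1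
    rw [e2] at s3
    rw [← ofList_append_replicate [enc v] 2]
    exact ⟨_, s1.seq <| s2'.seq <| s3.seq <| hT.seq (runsIn_lower _)⟩

open Turing.ToPartrec in
theorem exists_prog_computable {f : ℕ → ℕ} (hf : Computable f) :
    ∃ (P : Prog) (τ : ℕ → ℕ), Computable τ ∧
      ∀ k, RunsIn P (ofList [enc [k]]) (τ k) (ofList [enc [f k]]) := by
  obtain ⟨c, hc⟩ := Code.exists_code (Nat.Partrec'.part_iff₁.2 hf.partrec)
  obtain ⟨P, hP⟩ := exists_prog_code c
  have hrun : ∀ k, ∃ T, RunsIn P (ofList [enc [k]]) T (ofList [enc [f k]]) := by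
    intro k
    refine hP [k] [f k] ?_
    have := hc (k ::ᵥ List.Vector.nil)
    simp only [List.Vector.head_cons, PFun.coe_val, Part.map_eq_map, Part.map_some] at this
    change c.eval [k] = _ at this
    rw [this]
    exact Part.mem_some _
  have hs : ∀ w, ofList [w] = single 0 w := by
    intro w
    funext r
    rcases r with _ | r <;> simp [ofList, single, List.getD]
  have henc : Computable fun k => enc [k] := by
    have h1 : Primrec fun k => (List.range k).map fun _ => true :=
      Primrec.list_map Primrec.list_range (Primrec₂.const true)
    refine ((Primrec.list_append.comp h1 (Primrec.const [false])).of_eq fun k => ?_).to_comp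
    simp [enc]
  obtain ⟨τ, hτ, h⟩ := exists_computable_time P (fun k => enc [k]) henc fun k => by
    obtain ⟨T, t, -, hr⟩ := hrun k
    exact ⟨t, _, by rwa [← hs]⟩
  refine ⟨P, τ, hτ, fun k => ?_⟩
  obtain ⟨T, t, -, hr⟩ := hrun k
  exact ⟨t, h k t _ (by rwa [← hs]), hr⟩

end Prog

namespace Prog

/-! ### Binary arithmetic -/

/-- The number with the given binary digits, the least significant digit first. -/
def val : List Bool → ℕ
  | [] => 0
  | b :: l => b.toNat + 2 * val l

theorem val_append (l l' : List Bool) : val (l ++ l') = val l + 2 ^ l.length * val l' := by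
  induction l with
  | nil => simp [val]
  | cons b l ih => simp [val, ih, pow_succ]; ring

theorem val_lt (l : List Bool) : val l < 2 ^ l.length := by
  induction l with
  | nil => simp [val]
  | cons b l ih =>
    have := b.toNat_le
    simp only [val, List.length_cons, pow_succ]; omega

/-- The output and the final state of a finite automaton with output that reads two strings, which
are padded to the same length by `false`. -/
def mealy (δ : Bool → Bool → Bool → Bool × Bool) :
    Bool → List Bool → List Bool → List Bool × Bool
  | s, [], [] => ([], s)
  | s, x :: a, [] =>
    ((δ s x false).1 :: (mealy δ (δ s x false).2 a []).1, (mealy δ (δ s x false).2 a []).2)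
  | s, [], y :: b =>
    ((δ s false y).1 :: (mealy δ (δ s false y).2 [] b).1, (mealy δ (δ s false y).2 [] b).2)
  | s, x :: a, y :: b =>
    ((δ s x y).1 :: (mealy δ (δ s x y).2 a b).1, (mealy δ (δ s x y).2 a b).2)

theorem length_mealy (δ : Bool → Bool → Bool → Bool × Bool) (s : Bool) (a b : List Bool) :
    (mealy δ s a b).1.length = max a.length b.length := by
  induction s, a, b using mealy.induct δ <;> simp_all [mealy]

/-- One step of the automaton; register `2` contains the state, register `3` the reversed output. -/
def mealyStep (δ : Bool → Bool → Bool → Bool × Bool) (x y : Bool) : Prog :=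
  .case 2 .skip (.push 3 (δ false x y).1 ;; .push 2 (δ false x y).2)
    (.push 3 (δ true x y).1 ;; .push 2 (δ true x y).2)

/-- The automaton as a program. -/
def mealyProg (δ : Bool → Bool → Bool → Bool × Bool) : Prog :=
  .loop 0
    (.case 1 (mealyStep δ false false) (mealyStep δ false false) (mealyStep δ false true))
    (.case 1 (mealyStep δ true false) (mealyStep δ true false) (mealyStep δ true true)) ;;
  .loop 1 (mealyStep δ false false) (mealyStep δ false true)

theorem runsIn_mealyStep (δ : Bool → Bool → Bool → Bool × Bool) (s x y : Bool)
    (a b c : List Bool) : RunsIn (mealyStep δ x y) (ofList [a, b, [s], c]) 4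
      (ofList [a, b, [(δ s x y).2], (δ s x y).1 :: c]) := by
  cases s
  · exact RunsIn.caseFalse (r := 2) (by simp) rfl ((RunsIn.push (r := 3) _ (by simp)).seq
      (RunsIn.push (r := 2) _ (by simp)))
  · exact RunsIn.caseTrue (r := 2) (by simp) rfl ((RunsIn.push (r := 3) _ (by simp)).seq
      (RunsIn.push (r := 2) _ (by simp)))

theorem runsIn_mealyProg (δ : Bool → Bool → Bool → Bool × Bool) (s : Bool) (a b c : List Bool) :
    RunsIn (mealyProg δ) (ofList [a, b, [s], c]) (8 * (a.length + b.length) + 2)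
      (ofList [[], [], [(mealy δ s a b).2], (mealy δ s a b).1.reverse ++ c]) := by
  have h2 : ∀ s b c, RunsIn (.loop 1 (mealyStep δ false false) (mealyStep δ false true))
      (ofList [[], b, [s], c]) (8 * b.length + 1)
      (ofList [[], [], [(mealy δ s [] b).2], (mealy δ s [] b).1.reverse ++ c]) := by
    intro s b
    induction b generalizing s with
    | nil => intro c; simpa [mealy] using RunsIn.loopNil (r := 1) (L := [[], [], [s], c]) rfl
    | cons y b ih =>
      intro c
      have h := ih (δ s false y).2 ((δ s false y).1 :: c)
      simp only [mealy, List.reverse_cons, List.append_assoc, List.singleton_append]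
      cases y
      · exact (RunsIn.loopFalse (r := 1) (by simp) rfl
          (runsIn_mealyStep δ s false false [] b c) h).mono (by simp; omega)
      · exact (RunsIn.loopTrue (r := 1) (by simp) rfl
          (runsIn_mealyStep δ s false true [] b c) h).mono (by simp; omega)
  -- The first loop stops when `a` is exhausted. Whatever remains of `b` is left to the second loop,
  -- started from the state and output reached so far.
  suffices h : ∃ b' s' c', RunsIn (.loop 0
      (.case 1 (mealyStep δ false false) (mealyStep δ false false) (mealyStep δ false true))
      (.case 1 (mealyStep δ true false) (mealyStep δ true false) (mealyStep δ true true)))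
      (ofList [a, b, [s], c]) (8 * a.length + 1) (ofList [[], b', [s'], c']) ∧
      b'.length ≤ b.length ∧ (mealy δ s a b).2 = (mealy δ s' [] b').2 ∧
      (mealy δ s a b).1.reverse ++ c = (mealy δ s' [] b').1.reverse ++ c' by
    obtain ⟨b', s', c', h, hb, h3, h4⟩ := h
    rw [h3, h4]
    exact (h.seq (h2 s' b' c')).mono (by omega)
  induction a generalizing s b c with
  | nil => exact ⟨b, s, c, .loopNil rfl, le_rfl, rfl, rfl⟩
  | cons x a ih =>
    rcases b with _ | ⟨y, b⟩
    · obtain ⟨b', s', c', h, hb, h3, h4⟩ := ih (δ s x false).2 [] ((δ s x false).1 :: c)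
      refine ⟨b', s', c', ?_, hb, by simpa only [mealy] using h3, by simpa [mealy] using h4⟩
      have h5 := runsIn_mealyStep δ s x false a [] c
      cases x
      · exact (RunsIn.loopFalse (r := 0) (by simp) rfl (.caseNil (r := 1) rfl h5) h).mono
          (by simp; omega)
      · exact (RunsIn.loopTrue (r := 0) (by simp) rfl (.caseNil (r := 1) rfl h5) h).mono
          (by simp; omega)
    · obtain ⟨b', s', c', h, hb, h3, h4⟩ := ih (δ s x y).2 b ((δ s x y).1 :: c)
      refine ⟨b', s', c', ?_, hb.trans (by simp), by simpa only [mealy] using h3,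
        by simpa [mealy] using h4⟩
      have h5 := runsIn_mealyStep δ s x y a b c
      cases x <;> cases y
      · exact (RunsIn.loopFalse (r := 0) (by simp) rfl
          (.caseFalse (r := 1) (by simp) rfl h5) h).mono (by simp; omega)
      · exact (RunsIn.loopFalse (r := 0) (by simp) rfl
          (.caseTrue (r := 1) (by simp) rfl h5) h).mono (by simp; omega)
      · exact (RunsIn.loopTrue (r := 0) (by simp) rfl
          (.caseFalse (r := 1) (by simp) rfl h5) h).mono (by simp; omega)
      · exact (RunsIn.loopTrue (r := 0) (by simp) rfl
          (.caseTrue (r := 1) (by simp) rfl h5) h).mono (by simp; omega)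

/-- The full adder. -/
def adder (s x y : Bool) : Bool × Bool := (s ^^ x ^^ y, (s && x) || (s && y) || (x && y))

/-- The full subtractor. -/
def subtractor (s x y : Bool) : Bool × Bool := (s ^^ x ^^ y, (!x && (s || y)) || (s && y))

/-- A final carry has the weight of the first position behind the output. The claim propagates along
the strings from the one-digit identity `key`. -/
theorem val_adder (s : Bool) (a b : List Bool) :
    val (mealy adder s a b).1 + 2 ^ (mealy adder s a b).1.length * (mealy adder s a b).2.toNat =
      val a + val b + s.toNat := by
  have key : ∀ s x y : Bool, (adder s x y).1.toNat + 2 * (adder s x y).2.toNat =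
    s.toNat + x.toNat + y.toNat := by decide
  induction s, a, b using mealy.induct adder with
  | case1 s => simp [mealy, val]
  | case2 s x a ih =>
    have := key s x false
    simp only [mealy, val, List.length_cons, pow_succ', mul_assoc, Bool.toNat_false] at ih this ⊢
    omega
  | case3 s y b ih =>
    have := key s false y
    simp only [mealy, val, List.length_cons, pow_succ', mul_assoc, Bool.toNat_false] at ih this ⊢
    omega
  | case4 s x a y b ih =>
    have := key s x y
    simp only [mealy, val, List.length_cons, pow_succ', mul_assoc] at ih this ⊢
    omega

/-- The final state is the borrow. Since the output is less than `2` to its length, the borrow is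
set exactly if the subtrahend, including the incoming borrow, exceeds the minuend. -/
theorem val_subtractor (s : Bool) (a b : List Bool) :
    val a + 2 ^ (mealy subtractor s a b).1.length * (mealy subtractor s a b).2.toNat =
      val (mealy subtractor s a b).1 + val b + s.toNat := by
  have key : ∀ s x y : Bool, x.toNat + 2 * (subtractor s x y).2.toNat =
    (subtractor s x y).1.toNat + s.toNat + y.toNat := by decide
  induction s, a, b using mealy.induct subtractor with
  | case1 s => simp [mealy, val]
  | case2 s x a ih =>
    have := key s x false
    simp only [mealy, val, List.length_cons, pow_succ', mul_assoc, Bool.toNat_false] at ih this ⊢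
    omega
  | case3 s y b ih =>
    have := key s false y
    simp only [mealy, val, List.length_cons, pow_succ', mul_assoc, Bool.toNat_false] at ih this ⊢
    omega
  | case4 s x a y b ih =>
    have := key s x y
    simp only [mealy, val, List.length_cons, pow_succ', mul_assoc] at ih this ⊢
    omega

/-- The program `P` replaces the numbers in registers `0` and `1` by the value of `f` in
register `0`, in quadratic time. -/
def Computes₂ (P : Prog) (f : ℕ → ℕ → ℕ) : Prop :=
  ∀ a b : List Bool, ∃ l : List Bool, l.length ≤ a.length + b.length + 1 ∧
    val l = f (val a) (val b) ∧
    RunsIn P (ofList [a, b]) (100 * (a.length + b.length + 1) ^ 2) (ofList [l])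

/-- Addition. -/
def addProg : Prog :=
  .push 2 false ;; mealyProg adder ;; .case 2 .skip .skip (.push 3 true) ;; move 3 0

theorem runsIn_addProg (a b : List Bool) : ∃ l : List Bool,
    l.length ≤ max a.length b.length + 1 ∧ val l = val a + val b ∧
    RunsIn addProg (ofList [a, b]) (11 * (a.length + b.length) + 10) (ofList [l]) := by
  have hv := val_adder false a b
  have hlen := length_mealy adder false a b
  have s1 := RunsIn.push (r := 2) (L := [a, b, [], []]) false (by simp)
  have s2 := runsIn_mealyProg adder false a b []
  rcases h : mealy adder false a b with ⟨o, s⟩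
  rw [h] at hv s2 hlen
  simp only at hv s2 hlen
  have e1 : ofList [a, b] = ofList [a, b, [], []] := (ofList_append_replicate [a, b] 2).symm
  cases s
  · refine ⟨o, by omega, by simpa using hv, ?_⟩
    have s3 := runsIn_move (a := 3) (b := 0) (L := [[], [], [], o.reverse ++ []])
      (by simp) (by simp) (by simp)
    have e2 : ofList ([[], [], [], o.reverse ++ []].set 3 [] |>.set 0
        ((o.reverse ++ []).reverse ++ [])) = ofList [o] := by
      simpa using ofList_append_replicate [o] 3
    rw [e1, ← e2]
    refine (s1.seq (s2.seq ((RunsIn.caseFalse (r := 2) (by simp) rfl .skip).seq s3))).mono ?_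
    simp; omega
  · refine ⟨o ++ [true], by simp; omega, by simpa [val_append, val] using hv, ?_⟩
    have s3 := runsIn_move (a := 3) (b := 0) (L := [[], [], [], true :: (o.reverse ++ [])])
      (by simp) (by simp) (by simp)
    have e2 : ofList ([[], [], [], true :: (o.reverse ++ [])].set 3 [] |>.set 0
        ((true :: (o.reverse ++ [])).reverse ++ [])) = ofList [o ++ [true]] := by
      simpa using ofList_append_replicate [o ++ [true]] 3
    rw [e1, ← e2]
    refine (s1.seq (s2.seq ((RunsIn.caseTrue (r := 2) (by simp) rfl
      (RunsIn.push (r := 3) true (by simp))).seq s3))).mono ?_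
    simp; omega

theorem computes_add : Computes₂ addProg (· + ·) := fun a b => by
  obtain ⟨l, h1, h2, h3⟩ := runsIn_addProg a b
  exact ⟨l, by omega, h2, h3.mono (by nlinarith)⟩

/-- Truncated subtraction. -/
def subProg : Prog :=
  .push 2 false ;; mealyProg subtractor ;; .case 2 .skip (move 3 0) (clear 3)

theorem computes_sub : Computes₂ subProg (· - ·) := fun a b => by
  have hv := val_subtractor false a b
  have hlen := length_mealy subtractor false a b
  have s1 := RunsIn.push (r := 2) (L := [a, b, [], []]) false (by simp)
  have s2 := runsIn_mealyProg subtractor false a b []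
  have e1 : ofList [a, b] = ofList [a, b, [], []] := (ofList_append_replicate [a, b] 2).symm
  rcases h : mealy subtractor false a b with ⟨o, s⟩
  rw [h] at hv s2 hlen
  have hlt := val_lt o
  cases s
  · refine ⟨o, by simp only at hlen; omega, by simp at hv ⊢; omega, ?_⟩
    have s3 := runsIn_move (a := 3) (b := 0) (L := [[], [], [], o.reverse ++ []])
      (by simp) (by simp) (by simp)
    have e2 : ofList ([[], [], [], o.reverse ++ []].set 3 [] |>.set 0
        ((o.reverse ++ []).reverse ++ [])) = ofList [o] := by
      simpa using ofList_append_replicate [o] 3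
    rw [e1, ← e2]
    refine (s1.seq (s2.seq (RunsIn.caseFalse (r := 2) (by simp) rfl s3))).mono ?_
    simp at hlen ⊢; nlinarith [max_le_add_of_nonneg (Nat.zero_le a.length) (Nat.zero_le b.length)]
  -- A remaining borrow means `val a < val b`, so the truncated difference is zero and the output is
  -- discarded.
  · refine ⟨[], by simp, by simp [val] at hv ⊢; omega, ?_⟩
    have s3 := runsIn_clear (a := 3) (L := [[], [], [], o.reverse ++ []]) (by simp)
    have e2 : ofList ([[], [], [], o.reverse ++ []].set 3 []) = ofList [[]] :=
      ofList_append_replicate [[]] 3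
    rw [e1, ← e2]
    refine (s1.seq (s2.seq (RunsIn.caseTrue (r := 2) (by simp) rfl s3))).mono ?_
    simp at hlen ⊢; nlinarith [max_le_add_of_nonneg (Nat.zero_le a.length) (Nat.zero_le b.length)]

/-- Multiplication; register `1` contains the shifted second factor, register `2` the result. -/
def mulProg : Prog :=
  .loop 0 (.push 1 false) (copyTo 1 3 4 ;; addProg.shift 2 ;; .push 1 false) ;;
  clear 1 ;; move 2 1 ;; move 1 0

/-- School multiplication from the least significant digit: `b` is doubled in every round and added
to `c` when the digit is one. A sum is at most one digit longer than `b`, which is the length of the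
doubled `b`. So `c` never becomes longer than `b`, and both stay within `B`. -/
theorem runsIn_mul_loop (B : ℕ) (a b c : List Bool) (hc : c.length ≤ b.length)
    (hb : a.length + b.length ≤ B) : ∃ b' c' : List Bool,
    c'.length ≤ b'.length ∧ b'.length ≤ B ∧ val c' = val c + val a * val b ∧
    RunsIn (.loop 0 (.push 1 false) (copyTo 1 3 4 ;; addProg.shift 2 ;; .push 1 false))
      (ofList [a, b, c]) (a.length * (30 * B + 20) + 1) (ofList [[], b', c']) := by
  induction a generalizing b c with
  | nil =>
    exact ⟨b, c, hc, by simpa using hb, by simp [val],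
      (RunsIn.loopNil (r := 0) (L := [[], b, c]) rfl).mono (by simp)⟩
  | cons x a ih =>
    cases x
    · obtain ⟨b', c', h1, h2, h3, h4⟩ := ih (false :: b) c (by simp; omega)
        (by simp at hb ⊢; omega)
      refine ⟨b', c', h1, h2, by rw [h3]; simp [val]; ring, ?_⟩
      refine (RunsIn.loopFalse (r := 0) (by simp) rfl (RunsIn.push (r := 1) false (by simp))
        h4).mono ?_
      simp; nlinarith
    · obtain ⟨d, g1, g2, g3⟩ := runsIn_addProg c b
      obtain ⟨b', c', h1, h2, h3, h4⟩ := ih (false :: b) d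
        (by simp; omega) (by simp at hb ⊢; omega)
      refine ⟨b', c', h1, h2, by rw [h3, g2]; simp [val]; ring, ?_⟩
      have s1 := runsIn_copyTo (a := 1) (b := 3) (c := 4) (L := [a, b, c, []]) (by simp) (by simp)
        (by simp) (by simp) rfl
      have e1 : ofList [a, b, c, []] = ofList [a, b, c] := ofList_append_replicate [a, b, c] 1
      have e2 : ofList ([a, b, c, []].set 3 ([a, b, c, []].getD 1 [] ++ [a, b, c, []].getD 3 [])) =
        ofList [a, b, c, b] := by simp
      rw [e1, e2] at s1
      have s2 : RunsIn (addProg.shift 2) (ofList [a, b, c, b])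
          (11 * (c.length + b.length) + 10) (ofList [a, b, d]) := g3.shift_ofList [a, b]
      have s3 := RunsIn.push (r := 1) (L := [a, b, d]) false (by simp)
      refine (RunsIn.loopTrue (r := 0) (by simp) rfl (s1.seq (s2.seq s3)) h4).mono ?_
      simp at hb ⊢; nlinarith

theorem computes_mul : Computes₂ mulProg (· * ·) := fun a b => by
  obtain ⟨b', c, h1, h2, h3, h4⟩ := runsIn_mul_loop (a.length + b.length) a b [] (by simp) le_rfl
  refine ⟨c, by omega, by simpa [val] using h3, ?_⟩
  have s2 := runsIn_clear (a := 1) (L := [[], b', c]) (by simp)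
  have s3 := runsIn_move (a := 2) (b := 1) (L := [[], [], c]) (by simp) (by simp) (by simp)
  have s4 := runsIn_move (a := 1) (b := 0) (L := [[], c.reverse ++ [], []])
    (by simp) (by simp) (by simp)
  have e1 : ofList [a, b] = ofList [a, b, []] := (ofList_append_replicate [a, b] 1).symm
  have e2 : ofList (([[], c.reverse ++ [], []].set 1 []).set 0
      ((c.reverse ++ []).reverse ++ [])) = ofList [c] := by
    simpa using ofList_append_replicate [c] 2
  rw [e1, ← e2]
  refine (h4.seq (s2.seq (s3.seq s4))).mono ?_
  simp
  nlinarith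

/-- Division by a power of two. Register `0` contains the remaining digits, register `1` the
reversed result, register `2` the number of digits that still have to be dropped. -/
def shrBody (x : Bool) : Prog :=
  .push 3 true ;; .push 4 false ;; (mealyProg subtractor).shift 2 ;;
    .case 4 .skip (move 5 2) (clear 5 ;; .push 1 x)

/-- Division by a power of two. -/
def shrProg : Prog :=
  move 1 3 ;; move 3 2 ;; .loop 0 (shrBody false) (shrBody true) ;; clear 2 ;; move 1 0

/-- Subtracting one from the counter tests it for zero: a borrow means that enough digits have been
dropped, so the current digit is kept and the counter stays zero; otherwise the digit is dropped and
the counter decreases. -/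
theorem runsIn_shrBody (x : Bool) (a c b : List Bool) :
    (val b = 0 ∧ RunsIn (shrBody x) (ofList [a, c, b]) (12 * b.length + 24)
      (ofList [a, x :: c, []])) ∨
    ∃ b', b'.length ≤ b.length + 1 ∧ b'.length ≤ max b.length 1 ∧ val b = val b' + 1 ∧
      RunsIn (shrBody x) (ofList [a, c, b]) (12 * b.length + 24) (ofList [a, c, b']) := by
  have hv := val_subtractor false b [true]
  have hlen := length_mealy subtractor false b [true]
  have e1 : ofList [a, c, b] = ofList [a, c, b, [], []] :=
    (ofList_append_replicate [a, c, b] 2).symm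
  have s1 := RunsIn.push (r := 3) (L := [a, c, b, [], []]) true (by simp)
  have s2 := RunsIn.push (r := 4) (L := [a, c, b, [true], []]) false (by simp)
  have s3 := (runsIn_mealyProg subtractor false b [true] []).shift_ofList [a, c]
  have e2 : ofList ([a, c] ++ [b, [true], [false], []]) = ofList [a, c, b, [true], [false]] :=
    ofList_append_replicate [a, c, b, [true], [false]] 1
  rw [e2] at s3
  rcases h : mealy subtractor false b [true] with ⟨o, s⟩
  rw [h] at hv s3 hlen
  have hlt := val_lt o
  rw [e1]
  cases s
  · refine .inr ⟨o, by simp at hlen; omega, by simp at hlen; omega, by simp [val] at hv; omega, ?_⟩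
    have s4 := runsIn_move (a := 5) (b := 2) (L := [a, c, [], [], [], o.reverse ++ []])
      (by simp) (by simp) (by simp)
    have e3 : ofList (([a, c, [], [], [], o.reverse ++ []].set 5 []).set 2
        ((o.reverse ++ []).reverse ++ [])) = ofList [a, c, o] := by
      simpa using ofList_append_replicate [a, c, o] 3
    rw [← e3]
    refine (s1.seq (s2.seq (s3.seq (RunsIn.caseFalse (r := 4) (by simp) rfl s4)))).mono ?_
    simp at hlen ⊢; omega
  · refine .inl ⟨by simp [val] at hv hlt; omega, ?_⟩
    have s4 := runsIn_clear (a := 5) (L := [a, c, [], [], [], o.reverse ++ []]) (by simp)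
    have s5 := RunsIn.push (r := 1) (L := [a, c, [], [], [], []]) x (by simp)
    have e3 : ofList ([a, c, [], [], [], []].set 1 (x :: c)) = ofList [a, x :: c, []] :=
      ofList_append_replicate [a, x :: c, []] 3
    rw [← e3]
    refine (s1.seq (s2.seq (s3.seq (RunsIn.caseTrue (r := 4) (by simp) rfl
      (s4.seq s5))))).mono ?_
    simp at hlen ⊢; omega

/-- The loop runs over the digits of `a` and not over the value of the counter, which may be
exponential in its length. This keeps the time polynomial even for shifts by huge amounts. -/
theorem runsIn_shr_loop (B : ℕ) (hB : 0 < B) (a c b : List Bool) (hb : b.length ≤ B) :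
    ∃ b' d : List Bool, b'.length ≤ B ∧ d.length ≤ a.length ∧
    val d.reverse = val a / 2 ^ val b ∧
    RunsIn (.loop 0 (shrBody false) (shrBody true)) (ofList [a, c, b])
      (a.length * (12 * B + 26) + 1) (ofList [[], d ++ c, b']) := by
  induction a generalizing b c with
  | nil =>
    exact ⟨b, [], hb, by simp, by simp [val],
      (RunsIn.loopNil (r := 0) (L := [[], c, b]) rfl).mono (by simp)⟩
  | cons x a ih =>
    rcases runsIn_shrBody x a c b with ⟨h0, h⟩ | ⟨b', hb1, hb2, h0, h⟩
    · obtain ⟨b'', d, h1, h2, h3, h4⟩ := ih (x :: c) [] (by simp)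
      refine ⟨b'', d ++ [x], h1, by simpa using h2, ?_, ?_⟩
      · rw [h0]
        simp only [val] at h3 ⊢
        simp only [List.reverse_append, List.reverse_cons, List.reverse_nil, List.nil_append,
          List.singleton_append, val, h3]
        simp
      · rw [show d ++ [x] ++ c = d ++ x :: c by simp]
        cases x
        · refine (RunsIn.loopFalse (r := 0) (by simp) rfl h h4).mono ?_
          simp; nlinarith
        · refine (RunsIn.loopTrue (r := 0) (by simp) rfl h h4).mono ?_
          simp; nlinarith
    · obtain ⟨b'', d, h1, h2, h3, h4⟩ := ih c b' (by omega)
      refine ⟨b'', d, h1, h2.trans (by simp), ?_, ?_⟩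
      · rw [h3, h0, pow_succ', ← Nat.div_div_eq_div_mul]
        congr 1
        have := x.toNat_le
        simp only [val]; omega
      · cases x
        · refine (RunsIn.loopFalse (r := 0) (by simp) rfl h h4).mono ?_
          simp; nlinarith
        · refine (RunsIn.loopTrue (r := 0) (by simp) rfl h h4).mono ?_
          simp; nlinarith

theorem computes_shr : Computes₂ shrProg (fun x y => x / 2 ^ y) := fun a b => by
  obtain ⟨b', d, h1, h2, h3, h4⟩ := runsIn_shr_loop (b.length + 1) (by simp) a [] b (by simp)
  rw [List.append_nil] at h4
  refine ⟨d.reverse, by simp; omega, h3, ?_⟩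
  have s1 := runsIn_move (a := 1) (b := 3) (L := [a, b, [], []]) (by simp) (by simp) (by simp)
  have s2 := runsIn_move (a := 3) (b := 2) (L := [a, [], [], b.reverse ++ []])
    (by simp) (by simp) (by simp)
  have e1 : ofList [a, b] = ofList [a, b, [], []] := (ofList_append_replicate [a, b] 2).symm
  have e2 : ofList (([a, [], [], b.reverse ++ []].set 3 []).set 2
      ((b.reverse ++ []).reverse ++ [])) = ofList [a, [], b] := by
    simpa using ofList_append_replicate [a, [], b] 1
  rw [show [a, [], [], b.reverse ++ []].getD 3 [] = b.reverse ++ [] from rfl,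
    show [a, [], [], b.reverse ++ []].getD 2 [] = [] from rfl, e2] at s2
  have s3 := runsIn_clear (a := 2) (L := [[], d, b']) (by simp)
  have s4 := runsIn_move (a := 1) (b := 0) (L := [[], d, []]) (by simp) (by simp) (by simp)
  have e3 : ofList (([[], d, []].set 1 []).set 0
      (d.reverse ++ [])) = ofList [d.reverse] := by
    simpa using ofList_append_replicate [d.reverse] 2
  rw [e1, ← e3]
  refine (s1.seq (s2.seq (h4.seq (s3.seq s4)))).mono ?_
  simp
  nlinarith

end Prog

namespace Prog

/-! ### Arithmetic functions with loops are computable in polynomial time -/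

/-- The class of functions that are built from variables and constants by addition, truncated
subtraction, multiplication, division by powers of two, and sums and products over `j < N`. The
first argument is the loop bound `N`, the second argument gives the values of the variables. -/
inductive Arith : (ℕ → (ℕ → ℕ) → ℕ) → Prop
  | var (i : ℕ) : Arith fun _ e => e i
  | const (c : ℕ) : Arith fun _ _ => c
  | add {F G} : Arith F → Arith G → Arith fun N e => F N e + G N e
  | sub {F G} : Arith F → Arith G → Arith fun N e => F N e - G N e
  | mul {F G} : Arith F → Arith G → Arith fun N e => F N e * G N e
  | shr {F G} : Arith F → Arith G → Arith fun N e => F N e / 2 ^ G N e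
  | sum {F} (i : ℕ) : Arith F → Arith fun N e => ∑ j ∈ Finset.range N, F N (Function.update e i j)
  | prod {F} (i : ℕ) : Arith F → Arith fun N e => ∏ j ∈ Finset.range N, F N (Function.update e i j)

/-- The program `P` computes `F` into register `d` in time `p`. The variable `i` is in register
`ρ i`, the length of register `0` is the loop bound, and the registers from `d` on are scratch. -/
def ArithProg (F : ℕ → (ℕ → ℕ) → ℕ) (ρ : ℕ → ℕ) (d : ℕ) (P : Prog) (p : Polynomial ℕ) : Prop :=
  ∀ (S : Store) (s : ℕ), (S 0).length ≤ s → (∀ i, (S (ρ i)).length ≤ s) → (∀ r, d ≤ r → S r = []) →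
    ∃ l : List Bool, l.length ≤ p.eval s ∧ val l = F (S 0).length (fun i => val (S (ρ i))) ∧
      RunsIn P S (p.eval s) (Function.update S d l)

theorem eval_mono (p : Polynomial ℕ) : Monotone fun s => p.eval s := by
  intro a b hab
  simp only [Polynomial.eval_eq_sum, Polynomial.sum]
  gcongr

theorem exists_val (c : ℕ) : ∃ l, val l = c := by
  induction c using Nat.strong_induction_on with
  | _ c ih =>
    rcases Nat.eq_zero_or_pos c with rfl | hc
    · exact ⟨[], rfl⟩
    · obtain ⟨l, hl⟩ := ih (c / 2) (by omega)
      refine ⟨decide (c % 2 = 1) :: l, ?_⟩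
      rcases Nat.mod_two_eq_zero_or_one c with h | h <;> simp [val, hl, h] <;> omega

/-- Push all digits of a constant. -/
def pushAll (d : ℕ) : List Bool → Prog
  | [] => .skip
  | b :: l => pushAll d l ;; .push d b

theorem runsIn_pushAll (d : ℕ) (l : List Bool) (S : Store) :
    RunsIn (pushAll d l) S l.length (Function.update S d (l ++ S d)) := by
  induction l with
  | nil =>
    simp only [List.nil_append, Function.update_eq_self]
    exact RunsIn.skip
  | cons b l ih =>
    have h : RunsIn (.push d b) (Function.update S d (l ++ S d)) 1
        (Function.update S d (b :: l ++ S d)) := by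
      have := Run.push d b (Function.update S d (l ++ S d))
      rw [Function.update_self, Function.update_idem] at this
      exact ⟨1, le_rfl, this⟩
    exact ih.seq h

theorem glue_empty {S : Store} {d : ℕ} (h : ∀ r, d ≤ r → S r = []) (L : List (List Bool))
    (hL : ∀ l ∈ L, l = []) : glue d S (ofList L) = S := by
  funext r
  by_cases hr : r < d
  · rw [glue_of_lt _ _ hr]
  · obtain ⟨k, rfl⟩ := Nat.exists_eq_add_of_le (not_lt.1 hr)
    rw [glue_add, h _ (by omega)]
    by_cases hk : k < L.length
    · simpa [ofList, List.getD, hk] using hL _ (List.getElem_mem hk)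
    · simp [ofList, List.getD, List.getElem?_eq_none (not_lt.1 hk)]

theorem update_glue_ofList (S : Store) (d : ℕ) (L : List (List Bool)) (l : List Bool) :
    Function.update (glue d S (ofList L)) (d + L.length) l = glue d S (ofList (L ++ [l])) := by
  rw [update_glue, ← ofList_append_replicate L 1, update_ofList _ (by simp)]
  simp

/-- The operands go to registers `d` and `d + 1`, where the shifted operation finds them. Length
bounds and time bounds compose as polynomials. -/
theorem arithProg_binary {F G : ℕ → (ℕ → ℕ) → ℕ} {f : ℕ → ℕ → ℕ} {Q : Prog} (hQ : Computes₂ Q f)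
    (hF : ∀ ρ d, (∀ i, ρ i < d) → ∃ P p, ArithProg F ρ d P p)
    (hG : ∀ ρ d, (∀ i, ρ i < d) → ∃ P p, ArithProg G ρ d P p) (ρ : ℕ → ℕ) (d : ℕ)
    (hρ : ∀ i, ρ i < d) : ∃ P p, ArithProg (fun N e => f (F N e) (G N e)) ρ d P p := by
  obtain ⟨P₁, p₁, h₁⟩ := hF ρ d hρ
  obtain ⟨P₂, p₂, h₂⟩ := hG ρ (d + 1) fun i => (hρ i).trans (Nat.lt_succ_self d)
  have hd : 0 < d := (Nat.zero_le _).trans_lt (hρ 0)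
  refine ⟨P₁ ;; P₂ ;; Q.shift d, p₁ + p₂ + 100 * (p₁ + p₂ + 1) ^ 2, fun S s h0 hs hS => ?_⟩
  obtain ⟨a, ha, hav, r₁⟩ := h₁ S s h0 hs hS
  have hlow : ∀ r, r < d → Function.update S d a r = S r := fun r hr =>
    Function.update_of_ne hr.ne _ _
  obtain ⟨b, hb, hbv, r₂⟩ := h₂ (Function.update S d a) s (by rwa [hlow 0 hd])
    (fun i => by rw [hlow _ (hρ i)]; exact hs i)
    (fun r hr => by rw [Function.update_of_ne (by omega)]; exact hS r (by omega))
  obtain ⟨l, hl, hlv, r₃⟩ := hQ a b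
  have e0 := glue_empty hS [] (by simp)
  have e1 : Function.update S d a = glue d S (ofList [a]) := by
    conv_lhs => rw [← e0]
    exact update_glue_ofList S d [] a
  have e2 : Function.update (Function.update S d a) (d + 1) b = glue d S (ofList [a, b]) := by
    rw [e1]
    exact update_glue_ofList S d [a] b
  have e3 : Function.update S d l = glue d S (ofList [l]) := by
    conv_lhs => rw [← e0]
    exact update_glue_ofList S d [] l
  refine ⟨l, ?_, ?_, ?_⟩
  · simp only [Polynomial.eval_add, Polynomial.eval_mul, Polynomial.eval_pow, Polynomial.eval_one,
      Polynomial.eval_ofNat]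
    nlinarith
  · rw [hlv, hav, hbv]
    simp only [hlow _ hd, hlow _ (hρ _)]
  · rw [e2] at r₂
    rw [e3]
    refine (r₁.seq (r₂.seq (r₃.shift d S))).mono ?_
    simp only [Polynomial.eval_add, Polynomial.eval_mul, Polynomial.eval_pow, Polynomial.eval_one,
      Polynomial.eval_ofNat]
    have : (a.length + b.length + 1) ^ 2 ≤
        (Polynomial.eval s p₁ + Polynomial.eval s p₂ + 1) ^ 2 := by gcongr
    omega

/-- The part of the loop body that increments the loop variable. -/
def incProg : Prog :=
  copyTo 1 3 4 ;; .push 4 true ;; addProg.shift 3 ;; clear 1 ;; move 3 4 ;; move 4 1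

theorem runsIn_incProg (c v a : List Bool) : ∃ v' : List Bool,
    v'.length ≤ max v.length 1 + 1 ∧ val v' = val v + 1 ∧
    RunsIn incProg (ofList [c, v, a]) (30 * v.length + 60) (ofList [c, v', a]) := by
  obtain ⟨w, h1, h2, h3⟩ := runsIn_addProg v [true]
  refine ⟨w, by simpa using h1, by simpa [val] using h2, ?_⟩
  have s1 := runsIn_copyTo (a := 1) (b := 3) (c := 4) (L := [c, v, a, [], []]) (by simp) (by simp)
    (by simp) (by simp) rfl
  have e1 : [c, v, a, [], []].set 3 ([c, v, a, [], []].getD 1 [] ++ [c, v, a, [], []].getD 3 []) =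
    [c, v, a, v, []] := by simp
  rw [e1] at s1
  have s2 := RunsIn.push (r := 4) (L := [c, v, a, v, []]) true (by simp)
  have s3 : RunsIn (addProg.shift 3) (ofList [c, v, a, v, [true]])
      (11 * (v.length + [true].length) + 10) (ofList [c, v, a, w, []]) := by
    have := h3.shift_ofList [c, v, a]
    have e : ofList [c, v, a, w, []] = ofList [c, v, a, w] :=
      ofList_append_replicate [c, v, a, w] 1
    rw [e]
    exact this
  have s4 := runsIn_clear (a := 1) (L := [c, v, a, w, []]) (by simp)
  have s5 := runsIn_move (a := 3) (b := 4) (L := [c, [], a, w, []]) (by simp) (by simp) (by simp)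
  have s6 := runsIn_move (a := 4) (b := 1) (L := [c, [], a, [], w.reverse ++ []])
    (by simp) (by simp) (by simp)
  have e2 : ofList (([c, [], a, [], w.reverse ++ []].set 4 []).set 1
      ((w.reverse ++ []).reverse ++ [])) = ofList [c, w, a] := by
    simpa using ofList_append_replicate [c, w, a] 2
  have e3 : ofList [c, v, a, [], []] = ofList [c, v, a] := ofList_append_replicate [c, v, a] 2
  rw [← e2, ← e3]
  refine (s1.seq (s2.seq (s3.seq (s4.seq (s5.seq s6))))).mono ?_
  simp at h1 ⊢; omega

/-- The value of a loop. -/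
def foldNat (f : ℕ → ℕ → ℕ) (g : ℕ → ℕ) (a : ℕ) (N : ℕ) : ℕ :=
  Nat.rec a (fun j x => f x (g j)) N

/-- Register `d` holds one bit per remaining iteration, `d + 1` the loop variable, `d + 2` the
accumulator, and the loop body works from `d + 3` on. One operation lengthens the accumulator by at
most the length of the new operand plus one. Its length therefore grows additively and stays
polynomial, for products as well as for sums. -/
theorem arithProg_fold {F : ℕ → (ℕ → ℕ) → ℕ} {f : ℕ → ℕ → ℕ} {Q : Prog} (hQ : Computes₂ Q f)
    (hF : ∀ ρ d, (∀ i, ρ i < d) → ∃ P p, ArithProg F ρ d P p) (x c₀ : ℕ) (ρ : ℕ → ℕ) (d : ℕ)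
    (hρ : ∀ i, ρ i < d) :
    ∃ P p, ArithProg (fun N e => foldNat f (fun j => F N (Function.update e x j)) c₀ N) ρ d P p := by
  obtain ⟨l₀, hl₀⟩ := exists_val c₀
  have hd : 0 < d := (Nat.zero_le _).trans_lt (hρ 0)
  obtain ⟨P, p, hP⟩ := hF (Function.update ρ x (d + 1)) (d + 3) fun i => by
    rw [Function.update_apply]
    have := hρ i
    split_ifs <;> omega
  let body := P ;; Q.shift (d + 2) ;; incProg.shift d
  -- `W` bounds the length of the accumulator during the whole loop, and `B` the time of one
  -- iteration: evaluating the operand, the operation, and incrementing the loop variable.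
  let W : Polynomial ℕ := Polynomial.C l₀.length + Polynomial.X * (p + 1)
  let B : Polynomial ℕ := p + 100 * (W + p + 1) ^ 2 + 30 * Polynomial.X + 70
  refine ⟨copyTo 0 d (d + 1) ;; pushAll (d + 2) l₀ ;; loop d body body ;;
    (clear 1 ;; move 2 1 ;; move 1 0).shift d,
    Polynomial.X * B + 20 * Polynomial.X + 8 * W + 20, fun S s h0 hs hS => ?_⟩
  set N := (S 0).length with hN
  set g := fun j => F N (Function.update (fun i => val (S (ρ i))) x j) with hg
  have hB : ∀ s, B.eval s = p.eval s + 100 * (W.eval s + p.eval s + 1) ^ 2 + 30 * s + 70 := by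
    intro s; simp [B]
  have hW : ∀ s, W.eval s = l₀.length + s * (p.eval s + 1) := by intro s; simp [W]
  -- Loop invariant after `j` iterations. The crude bound `j + 1` for the length of the loop
  -- variable suffices, since it is at most `s` as long as an iteration remains.
  have hloop : ∀ (c : List Bool) (j : ℕ) (v a : List Bool), j + c.length = N →
      v.length ≤ j + 1 → val v = j → a.length ≤ l₀.length + j * (p.eval s + 1) →
      val a = foldNat f g c₀ j →
      ∃ v' a' : List Bool, v'.length ≤ N + 1 ∧ a'.length ≤ l₀.length + N * (p.eval s + 1) ∧
        val a' = foldNat f g c₀ N ∧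
        RunsIn (loop d body body) (glue d S (ofList [c, v, a])) (c.length * (B.eval s + 2) + 1)
          (glue d S (ofList [[], v', a'])) := by
    intro c
    induction c with
    | nil =>
      intro j v a hj hv _ ha hfa
      have hj : j = N := by simpa using hj
      subst hj
      refine ⟨v, a, hv, ha, hfa, 1, by simp, .loopNil ?_⟩
      exact glue_add d S _ 0
    | cons y c ih =>
      intro j v a hj hv hvj ha hfa
      rw [List.length_cons] at hj
      have hlow : ∀ r, r < d → glue d S (ofList [c, v, a]) r = S r := fun r hr =>
        glue_of_lt _ _ hr
      have hx : glue d S (ofList [c, v, a]) (d + 1) = v := glue_add d S _ 1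
      have hreg : ∀ i, glue d S (ofList [c, v, a]) (Function.update ρ x (d + 1) i) =
          Function.update (fun i => S (ρ i)) x v i := by
        intro i
        by_cases hi : i = x
        · subst hi; simp only [Function.update_self, hx]
        · simp only [Function.update_of_ne hi, hlow _ (hρ i)]
      obtain ⟨b, hb, hbv, r₁⟩ := hP (glue d S (ofList [c, v, a])) s
        (by rw [hlow 0 hd]; exact h0)
        (fun i => by
          rw [hreg, Function.update_apply]
          split_ifs
          · omega
          · exact hs i)
        (fun r hr => by
          obtain ⟨k, rfl⟩ := Nat.exists_eq_add_of_le (show d ≤ r by omega)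
          rw [glue_add]
          simp [ofList, List.getD, List.getElem?_eq_none (show [c, v, a].length ≤ k by simp; omega)])
      have hbv' : val b = g j := by
        rw [hbv, hlow 0 hd, hg]
        congr 1
        funext i
        rw [hreg]
        by_cases hi : i = x
        · subst hi; simp only [Function.update_self, hvj]
        · simp only [Function.update_of_ne hi]
      have e1 : Function.update (glue d S (ofList [c, v, a])) (d + 3) b =
          glue d S (ofList [c, v, a, b]) := update_glue_ofList S d [c, v, a] b
      rw [e1] at r₁
      obtain ⟨a', ha', hav', r₂⟩ := hQ a b
      have r₂' : RunsIn (Q.shift (d + 2)) (glue d S (ofList [c, v, a, b]))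
          (100 * (a.length + b.length + 1) ^ 2) (glue d S (ofList [c, v, a'])) := by
        have h1 := r₂.shift (d + 2) (glue d S (ofList [c, v]))
        have h2 : ∀ L, glue (d + 2) (glue d S (ofList [c, v])) (ofList L) =
            glue d S (ofList ([c, v] ++ L)) := by
          intro L
          funext r
          by_cases hr : r < d
          · rw [glue_of_lt _ _ hr, glue_of_lt _ _ (by omega), glue_of_lt _ _ hr]
          · obtain ⟨k, rfl⟩ := Nat.exists_eq_add_of_le (not_lt.1 hr)
            rw [glue_add]
            rcases k with _ | _ | k
            · rw [glue_of_lt _ _ (by omega)]; exact glue_add d S _ 0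
            · rw [glue_of_lt _ _ (by omega)]; exact glue_add d S _ 1
            · rw [show d + (k + 1 + 1) = d + 2 + k by omega, glue_add]
              simp [ofList, List.getD]
        rw [h2, h2] at h1
        exact h1
      obtain ⟨v', hv', hvv', r₃⟩ := runsIn_incProg c v a'
      obtain ⟨v'', a'', h1, h2, h3, r₄⟩ := ih (j + 1) v' a' (by omega) (by omega) (by omega)
        (by rw [add_mul]; omega) (by rw [hav', hbv', hfa]; rfl)
      refine ⟨v'', a'', h1, h2, h3, ?_⟩
      obtain ⟨t, ht, rb⟩ := r₁.seq (r₂'.seq (r₃.shift d S))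
      obtain ⟨t', ht', rl⟩ := r₄
      have e2 : Function.update (glue d S (ofList [y :: c, v, a])) d c =
          glue d S (ofList [c, v, a]) := by
        have h1 := update_glue d S (ofList [y :: c, v, a]) 0 c
        rw [update_ofList _ (by simp)] at h1
        exact h1
      have htop : glue d S (ofList [y :: c, v, a]) d = y :: c :=
        glue_add d S (ofList [y :: c, v, a]) 0
      have htime : t ≤ B.eval s := by
        have haW : a.length ≤ W.eval s := by
          rw [hW]
          refine ha.trans ?_
          gcongr
          omega
        have : (a.length + b.length + 1) ^ 2 ≤ (W.eval s + p.eval s + 1) ^ 2 := by gcongr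
        rw [hB]
        omega
      refine ⟨t + t' + 2, by simp only [List.length_cons]; nlinarith, ?_⟩
      cases y
      · exact .loopFalse htop (by rw [e2]; exact rb) rl
      · exact .loopTrue htop (by rw [e2]; exact rb) rl
  obtain ⟨v, a, hv, ha, hfa, r₃⟩ := hloop (S 0) 0 [] l₀ (by simp [hN]) (by simp) rfl (by simp)
    (by rw [hl₀]; rfl)
  have e0 := glue_empty hS [[], [], []] (by simp)
  have r₁ := runsIn_copyTo_store (a := 0) (b := d) (c := d + 1) (by omega) (by omega) (by omega) S
    (hS _ (by omega))
  have e1 : Function.update S d (S 0 ++ S d) = glue d S (ofList [S 0, [], []]) := by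
    rw [hS d le_rfl, List.append_nil]
    have := update_glue d S (ofList [[], [], []]) 0 (S 0)
    rw [update_ofList _ (by simp), e0] at this
    exact this
  have r₂ := runsIn_pushAll (d + 2) l₀ (glue d S (ofList [S 0, [], []]))
  have e2 : Function.update (glue d S (ofList [S 0, [], []])) (d + 2)
      (l₀ ++ glue d S (ofList [S 0, [], []]) (d + 2)) = glue d S (ofList [S 0, [], l₀]) := by
    rw [glue_add, update_glue, update_ofList _ (by simp)]
    simp [ofList, List.getD]
  rw [e1] at r₁
  rw [e2] at r₂
  have s1 := runsIn_clear (a := 1) (L := [[], v, a]) (by simp)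
  have s2 := runsIn_move (a := 2) (b := 1) (L := [[], [], a]) (by simp) (by simp) (by simp)
  have s3 := runsIn_move (a := 1) (b := 0) (L := [[], a.reverse ++ [], []])
    (by simp) (by simp) (by simp)
  have e3 : ofList (([[], a.reverse ++ [], []].set 1 []).set 0
      ((a.reverse ++ []).reverse ++ [])) = ofList [a] := by
    simpa using ofList_append_replicate [a] 2
  have e4 : Function.update S d a = glue d S (ofList [a]) := by
    conv_lhs => rw [← glue_empty hS [] (by simp)]
    exact update_glue_ofList S d [] a
  have r₄ : RunsIn (clear 1 ;; move 2 1 ;; move 1 0) (ofList [[], v, a])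
      (2 * v.length + 6 * a.length + 3) (ofList [a]) := by
    rw [← e3]
    refine (s1.seq (s2.seq s3)).mono ?_
    simp; omega
  have haW : a.length ≤ W.eval s := by
    rw [hW]
    refine ha.trans ?_
    gcongr
  have hev : (Polynomial.X * B + 20 * Polynomial.X + 8 * W + 20).eval s =
      s * B.eval s + 20 * s + 8 * W.eval s + 20 := by simp
  have hl₀W : l₀.length ≤ W.eval s := by rw [hW]; exact Nat.le_add_right _ _
  refine ⟨a, by rw [hev]; omega, hfa, ?_⟩
  rw [e4]
  refine (r₁.seq (r₂.seq (r₃.seq (r₄.shift d S)))).mono ?_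
  rw [hev]
  have : (S 0).length * (B.eval s + 2) ≤ s * (B.eval s + 2) := by gcongr
  nlinarith

theorem foldNat_add (g : ℕ → ℕ) (N : ℕ) :
    foldNat (· + ·) g 0 N = ∑ j ∈ Finset.range N, g j := by
  induction N with
  | zero => rfl
  | succ N ih => rw [Finset.sum_range_succ, ← ih]; rfl

theorem foldNat_mul (g : ℕ → ℕ) (N : ℕ) :
    foldNat (· * ·) g 1 N = ∏ j ∈ Finset.range N, g j := by
  induction N with
  | zero => rfl
  | succ N ih => rw [Finset.prod_range_succ, ← ih]; rfl

/-- The register assignment `ρ` and the start `d` of the scratch area are generalized, since a bound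
variable is reassigned to the register of its loop and later subexpressions start further up. -/
theorem Arith.exists_arithProg {F : ℕ → (ℕ → ℕ) → ℕ} (hF : Arith F) (ρ : ℕ → ℕ) (d : ℕ)
    (hρ : ∀ i, ρ i < d) : ∃ P p, ArithProg F ρ d P p := by
  induction hF generalizing ρ d with
  | var i =>
    have := hρ i
    refine ⟨copyTo (ρ i) d (d + 1), 7 * Polynomial.X + 2, fun S s h0 hs hS => ⟨S (ρ i), ?_, rfl, ?_⟩⟩
    · have := hs i
      simp; omega
    · have h := runsIn_copyTo_store (a := ρ i) (b := d) (c := d + 1) (by omega) (by omega)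
        (by omega) S (hS _ (by omega))
      rw [hS d le_rfl, List.append_nil] at h
      refine h.mono ?_
      have := hs i
      simp; omega
  | const c =>
    obtain ⟨l, hl⟩ := exists_val c
    refine ⟨pushAll d l, Polynomial.C l.length, fun S s h0 hs hS => ⟨l, by simp, hl, ?_⟩⟩
    have h := runsIn_pushAll d l S
    rw [hS d le_rfl, List.append_nil] at h
    simpa using h
  | add _ _ hF hG => exact arithProg_binary computes_add hF hG ρ d hρ
  | sub _ _ hF hG => exact arithProg_binary computes_sub hF hG ρ d hρ
  | mul _ _ hF hG => exact arithProg_binary computes_mul hF hG ρ d hρ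
  | shr _ _ hF hG => exact arithProg_binary computes_shr hF hG ρ d hρ
  | sum i _ hF => simpa only [foldNat_add] using arithProg_fold computes_add hF i 0 ρ d hρ
  | prod i _ hF => simpa only [foldNat_mul] using arithProg_fold computes_mul hF i 1 ρ d hρ

end Prog

namespace Prog

/-! ### Turing machines for arithmetic functions -/

theorem encodeNat_bit (b : Bool) {n : ℕ} (hn : 0 < n) :
    encodeNat (b.toNat + 2 * n) = b :: encodeNat n := by
  obtain ⟨p, rfl⟩ : ∃ p : PosNum, (p : ℕ) = n := by
    rcases h : (n : Num) with _ | p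
    · have := congrArg (fun x : Num => (x : ℕ)) h
      simp at this
      omega
    · refine ⟨p, ?_⟩
      have := congrArg (fun x : Num => (x : ℕ)) h
      simpa using this.symm
  have h0 : encodeNat (p : ℕ) = encodePosNum p := by
    have : ((p : ℕ) : Num) = Num.pos p := Num.of_to_nat (Num.pos p)
    rw [encodeNat, this]
    rfl
  cases b
  · have : ((false.toNat + 2 * (p : ℕ) : ℕ) : Num) = Num.pos p.bit0 := by
      rw [← Num.of_to_nat (Num.pos p.bit0)]
      congr 1
      simp [two_mul]
    rw [h0, encodeNat, this]
    rfl
  · have : ((true.toNat + 2 * (p : ℕ) : ℕ) : Num) = Num.pos p.bit1 := by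
      rw [← Num.of_to_nat (Num.pos p.bit1)]
      congr 1
      simp [two_mul]; omega
    rw [h0, encodeNat, this]
    rfl

theorem val_pos_of_getLast {l : List Bool} (h : l ≠ []) (h' : l.getLast? ≠ some false) :
    0 < val l := by
  induction l with
  | nil => exact absurd rfl h
  | cons b l ih =>
    rcases l with _ | ⟨c, l⟩
    · cases b <;> simp_all [val]
    · have := ih (by simp) (by simpa using h')
      simp only [val] at this ⊢; omega

/-- `encodeNat` writes the least significant digit first and has no superfluous zeros at the end,
which pins down the string from its value. -/
theorem encodeNat_val {l : List Bool} (h : l.getLast? ≠ some false) : encodeNat (val l) = l := by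
  induction l with
  | nil => rfl
  | cons b l ih =>
    rcases l with _ | ⟨c, l⟩
    · cases b
      · simp at h
      · rfl
    · have h' : (c :: l).getLast? ≠ some false := by simpa using h
      rw [val, encodeNat_bit b (val_pos_of_getLast (by simp) h'), ih h']

theorem encodeNat_val_append (l : List Bool) (n : ℕ) :
    val (l ++ List.replicate n false) = val l := by
  rw [val_append]
  have : val (List.replicate n false) = 0 := by
    induction n with
    | zero => rfl
    | succ n ih => simp [List.replicate_succ, val, ih]
  simp [this]

/-- Remove the trailing `false`s of register `0`. -/
def stripProg : Prog := move 0 1 ;; loop 1 .skip (.push 0 true ;; move 1 0)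

theorem runsIn_stripProg (l : List Bool) :
    RunsIn stripProg (ofList [l]) (8 * l.length + 10) (ofList [encodeNat (val l)]) := by
  -- After the reversal the superfluous zeros are on top. The first `true` ends the search: the
  -- remaining digits are moved back in one go, which empties register `1` and so stops the loop.
  have hloop : ∀ w : List Bool, RunsIn (loop 1 .skip (.push 0 true ;; move 1 0)) (ofList [[], w])
      (5 * w.length + 5) (ofList [encodeNat (val w.reverse), []]) := by
    intro w
    induction w with
    | nil => exact (RunsIn.loopNil (r := 1) (L := [[], []]) rfl).mono (by simp)
    | cons x w ih =>
      cases x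
      · have h1 : val (false :: w).reverse = val w.reverse := by
          rw [List.reverse_cons]
          exact encodeNat_val_append _ 1
        rw [h1]
        exact (RunsIn.loopFalse (r := 1) (by simp) rfl .skip ih).mono (by simp; omega)
      · rw [encodeNat_val (by simp)]
        have s1 := RunsIn.push (r := 0) (L := [[], w]) true (by simp)
        have s2 := runsIn_move (a := 1) (b := 0) (L := [[true], w]) (by simp) (by simp) (by simp)
        have e : ofList (([[true], w].set 1 []).set 0 (w.reverse ++ [true])) =
            ofList [(true :: w).reverse, []] := by simp
        rw [← e]
        exact (RunsIn.loopTrue (r := 1) (by simp) rfl (s1.seq s2)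
          (RunsIn.loopNil (r := 1) rfl)).mono (by simp; omega)
  have s1 := runsIn_move (a := 0) (b := 1) (L := [l, []]) (by simp) (by simp) (by simp)
  have s2 := hloop (l.reverse ++ [])
  have e1 : ofList [l] = ofList [l, []] := (ofList_append_replicate [l] 1).symm
  have e2 : ofList [encodeNat (val l)] = ofList [encodeNat (val (l.reverse ++ []).reverse), []] := by
    simpa using (ofList_append_replicate [encodeNat (val l)] 1).symm
  rw [e1, e2]
  exact (s1.seq s2).mono (by simp; omega)

/-- This separation yields the form required for fixed-parameter tractability: with `a` depending on
the parameter only, a polynomial in `a + b` is at most a function of the parameter times a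
polynomial in `b`. -/
theorem exists_eval_add_le (q : Polynomial ℕ) :
    ∃ C d : ℕ, ∀ a b : ℕ, q.eval (a + b) ≤ C * (a + 1) ^ d * (b + 1) ^ d := by
  have h : ∃ C d : ℕ, ∀ y : ℕ, q.eval y ≤ C * (y + 1) ^ d := by
    induction q using Polynomial.induction_on' with
    | add p q hp hq =>
      obtain ⟨C, d, h⟩ := hp
      obtain ⟨C', d', h'⟩ := hq
      refine ⟨C + C', d + d', fun y => ?_⟩
      rw [Polynomial.eval_add, add_mul]
      have h1 : (y + 1) ^ d ≤ (y + 1) ^ (d + d') := Nat.pow_le_pow_right (by omega) (by omega)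
      have h2 : (y + 1) ^ d' ≤ (y + 1) ^ (d + d') := Nat.pow_le_pow_right (by omega) (by omega)
      exact Nat.add_le_add ((h y).trans (by gcongr)) ((h' y).trans (by gcongr))
    | monomial n a =>
      refine ⟨a, n, fun y => ?_⟩
      rw [Polynomial.eval_monomial]
      gcongr
      omega
  obtain ⟨C, d, h⟩ := h
  refine ⟨C, d, fun a b => (h _).trans ?_⟩
  rw [mul_assoc, ← mul_pow]
  gcongr
  nlinarith

/-- Split the input `1ᵏ01ⁿ0w` in register `2` into the registers `1`, `2` and `4`. -/
def parseProg : Prog :=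
  takeOnes.shift 2 ;; move 3 1 ;; takeOnes.shift 2 ;; move 2 5 ;; move 3 2 ;; move 5 4

theorem runsIn_parseProg (k n : ℕ) (w : List Bool) :
    RunsIn parseProg
      (ofList [[], [], List.replicate k true ++ false :: (List.replicate n true ++ false :: w)])
      (20 * (k + n + w.length) + 20)
      (ofList [[], List.replicate k true, List.replicate n true, [], w]) := by
  set r := List.replicate n true ++ false :: w
  have s1 := (runsIn_takeOnes k _ r [] (.inl rfl)).shift_ofList [[], []]
  have s2 := runsIn_move (a := 3) (b := 1) (L := [[], [], r, List.replicate k true ++ []])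
    (by simp) (by simp) (by simp)
  have e2 : ofList (([[], [], r, List.replicate k true ++ []].set 3 []).set 1
      ((List.replicate k true ++ []).reverse ++ [])) = ofList [[], List.replicate k true, r, []] := by
    simp
  have s3 := (runsIn_takeOnes n r w [] (.inl rfl)).shift_ofList [[], List.replicate k true]
  have e3 : ofList ([[], List.replicate k true] ++ [w, List.replicate n true ++ []]) =
      ofList [[], List.replicate k true, w, List.replicate n true, [], []] := by
    simpa using (ofList_append_replicate [[], List.replicate k true, w, List.replicate n true] 2).symm
  have s4 := runsIn_move (a := 2) (b := 5)
    (L := [[], List.replicate k true, w, List.replicate n true, [], []])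
    (by simp) (by simp) (by simp)
  have s5 := runsIn_move (a := 3) (b := 2)
    (L := [[], List.replicate k true, [], List.replicate n true, [], w.reverse ++ []])
    (by simp) (by simp) (by simp)
  have s6 := runsIn_move (a := 5) (b := 4)
    (L := [[], List.replicate k true, (List.replicate n true).reverse ++ [], [], [],
      w.reverse ++ []]) (by simp) (by simp) (by simp)
  have e0 : ofList [[], [], List.replicate k true ++ false :: r] =
      ofList [[], [], List.replicate k true ++ false :: r, []] :=
    (ofList_append_replicate [[], [], List.replicate k true ++ false :: r] 1).symm
  have e6 : ofList (([[], List.replicate k true, (List.replicate n true).reverse ++ [], [], [],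
      w.reverse ++ []].set 5 []).set 4 ((w.reverse ++ []).reverse ++ [])) =
      ofList [[], List.replicate k true, List.replicate n true, [], w] := by
    simpa using
      ofList_append_replicate [[], List.replicate k true, List.replicate n true, [], w] 1
  rw [show [[], [], r, List.replicate k true ++ []].getD 3 [] = List.replicate k true ++ [] from rfl,
    show [[], [], r, List.replicate k true ++ []].getD 1 [] = [] from rfl, e2] at s2
  rw [e3] at s3
  rw [e0, ← e6]
  refine (s1.seq (s2.seq (s3.seq (s4.seq (s5.seq s6))))).mono ?_
  simp; omega

/-- The values of the variables: the variables `1`, `2`, `3` are `2ᵏ - 1`, `2ⁿ - 1` and `2ᵐ - 1`,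
all other variables have the value of the binary number `w`. -/
def inputEnv (k n m : ℕ) (w : List Bool) (i : ℕ) : ℕ :=
  if i = 1 then 2 ^ k - 1 else if i = 2 then 2 ^ n - 1 else if i = 3 then 2 ^ m - 1 else val w

/-- Numbers in unary are stored as blocks of ones, which an arithmetic function sees as binary
numbers of this form. The function `ones` recovers the original number. -/
theorem val_replicate_true (n : ℕ) : val (List.replicate n true) = 2 ^ n - 1 := by
  induction n with
  | zero => rfl
  | succ n ih =>
    have := Nat.one_le_two_pow (n := n)
    simp only [List.replicate_succ, val, ih, Bool.toNat_true, pow_succ']; omega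

/-- Only the computation of `m k` may take more than polynomial time, and it depends on `k` alone.
Its result stays in unary, so that the loop bound, and with it the time for `F`, is polynomial in `m
k` plus the input length. -/
theorem exists_prog_arith {F : ℕ → (ℕ → ℕ) → ℕ} (hF : Arith F) {m : ℕ → ℕ} (hm : Computable m) :
    ∃ (P : Prog) (f : ℕ → ℕ) (p : Polynomial ℕ), Computable f ∧
      ∀ (k n : ℕ) (w : List Bool), RunsIn P
        (single 2 (List.replicate k true ++ false :: (List.replicate n true ++ false :: w)))
        (f k * p.eval (k + n + w.length))
        (single 5 (encodeNat (F (m k + 1 + n + k) (inputEnv k n (m k) w)))) := by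
  obtain ⟨P₂, τ, hτ, h₂⟩ := exists_prog_computable hm
  obtain ⟨P₄, p₄, h₄⟩ := hF.exists_arithProg (fun i => if i = 0 then 4 else min i 4) 5 (by
    intro i
    split_ifs <;> omega)
  -- This computes `m k` into register `3` and then concatenates registers `1`, `2` and `3` into
  -- register `0`, whose length is the loop bound. The `false` that terminates the encoding of `m k`
  -- accounts for the summand `1` and does not change the binary value of register `3`.
  let prep : Prog := .push 5 false ;; copyTo 1 5 6 ;; P₂.shift 5 ;; move 5 6 ;; move 6 3 ;;
    copyTo 1 0 5 ;; copyTo 2 0 5 ;; copyTo 3 0 5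
  let fin : Prog := clear 0 ;; clear 1 ;; clear 2 ;; clear 3 ;; clear 4 ;; stripProg.shift 5
  let q : Polynomial ℕ := 1000 * Polynomial.X + 1000 + 10 * p₄
  obtain ⟨C, e, hC⟩ := exists_eval_add_le q
  have hq : ∀ s, q.eval s = 1000 * s + 1000 + 10 * p₄.eval s := by intro s; simp [q]
  -- The parameter factor collects the time for `m k` and the part of the polynomial bound that
  -- `exists_eval_add_le` assigns to `m k`. The rest, in `k + n + w.length + 1`, is `(X + 2) ^ e` at
  -- the input size.
  refine ⟨parseProg ;; prep ;; P₄ ;; fin, fun k => τ k + C * (m k + 1) ^ e, (Polynomial.X + 2) ^ e,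
    ?_, fun k n w => ?_⟩
  · have hpow : Primrec fun a : ℕ => C * (a + 1) ^ e := by
      have : Primrec₂ ((· ^ ·) : ℕ → ℕ → ℕ) := Primrec₂.unpaired'.1 Nat.Primrec.pow
      exact Primrec.nat_mul.comp (Primrec.const C)
        (this.comp (Primrec.succ.comp Primrec.id) (Primrec.const e))
    exact Primrec.nat_add.to_comp.comp hτ (hpow.to_comp.comp hm)
  set K := List.replicate k true
  set Nn := List.replicate n true
  have hKl : K.length = k := by simp [K]
  have hNl : Nn.length = n := by simp [Nn]
  set E := enc [m k]
  have hE : E = List.replicate (m k) true ++ [false] := by simp [E, enc]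
  have hEl : E.length = m k + 1 := by simp [hE]
  set inp := K ++ false :: (Nn ++ false :: w)
  have e0 : single 2 inp = ofList [[], [], inp] := by
    funext r
    rcases r with _ | _ | _ | r <;> simp [single, ofList, List.getD]
  have s1 := runsIn_parseProg k n w
  have a1 := RunsIn.push (r := 5) (L := [[], K, Nn, [], w, [], []]) false (by simp)
  have a2 := runsIn_copyTo (a := 1) (b := 5) (c := 6) (L := [[], K, Nn, [], w, [false], []])
    (by simp) (by simp) (by simp) (by simp) rfl
  have a3 := (h₂ k).shift_ofList [[], K, Nn, [], w]
  have a4 := runsIn_move (a := 5) (b := 6) (L := [[], K, Nn, [], w, E, []])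
    (by simp) (by simp) (by simp)
  have a5 := runsIn_move (a := 6) (b := 3) (L := [[], K, Nn, [], w, [], E.reverse ++ []])
    (by simp) (by simp) (by simp)
  have a6 := runsIn_copyTo (a := 1) (b := 0) (c := 5)
    (L := [[], K, Nn, (E.reverse ++ []).reverse ++ [], w, [], []])
    (by simp) (by simp) (by simp) (by simp) rfl
  have a7 := runsIn_copyTo (a := 2) (b := 0) (c := 5)
    (L := [K ++ [], K, Nn, (E.reverse ++ []).reverse ++ [], w, [], []])
    (by simp) (by simp) (by simp) (by simp) rfl
  have f1 : ofList [[], K, Nn, [], w] = ofList [[], K, Nn, [], w, [], []] :=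
    (ofList_append_replicate [[], K, Nn, [], w] 2).symm
  have f2 : ofList ([[], K, Nn, [], w, [false], []].set 5 (K ++ [false])) =
      ofList ([[], K, Nn, [], w] ++ [enc [k]]) := by
    have := ofList_append_replicate [[], K, Nn, [], w, K ++ [false]] 1
    simpa [enc, K] using this
  have f3 : ofList ([[], K, Nn, [], w] ++ [enc [m k]]) = ofList [[], K, Nn, [], w, E, []] :=
    (ofList_append_replicate [[], K, Nn, [], w, E] 1).symm
  have f8 : ofList ([Nn ++ (K ++ []), K, Nn, (E.reverse ++ []).reverse ++ [], w, [], []].set 0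
      (((E.reverse ++ []).reverse ++ []) ++ (Nn ++ (K ++ [])))) =
      ofList [E ++ (Nn ++ K), K, Nn, E, w] := by
    simpa using ofList_append_replicate [E ++ (Nn ++ K), K, Nn, E, w] 2
  rw [f1] at s1
  rw [show [[], K, Nn, [], w, [false], []].getD 1 [] = K from rfl,
    show [[], K, Nn, [], w, [false], []].getD 5 [] = [false] from rfl, f2] at a2
  rw [f3] at a3
  have a8 : RunsIn (copyTo 3 0 5)
      (ofList [Nn ++ (K ++ []), K, Nn, (E.reverse ++ []).reverse ++ [], w, [], []])
      (20 * E.length + 20) (ofList [E ++ (Nn ++ K), K, Nn, E, w]) := by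
    have := runsIn_copyTo (a := 3) (b := 0) (c := 5)
      (L := [Nn ++ (K ++ []), K, Nn, (E.reverse ++ []).reverse ++ [], w, [], []])
      (by simp) (by simp) (by simp) (by simp) rfl
    rw [← f8]
    refine this.mono ?_
    simp; omega
  have sprep : RunsIn prep (ofList [[], K, Nn, [], w, [], []]) (τ k + 40 * (m k + n + k) + 100)
      (ofList [E ++ (Nn ++ K), K, Nn, E, w]) := by
    refine (a1.seq (a2.seq (a3.seq (a4.seq (a5.seq (a6.seq (a7.seq a8))))))).mono ?_
    simp [hKl, hNl, hEl]; omega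
  set s := m k + (k + n + w.length) + 1
  obtain ⟨l, hl, hlv, s4⟩ := h₄ (ofList [E ++ (Nn ++ K), K, Nn, E, w]) s
    (by
      change (E ++ (Nn ++ K)).length ≤ s
      simp [hKl, hNl, hEl, s]; omega)
    (by
      intro i
      rcases i with _ | _ | _ | _ | i
      · change w.length ≤ s; omega
      · change K.length ≤ s; omega
      · change Nn.length ≤ s; omega
      · change E.length ≤ s; omega
      · have : min (i + 1 + 1 + 1 + 1) 4 = 4 := by omega
        simp only [this]
        change w.length ≤ s; omega)
    (by
      intro r hr
      simp [ofList, List.getD, List.getElem?_eq_none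
        (show [E ++ (Nn ++ K), K, Nn, E, w].length ≤ r by simpa using hr)])
  have hN : (ofList [E ++ (Nn ++ K), K, Nn, E, w] 0).length = m k + 1 + n + k := by
    change (E ++ (Nn ++ K)).length = _
    simp [hKl, hNl, hEl]; omega
  have henv : (fun i => val (ofList [E ++ (Nn ++ K), K, Nn, E, w] (if i = 0 then 4 else min i 4))) =
      inputEnv k n (m k) w := by
    funext i
    rcases i with _ | _ | _ | _ | i
    · rfl
    · exact val_replicate_true k
    · exact val_replicate_true n
    · change val E = 2 ^ m k - 1
      rw [hE, ← val_replicate_true]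
      exact encodeNat_val_append _ 1
    · have : min (i + 1 + 1 + 1 + 1) 4 = 4 := by omega
      simp only [this]
      rfl
  rw [hN, henv] at hlv
  have e4 : Function.update (ofList [E ++ (Nn ++ K), K, Nn, E, w]) 5 l =
      ofList [E ++ (Nn ++ K), K, Nn, E, w, l] := by
    rw [← ofList_append_replicate [E ++ (Nn ++ K), K, Nn, E, w] 1, update_ofList _ (by simp)]
    rfl
  rw [e4] at s4
  have b1 := runsIn_clear (a := 0) (L := [E ++ (Nn ++ K), K, Nn, E, w, l]) (by simp)
  have b2 := runsIn_clear (a := 1) (L := [[], K, Nn, E, w, l]) (by simp)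
  have b3 := runsIn_clear (a := 2) (L := [[], [], Nn, E, w, l]) (by simp)
  have b4 := runsIn_clear (a := 3) (L := [[], [], [], E, w, l]) (by simp)
  have b5 := runsIn_clear (a := 4) (L := [[], [], [], [], w, l]) (by simp)
  have b6 := (runsIn_stripProg l).shift_ofList [[], [], [], [], []]
  have sfin : RunsIn fin (ofList [E ++ (Nn ++ K), K, Nn, E, w, l])
      (10 * s + 100 + 8 * l.length) (ofList ([[], [], [], [], []] ++ [encodeNat (val l)])) := by
    refine (b1.seq (b2.seq (b3.seq (b4.seq (b5.seq b6))))).mono ?_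
    simp [hKl, hNl, hEl, s]; omega
  have e5 : ofList ([[], [], [], [], []] ++ [encodeNat (val l)]) =
      single 5 (encodeNat (F (m k + 1 + n + k) (inputEnv k n (m k) w))) := by
    rw [← hlv]
    funext r
    rcases r with _ | _ | _ | _ | _ | _ | r <;> simp [single, ofList, List.getD]
  rw [e0, ← e5]
  have htotal := s1.seq (sprep.seq (s4.seq sfin))
  refine htotal.mono ?_
  have h1 := hC (m k) (k + n + w.length + 1)
  rw [show m k + (k + n + w.length + 1) = s by omega, hq] at h1
  have h2 : 1 ≤ (k + n + w.length + 2) ^ e := Nat.one_le_pow _ _ (by omega)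
  have h3 : τ k ≤ τ k * (k + n + w.length + 2) ^ e := Nat.le_mul_of_pos_right _ h2
  simp only [Polynomial.eval_pow, Polynomial.eval_add, Polynomial.eval_X, Polynomial.eval_ofNat,
    add_mul]
  rw [show k + n + w.length + 1 + 1 = k + n + w.length + 2 by omega] at h1
  omega

end Prog

/-! ### From arithmetic functions to fixed-parameter tractability -/

namespace Prog

/-- This removes machines from the problem: it remains to write the count as an arithmetic function
of the input and of one computable number `m k`. -/
theorem isFPT_of_arith (Φ : GraphProperty) {F : ℕ → (ℕ → ℕ) → ℕ} (hF : Arith F) {m : ℕ → ℕ}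
    (hm : Computable m)
    (h : ∀ x : EdgeSubInstance,
      F (m x.k + 1 + x.n + x.k) (inputEnv x.k x.n (m x.k) (adjBits x.graph)) =
        (edgeSubs Φ x.k x.graph).ncard) : (sharpEdgeSub Φ).IsFPT := by
  obtain ⟨P, f, p, hf, hP⟩ := exists_prog_arith hF hm
  obtain ⟨d, hd⟩ := P.exists_regLt
  -- The number of stacks is enlarged so that the input register `2` and the output register `5`
  -- exist whatever `d` is.
  let i : Fin (d + 6 + 1) := ⟨2, by omega⟩
  let o : Fin (d + 6 + 1) := ⟨5, by omega⟩
  refine ⟨⟨codeTM (P.code 0) (d + 6) i o, Equiv.refl Bool, Equiv.refl Bool⟩, fun k => f k + 1,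
    p + 1, Computable.succ.comp hf, fun (x : EdgeSubInstance) => ?_⟩
  obtain ⟨t, ht, hrun⟩ := hP x.k x.n (adjBits x.graph)
  rw [h x] at hrun
  obtain ⟨r⟩ := Run.outputsInTime (hd.mono (by omega : d ≤ d + 6 + 1)) i o hrun
  have hlen : ((sharpEdgeSub Φ).encode x).length =
      x.k + x.n + (adjBits x.graph).length + 2 := by
    change (List.replicate x.k true ++ false :: (List.replicate x.n true ++ false ::
      adjBits x.graph)).length = _
    simp; omega
  have hle : t + 1 ≤ (f x.k + 1) * (p + 1).eval ((sharpEdgeSub Φ).encode x).length := by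
    have h1 : p.eval (x.k + x.n + (adjBits x.graph).length) ≤
        p.eval ((sharpEdgeSub Φ).encode x).length := eval_mono p (by omega)
    rw [Polynomial.eval_add, Polynomial.eval_one]
    calc t + 1 ≤ f x.k * p.eval ((sharpEdgeSub Φ).encode x).length + 1 := by
            exact Nat.add_le_add_right (ht.trans (Nat.mul_le_mul_left _ h1)) 1
      _ ≤ _ := by ring_nf; omega
  have e1 : ((sharpEdgeSub Φ).encode x).map (Equiv.refl Bool).symm =
      (sharpEdgeSub Φ).encode x := by simp
  have e2 : (encodeNat ((sharpEdgeSub Φ).count x)).map (Equiv.refl Bool).symm =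
      encodeNat ((sharpEdgeSub Φ).count x) := by simp
  have key : ∀ a b : List Bool, a = (sharpEdgeSub Φ).encode x →
      b = encodeNat ((sharpEdgeSub Φ).count x) →
      Turing.TM2OutputsInTime (codeTM (P.code 0) (d + 6) i o) a (some b) (t + 1) := by
    rintro _ _ rfl rfl
    exact r
  exact ⟨⟨(key _ _ e1 e2).toEvalsTo, (key _ _ e1 e2).steps_le_m.trans hle⟩⟩

end Prog

/-! ### Vertex covers of graphs with small matching number -/

namespace SimpleGraph

/-- The number of neighbours of a vertex. -/
noncomputable def ndeg {V : Type} (H : SimpleGraph V) (v : V) : ℕ := (H.neighborSet v).ncard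

/-- The vertices of degree more than `D`, and the endpoints of the edges between vertices of degree
at most `D`. -/
def core {V : Type} (H : SimpleGraph V) (D : ℕ) : Set V :=
  {v | D < H.ndeg v ∨ H.ndeg v ≤ D ∧ ∃ w, H.Adj v w ∧ H.ndeg w ≤ D}

/-- An edge without an endpoint of degree more than `D` has both endpoints in the core by
definition. In contrast to a cover taken from a maximum matching, the core involves no choice, so
each subgraph is counted once. -/
theorem core_cover {V : Type} (H : SimpleGraph V) (D : ℕ) {v w : V} (h : H.Adj v w) :
    v ∈ H.core D ∨ w ∈ H.core D := by
  simp only [core, Set.mem_ofPred_eq]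
  by_cases h1 : D < H.ndeg v
  · exact .inl (.inl h1)
  by_cases h2 : D < H.ndeg w
  · exact .inr (.inl h2)
  exact .inl (.inr ⟨by omega, w, h, by omega⟩)

theorem bddAbove_matching {V : Type} [Finite V] (H : SimpleGraph V) :
    BddAbove {m : ℕ | ∃ S : H.Subgraph, S.IsMatching ∧ S.edgeSet.ncard = m} :=
  ⟨H.edgeSet.ncard, by
    rintro m ⟨S, -, rfl⟩
    exact Set.ncard_le_ncard S.edgeSet_subset (Set.toFinite _)⟩

theorem le_matchingNumber {V : Type} [Finite V] {H : SimpleGraph V} {S : H.Subgraph}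
    (hS : S.IsMatching) : S.edgeSet.ncard ≤ matchingNumber H :=
  le_csSup H.bddAbove_matching ⟨S, hS, rfl⟩

theorem exists_matching_card_eq {V : Type} [Finite V] (H : SimpleGraph V) :
    ∃ S : H.Subgraph, S.IsMatching ∧ S.edgeSet.ncard = matchingNumber H :=
  Nat.sSup_mem (s := {m : ℕ | ∃ S : H.Subgraph, S.IsMatching ∧ S.edgeSet.ncard = m})
    ⟨0, ⊥, by simp [Subgraph.IsMatching], by simp⟩ H.bddAbove_matching

theorem matchingNumber_le_ncard_edgeSet {V : Type} [Finite V] (H : SimpleGraph V) :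
    matchingNumber H ≤ H.edgeSet.ncard := by
  obtain ⟨S, -, h⟩ := H.exists_matching_card_eq
  rw [← h]
  exact Set.ncard_le_ncard S.edgeSet_subset (Set.toFinite _)

/-- The vertices of a maximum matching work: an edge that avoids all of them could be added to the
matching. -/
theorem exists_cover {V : Type} [Finite V] (H : SimpleGraph V) :
    ∃ C : Set V, C.ncard ≤ 2 * matchingNumber H ∧ ∀ v w, H.Adj v w → v ∈ C ∨ w ∈ C := by
  classical
  obtain ⟨S, hS, hc⟩ := H.exists_matching_card_eq
  refine ⟨S.verts, ?_, fun v w hvw => ?_⟩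
  · rw [← hc]
    have h1 : S.verts ⊆ ⋃ e ∈ S.edgeSet.toFinite.toFinset, (e.toFinset : Set V) := by
      intro v hv
      obtain ⟨w, hw, -⟩ := hS hv
      simp only [Set.mem_iUnion]
      exact ⟨s(v, w), by simpa using hw, by simp⟩
    have h2 := (Set.ncard_le_ncard h1 (Set.toFinite _)).trans
      (Finset.set_ncard_biUnion_le _ _)
    refine h2.trans ?_
    rw [Set.ncard_eq_toFinset_card _, mul_comm]
    refine Finset.sum_le_card_nsmul _ _ 2 fun e he => ?_
    rw [Set.ncard_coe_finset]
    induction e with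
    | _ a b =>
      rw [Sym2.toFinset_mk_eq]
      exact Finset.card_le_two
  · by_contra! h
    have hd : Disjoint S.support (H.subgraphOfAdj hvw).support := by
      rw [Set.disjoint_left]
      intro x hx hx'
      have hx := S.support_subset_verts hx
      have hx' := Subgraph.support_subset_verts _ hx'
      simp only [subgraphOfAdj_verts, Set.mem_insert_iff, Set.mem_singleton_iff] at hx'
      rcases hx' with rfl | rfl
      · exact h.1 hx
      · exact h.2 hx
    have := le_matchingNumber (hS.sup (Subgraph.IsMatching.subgraphOfAdj hvw) hd)
    rw [Subgraph.edgeSet_sup, edgeSet_subgraphOfAdj, Set.union_singleton,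
      Set.ncard_insert_of_notMem _ (Set.toFinite _)] at this
    · omega
    · intro he
      exact h.1 (S.edge_vert he)

/-- A vertex outside the cover `C` has all its neighbours in `C`, so its degree is at most `D`. If
it is in the core, it thus has a neighbour of degree at most `D`, which lies in `C`; the at most `D`
such vertices have at most `D` neighbours each. -/
theorem ncard_core_le {V : Type} [Finite V] (H : SimpleGraph V) {D : ℕ} {C : Set V}
    (hC' : C.ncard ≤ D) (hcov : ∀ v w, H.Adj v w → v ∈ C ∨ w ∈ C) :
    (H.core D).ncard ≤ D + D * D := by
  classical
  let C' : Finset V := C.toFinite.toFinset.filter fun v => H.ndeg v ≤ D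
  have hsub : H.core D ⊆ C ∪ ⋃ w ∈ C', H.neighborSet w := by
    rintro v hv
    by_cases hvC : v ∈ C
    · exact .inl hvC
    right
    rcases hv with hv | ⟨-, w, hw, hwd⟩
    · exfalso
      have : H.neighborSet v ⊆ C := fun w hw => (hcov v w hw).resolve_left hvC
      have := Set.ncard_le_ncard this (Set.toFinite _)
      simp only [ndeg] at hv
      omega
    · simp only [Set.mem_iUnion]
      exact ⟨w, by simp [C', hwd, (hcov v w hw).resolve_left hvC], hw.symm⟩
  have hcard : C'.card ≤ D := by
    refine (Finset.card_filter_le _ _).trans ?_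
    rwa [← Set.ncard_eq_toFinset_card]
  refine (Set.ncard_le_ncard hsub (Set.toFinite _)).trans ((Set.ncard_union_le _ _).trans ?_)
  refine Nat.add_le_add hC' ((Finset.set_ncard_biUnion_le _ _).trans ?_)
  refine (Finset.sum_le_card_nsmul _ _ D fun w hw => ?_).trans
    (Nat.mul_le_mul_right _ hcard)
  exact (Finset.mem_filter.1 hw).2

theorem ncard_edgeSet_induce_support {V : Type} (H : SimpleGraph V) :
    (H.induce H.support).edgeSet.ncard = H.edgeSet.ncard := by
  have h : H.edgeSet = Sym2.map Subtype.val '' (H.induce H.support).edgeSet := by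
    ext e
    constructor
    · induction e with
      | _ v w =>
        intro h
        exact ⟨s(⟨v, w, h⟩, ⟨w, v, h.symm⟩), h, rfl⟩
    · rintro ⟨e, he, rfl⟩
      induction e with
      | _ v w => exact he
  rw [h, Set.ncard_image_of_injective _ (Sym2.map.injective Subtype.val_injective)]

/-- The disjoint union of `k` edges. -/
def edges (k : ℕ) : SimpleGraph (Fin (2 * k)) where
  Adj i j := (i : ℕ) ≠ j ∧ (i : ℕ) / 2 = j / 2
  symm := ⟨fun _ _ h => ⟨h.1.symm, h.2.symm⟩⟩
  loopless := ⟨fun _ h => h.1 rfl⟩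

theorem ncard_edgeSet_edges (k : ℕ) : (edges k).edgeSet.ncard = k := by
  have h : (edges k).edgeSet = Set.range fun i : Fin k =>
      s((⟨2 * i, by omega⟩ : Fin (2 * k)), (⟨2 * i + 1, by omega⟩ : Fin (2 * k))) := by
    ext e
    induction e with
    | _ a b =>
      simp only [mem_edgeSet, Set.mem_range, Sym2.eq_iff, edges, Fin.ext_iff]
      constructor
      · rintro ⟨h1, h2⟩
        exact ⟨⟨a / 2, by omega⟩, by simp only; omega⟩
      · rintro ⟨i, h⟩
        omega
  rw [h, ← Set.image_univ, Set.ncard_image_of_injective]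
  · simp
  · intro i j hij
    simp only [Sym2.eq_iff, Fin.ext_iff] at hij
    ext
    omega

theorem le_matchingNumber_edges (k : ℕ) : k ≤ matchingNumber (edges k) := by
  have h : (⊤ : (edges k).Subgraph).IsMatching := by
    intro v _
    -- The partner of `v` is the other number with the same quotient by two.
    refine ⟨⟨if (v : ℕ) % 2 = 0 then v + 1 else v - 1, by split_ifs <;> omega⟩, ?_, ?_⟩
    · change (v : ℕ) ≠ (if (v : ℕ) % 2 = 0 then (v : ℕ) + 1 else v - 1) ∧
        (v : ℕ) / 2 = (if (v : ℕ) % 2 = 0 then (v : ℕ) + 1 else v - 1) / 2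
      split_ifs <;> omega
    · rintro w hw
      change (v : ℕ) ≠ w ∧ (v : ℕ) / 2 = w / 2 at hw
      ext
      simp only
      split_ifs <;> omega
  have := le_matchingNumber h
  rwa [Subgraph.edgeSet_top, ncard_edgeSet_edges] at this

end SimpleGraph

/-- If the hypothesis bounds the graphs with the value of `H`, it applies to `H` directly. Otherwise
it applies to `k` disjoint edges, which gives `k ≤ M`, and no graph with `k` edges has a larger
matching number than `k`. -/
theorem matchingNumber_le_of_holds_ne (Φ : GraphProperty) {M k : ℕ}
    (hM : (∀ (V : Type) [Finite V] (H : SimpleGraph V),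
        H.edgeSet.ncard = k → Φ.Holds H → matchingNumber H ≤ M) ∨
      (∀ (V : Type) [Finite V] (H : SimpleGraph V),
        H.edgeSet.ncard = k → ¬ Φ.Holds H → matchingNumber H ≤ M))
    {V : Type} [Finite V] (H : SimpleGraph V) (hk : H.edgeSet.ncard = k)
    (hH : ¬(Φ.Holds H ↔ Φ.Holds (SimpleGraph.edges k))) : matchingNumber H ≤ M := by
  have h1 : matchingNumber H ≤ k := hk ▸ H.matchingNumber_le_ncard_edgeSet
  have h2 := SimpleGraph.le_matchingNumber_edges k
  by_cases hf : Φ.Holds (SimpleGraph.edges k)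
  · have hn : ¬ Φ.Holds H := fun h => hH ⟨fun _ => hf, fun _ => h⟩
    rcases hM with hM | hM
    · exact h1.trans (h2.trans (hM _ _ (SimpleGraph.ncard_edgeSet_edges k) hf))
    · exact hM _ _ hk hn
  · have hn : Φ.Holds H := by
      by_contra h
      exact hH ⟨fun h' => absurd h' h, fun h' => absurd h' hf⟩
    rcases hM with hM | hM
    · exact hM _ _ hk hn
    · exact h1.trans (h2.trans (hM _ _ (SimpleGraph.ncard_edgeSet_edges k) hf))

/-! ### Encoding graphs with a small core by labels -/

/-- The label of a vertex `v`: the index of `v` in an enumeration of the core, and the indices of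
the neighbours of `v` in the core that do not come after `v`. -/
abbrev Label (T : ℕ) := Option (Fin T) × Finset (Fin T)

namespace Label

variable {T : ℕ}

/-- The second label belongs to a core vertex that is a registered neighbour of the first one. -/
def Points (a b : Label T) : Prop := ∃ i ∈ a.2, b.1 = some i ∧ ∀ j, a.1 = some j → i < j

/-- The adjacency of vertices in terms of their labels. -/
def Rel (a b : Label T) : Prop := Points a b ∨ Points b a

theorem Rel.symm {a b : Label T} (h : Rel a b) : Rel b a := Or.symm h

theorem not_rel_self (a : Label T) : ¬ Rel a a := by
  rintro (⟨i, -, h, h'⟩ | ⟨i, -, h, h'⟩) <;> exact lt_irrefl _ (h' i h)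

/-- The label of an isolated vertex. -/
def isolated : Label T := (none, ∅)

theorem not_rel_isolated (a : Label T) : ¬ Rel isolated a := by
  rintro (⟨i, h, -⟩ | ⟨i, -, h, -⟩) <;> simp [isolated] at h

/-- The graph given by a labelling of the vertices. -/
def graph {V : Type} (l : V → Label T) : SimpleGraph V where
  Adj v w := Rel (l v) (l w)
  symm := ⟨fun _ _ h => h.symm⟩
  loopless := ⟨fun v h => not_rel_self (l v) h⟩

/-- The tuple `u` is an increasing enumeration of a set of numbers below `n`, filled up
with `n`. -/
def ValidTuple (n : ℕ) (u : Fin T → ℕ) : Prop :=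
  (∀ i, u i ≤ n) ∧ ∀ i j, i < j → u i < u j ∨ u i = n ∧ u j = n

/-- The label `a` of the vertex `v` describes `v` with respect to the enumeration `u`, and all
registered neighbours are neighbours in `G`. -/
def Fits {n : ℕ} (G : SimpleGraph (Fin n)) (u : Fin T → ℕ) (v : Fin n) (a : Label T) : Prop :=
  (∀ j, a.1 = some j ↔ u j = v) ∧
    ∀ i ∈ a.2, (∃ h : u i < n, G.Adj v ⟨u i, h⟩) ∧ ∀ j, a.1 = some j → i < j

theorem ValidTuple.eq_of_eq {n : ℕ} {u : Fin T → ℕ} (hu : ValidTuple n u) {i j : Fin T}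
    (h : u i = u j) (hi : u i < n) : i = j := by
  rcases lt_trichotomy i j with h' | h' | h'
  · have := hu.2 i j h'; omega
  · exact h'
  · have := hu.2 j i h'; omega

/-- At the first position where the tuples differ, the smaller entry would have to occur in the
other tuple as well. It is too small for a later position there, and an earlier position would make
it a repeated entry of its own tuple. -/
theorem ValidTuple.ext {n : ℕ} {u u' : Fin T → ℕ} (hu : ValidTuple n u) (hu' : ValidTuple n u')
    (h : ∀ x < n, (∃ i, u i = x) ↔ ∃ i, u' i = x) : u = u' := by
  have key : ∀ {u u' : Fin T → ℕ}, ValidTuple n u → ValidTuple n u' →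
      (∀ x < n, (∃ i, u i = x) ↔ ∃ i, u' i = x) → ∀ i, (∀ j < i, u j = u' j) → ¬ u i < u' i := by
    intro u u' hu hu' h i hi hlt
    have h1 := hu'.1 i
    obtain ⟨j, hj⟩ := (h (u i) (by omega)).1 ⟨i, rfl⟩
    rcases lt_trichotomy i j with h' | h' | h'
    · have := hu'.2 i j h'; omega
    · subst h'; omega
    · have := hu.eq_of_eq ((hi j h').trans hj) (by have := hi j h'; omega)
      exact absurd this h'.ne
  funext i
  induction i using WellFoundedLT.induction with
  | _ i ih =>
    have h1 := key hu hu' h i ih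
    have h2 := key hu' hu (fun x hx => (h x hx).symm) i fun j hj => (ih j hj).symm
    omega

theorem exists_validTuple {n : ℕ} (C : Set (Fin n)) (hC : C.ncard ≤ T) :
    ∃ u : Fin T → ℕ, ValidTuple n u ∧ ∀ v : Fin n, v ∈ C ↔ ∃ i, u i = v := by
  classical
  let S := C.toFinite.toFinset
  have hS : S.card ≤ T := by rwa [← Set.ncard_eq_toFinset_card]
  let e := S.orderEmbOfFin rfl
  refine ⟨fun i => if h : (i : ℕ) < S.card then e ⟨i, h⟩ else n, ⟨fun i => ?_, fun i j hij => ?_⟩,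
    fun v => ?_⟩
  · simp only
    split_ifs
    · exact (e _).2.le
    · exact le_rfl
  · have hij' : (i : ℕ) < j := hij
    simp only
    split_ifs with h1 h2 h2
    · left
      exact e.strictMono (show (⟨i, h1⟩ : Fin S.card) < ⟨j, h2⟩ from hij')
    · exact .inl (e _).2
    · omega
    · exact .inr ⟨rfl, rfl⟩
  · have h1 : v ∈ C ↔ v ∈ Set.range e := by
      rw [Finset.range_orderEmbOfFin]
      simp [S]
    rw [h1]
    constructor
    · rintro ⟨i, rfl⟩
      exact ⟨⟨i, i.2.trans_le hS⟩, by simp⟩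
    · rintro ⟨i, hi⟩
      simp only at hi
      split_ifs at hi with h
      · exact ⟨_, Fin.ext hi⟩
      · exact absurd hi v.2.ne'

variable {n : ℕ} {G : SimpleGraph (Fin n)} {u : Fin T → ℕ} {l : Fin n → Label T}

/-- The second components can be read off from the graph and the enumeration, so two labellings of
the same graph agree. An edge inside the core is registered only at the endpoint with the larger
index, since registering it at either end would allow several labellings. -/
theorem mem_snd_iff (hl : ∀ v, Fits G u v (l v)) (v : Fin n) (i : Fin T) :
    i ∈ (l v).2 ↔ (∃ h : u i < n, (graph l).Adj v ⟨u i, h⟩) ∧ ∀ j, (l v).1 = some j → i < j := by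
  constructor
  · intro hi
    obtain ⟨⟨h, -⟩, h'⟩ := (hl v).2 i hi
    exact ⟨⟨h, .inl ⟨i, hi, ((hl ⟨u i, h⟩).1 i).2 rfl, h'⟩⟩, h'⟩
  · rintro ⟨⟨h, ⟨i', hi', h1, -⟩ | ⟨j, hj, h1, h2⟩⟩, h'⟩
    · rw [((hl ⟨u i, h⟩).1 i).2 rfl] at h1
      cases h1
      exact hi'
    · exact absurd (h2 i (((hl ⟨u i, h⟩).1 i).2 rfl)) (h' j h1).not_gt

theorem graph_le (hl : ∀ v, Fits G u v (l v)) : graph l ≤ G := by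
  have h : ∀ v w, Points (l v) (l w) → G.Adj v w := by
    rintro v w ⟨i, hi, h1, h2⟩
    obtain ⟨⟨h, h'⟩, -⟩ := (hl v).2 i hi
    have := ((hl w).1 i).1 h1
    rwa [show (⟨u i, h⟩ : Fin n) = w from Fin.ext this] at h'
  rintro v w (hvw | hvw)
  · exact h v w hvw
  · exact (h w v hvw).symm

theorem exists_index_iff (hl : ∀ v, Fits G u v (l v)) (v : Fin n) :
    (l v).1.isSome ↔ ∃ i, u i = v := by
  rw [Option.isSome_iff_exists]
  exact exists_congr fun i => (hl v).1 i

/-- The pairs of an enumeration of the core and a labelling that describe a subgraph of `G` with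
the property `Q`. -/
def Describes (G : SimpleGraph (Fin n)) (D : ℕ) (Q : SimpleGraph (Fin n) → Prop)
    (p : (Fin T → ℕ) × (Fin n → Label T)) : Prop :=
  ValidTuple n p.1 ∧ (∀ v, Fits G p.1 v (p.2 v)) ∧
    (∀ v, v ∈ (graph p.2).core D ↔ (p.2 v).1.isSome) ∧ Q (graph p.2)

/-- Injectivity: the indexed vertices are the core of the graph, which fixes the enumeration; this
fixes the indices, and then `mem_snd_iff` fixes the labels. Surjectivity: every edge meets the core
and so can be registered at one of its ends. -/
theorem bijOn_describes (G : SimpleGraph (Fin n)) (D : ℕ) (Q : SimpleGraph (Fin n) → Prop)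
    (hQ : ∀ H, Q H → (H.core D).ncard ≤ T) :
    Set.BijOn (fun p : (Fin T → ℕ) × (Fin n → Label T) => graph p.2) {p | Describes G D Q p}
      {H | H ≤ G ∧ Q H} := by
  classical
  refine ⟨?_, ?_, ?_⟩
  · rintro ⟨u, l⟩ ⟨-, h2, -, h4⟩
    exact ⟨graph_le h2, h4⟩
  · rintro ⟨u, l⟩ ⟨h1, h2, h3, -⟩ ⟨u', l'⟩ ⟨h1', h2', h3', -⟩ he
    simp only at h1 h2 h3 h1' h2' h3' he
    have hu : u = u' := by
      refine h1.ext h1' fun x hx => ?_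
      have a1 := exists_index_iff h2 ⟨x, hx⟩
      have a2 := exists_index_iff h2' ⟨x, hx⟩
      rw [← h3] at a1
      rw [← h3', ← he] at a2
      exact a1.symm.trans a2
    subst hu
    have hfst : ∀ v, (l v).1 = (l' v).1 := by
      intro v
      refine Option.ext fun j => ?_
      rw [(h2 v).1 j, (h2' v).1 j]
    have hl : l = l' := by
      funext v
      refine Prod.ext (hfst v) ?_
      ext i
      rw [mem_snd_iff h2, mem_snd_iff h2', he, hfst]
    rw [hl]
  · rintro H ⟨hHG, hH⟩
    obtain ⟨u, hu, hC⟩ := exists_validTuple (H.core D) (hQ H hH)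
    let τ : Fin n → Option (Fin T) := fun v => if h : ∃ i, u i = v then some h.choose else none
    have hτ : ∀ v j, τ v = some j ↔ u j = v := by
      intro v j
      simp only [τ]
      split_ifs with h
      · have h' := h.choose_spec
        constructor
        · intro he
          rw [← Option.some_injective _ he, h']
        · intro he
          rw [hu.eq_of_eq (h'.trans he.symm) (by rw [h']; exact v.2)]
      · simp only [false_iff]
        exact fun he => h ⟨j, he⟩
    let l : Fin n → Label T := fun v => (τ v, Finset.univ.filter fun i =>
      (∃ h : u i < n, H.Adj v ⟨u i, h⟩) ∧ ∀ j, τ v = some j → i < j)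
    have hl : ∀ v, Fits G u v (l v) := by
      intro v
      refine ⟨hτ v, fun i hi => ?_⟩
      obtain ⟨⟨h, h'⟩, h''⟩ := (Finset.mem_filter.1 hi).2
      exact ⟨⟨h, hHG h'⟩, h''⟩
    have hg : graph l = H := by
      ext v w
      have hpt : ∀ v w, Points (l v) (l w) → H.Adj v w := by
        rintro v w ⟨i, hi, h1, h2⟩
        obtain ⟨⟨h, h'⟩, -⟩ := (Finset.mem_filter.1 hi).2
        have := (hτ w i).1 h1
        rwa [show (⟨u i, h⟩ : Fin n) = w from Fin.ext this] at h'
      -- An edge to the core vertex `w` of index `i` is registered at `v`, unless `v` is itself a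
      -- core vertex of smaller index; in that case it is registered at `w`.
      have hcov : ∀ v w i, H.Adj v w → u i = w → Points (l v) (l w) ∨ Points (l w) (l v) := by
        intro v w i hvw hi
        have hw : u i < n := hi ▸ w.2
        have hwe : (⟨u i, hw⟩ : Fin n) = w := Fin.ext hi
        by_cases h : ∀ j, τ v = some j → i < j
        · exact .inl ⟨i, Finset.mem_filter.2 ⟨Finset.mem_univ _, ⟨hw, hwe ▸ hvw⟩, h⟩,
            (hτ w i).2 hi, h⟩
        · push Not at h
          obtain ⟨j, hj, hji⟩ := h
          have hj' := (hτ v j).1 hj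
          have hv : u j < n := hj' ▸ v.2
          have hve : (⟨u j, hv⟩ : Fin n) = v := Fin.ext hj'
          have hne : j ≠ i := by
            rintro rfl
            exact hvw.ne (hve.symm.trans hwe)
          have hlt : ∀ i', τ w = some i' → j < i' := by
            intro i' hi'
            rw [(hτ w i).2 hi] at hi'
            cases hi'
            exact lt_of_le_of_ne hji hne
          exact .inr ⟨j, Finset.mem_filter.2 ⟨Finset.mem_univ _, ⟨hv, hve ▸ hvw.symm⟩, hlt⟩,
            hj, hlt⟩
      constructor
      · rintro (h | h)
        · exact hpt v w h
        · exact (hpt w v h).symm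
      · intro h
        rcases H.core_cover D h with h' | h'
        · obtain ⟨i, hi⟩ := (hC v).1 h'
          exact (hcov w v i h.symm hi).symm
        · obtain ⟨i, hi⟩ := (hC w).1 h'
          exact hcov v w i h hi
    refine ⟨(u, l), ⟨hu, hl, fun v => ?_, ?_⟩, hg⟩
    · change v ∈ (graph l).core D ↔ _
      rw [hg, hC, exists_index_iff hl]
    · change Q (graph l)
      rwa [hg]

end Label

/-! ### Label multiplicities determine the graph up to isomorphism and isolated vertices -/

namespace Label

open Classical in
/-- The degree of a vertex with label `a` if there are `c b` vertices with label `b`. -/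
noncomputable def deg {T : ℕ} (c : Label T → ℕ) (a : Label T) : ℕ :=
  ∑ b, if Rel a b then c b else 0

/-- The core vertices are those with an index, if there are `c b` vertices with label `b`. -/
def CoreCond {T : ℕ} (D : ℕ) (c : Label T → ℕ) : Prop :=
  ∀ a, 0 < c a → ((D < deg c a ∨ deg c a ≤ D ∧ ∃ b, Rel a b ∧ 0 < c b ∧ deg c b ≤ D) ↔ a.1.isSome)

open Classical in
/-- The number of vertices with a given label, ignoring isolated vertices. -/
noncomputable def cnt {T n : ℕ} (l : Fin n → Label T) (a : Label T) : ℕ :=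
  if a = isolated then 0 else (Finset.univ.filter fun v => l v = a).card

variable {T n : ℕ}

theorem deg_isolated (c : Label T → ℕ) : deg c isolated = 0 :=
  Finset.sum_eq_zero fun b _ => if_neg (not_rel_isolated b)

theorem cnt_pos_iff {l : Fin n → Label T} {a : Label T} :
    0 < cnt l a ↔ a ≠ isolated ∧ ∃ v, l v = a := by
  unfold cnt
  split_ifs with h
  · simp [h]
  · simp [h, Finset.card_pos, Finset.filter_nonempty_iff]

/-- Adjacency depends on labels only, so neighbours can be counted label by label. Setting the
multiplicity of the isolated label to zero does no harm, because this label is related to no other.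
-/
theorem ndeg_graph (l : Fin n → Label T) (v : Fin n) :
    (graph l).ndeg v = deg (cnt l) (l v) := by
  classical
  have h1 : (graph l).ndeg v = (Finset.univ.filter fun w => Rel (l v) (l w)).card := by
    rw [SimpleGraph.ndeg, ← Set.ncard_coe_finset]
    congr 1
    ext w
    simp [graph]
  rw [h1, Finset.card_eq_sum_card_fiberwise (f := l) (t := Finset.univ) (by simp), deg]
  refine Finset.sum_congr rfl fun b _ => ?_
  rw [Finset.filter_filter]
  split_ifs with h
  · have hb : b ≠ isolated := by
      rintro rfl
      exact not_rel_isolated _ h.symm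
    rw [cnt, if_neg hb]
    congr 1
    ext w
    simp only [Finset.mem_filter, Finset.mem_univ, true_and, and_iff_right_iff_imp]
    rintro rfl
    exact h
  · rw [Finset.card_eq_zero, Finset.filter_eq_empty_iff]
    rintro w - ⟨h1, rfl⟩
    exact h h1

theorem sum_ndeg {V : Type} [Fintype V] (H : SimpleGraph V) :
    ∑ v, H.ndeg v = 2 * H.edgeSet.ncard := by
  classical
  have := H.sum_degrees_eq_twice_card_edges
  rw [← SimpleGraph.coe_edgeFinset, Set.ncard_coe_finset, ← this]
  refine Finset.sum_congr rfl fun v _ => ?_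
  rw [SimpleGraph.ndeg, Set.ncard_eq_toFinset_card']
  rfl

/-- The handshake lemma with vertices grouped by label; the isolated label contributes zero on both
sides. -/
theorem two_mul_ncard_edgeSet (l : Fin n → Label T) :
    ∑ a, cnt l a * deg (cnt l) a = 2 * (graph l).edgeSet.ncard := by
  classical
  rw [← sum_ndeg, ← Finset.sum_fiberwise_of_maps_to (s := Finset.univ) (t := Finset.univ) (g := l)
    (by simp)]
  refine Finset.sum_congr rfl fun a _ => ?_
  by_cases ha : a = isolated
  · subst ha
    rw [deg_isolated, mul_zero, eq_comm]
    refine Finset.sum_eq_zero fun v hv => ?_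
    rw [ndeg_graph, (Finset.mem_filter.1 hv).2, deg_isolated]
  · rw [cnt, if_neg ha, Finset.card_eq_sum_ones, Finset.sum_mul]
    refine Finset.sum_congr rfl fun v hv => ?_
    rw [ndeg_graph, (Finset.mem_filter.1 hv).2, one_mul]

theorem coreCond_iff (D : ℕ) (l : Fin n → Label T) :
    CoreCond D (cnt l) ↔ ∀ v, v ∈ (graph l).core D ↔ (l v).1.isSome := by
  have hb : ∀ v, v ∈ (graph l).core D ↔ (D < deg (cnt l) (l v) ∨ deg (cnt l) (l v) ≤ D ∧
      ∃ b, Rel (l v) b ∧ 0 < cnt l b ∧ deg (cnt l) b ≤ D) := by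
    intro v
    simp only [SimpleGraph.core, Set.mem_ofPred_eq, ndeg_graph]
    refine or_congr_right (and_congr_right fun _ => ?_)
    constructor
    · rintro ⟨w, h1, h2⟩
      refine ⟨l w, h1, cnt_pos_iff.2 ⟨?_, w, rfl⟩, h2⟩
      intro h
      exact not_rel_isolated (l v) (h ▸ Rel.symm h1)
    · rintro ⟨b, h1, h2, h3⟩
      obtain ⟨-, w, rfl⟩ := cnt_pos_iff.1 h2
      exact ⟨w, h1, h3⟩
  constructor
  · intro h v
    rw [hb]
    by_cases hv : l v = isolated
    · rw [hv, deg_isolated]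
      simp only [not_lt_zero, not_rel_isolated]
      simp [isolated]
    · exact h _ (cnt_pos_iff.2 ⟨hv, v, rfl⟩)
  · intro h a ha
    obtain ⟨-, v, rfl⟩ := cnt_pos_iff.1 ha
    rw [← h v, hb]

/-- The label with a given number. -/
noncomputable def ofFin (T : ℕ) : Fin (Fintype.card (Label T)) ≃ Label T :=
  (Fintype.equivFin (Label T)).symm

/-- A list of labels in which every label occurs with the prescribed multiplicity. -/
noncomputable def word (c : Label T → ℕ) : List (Fin (Fintype.card (Label T))) :=
  (List.finRange _).flatMap fun i => List.replicate (c (ofFin T i)) i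

theorem count_word (c : Label T → ℕ) (i : Fin (Fintype.card (Label T))) :
    (word c).count i = c (ofFin T i) := by
  classical
  rw [word, List.count_flatMap]
  have : (List.count i ∘ fun i => List.replicate (c (ofFin T i)) i) =
      fun j => if j = i then c (ofFin T i) else 0 := by
    funext j
    simp only [Function.comp, List.count_replicate, beq_iff_eq]
    split_ifs with h
    · rw [h]
    · rfl
  rw [this, ← List.ofFn_eq_map, List.sum_ofFn, Finset.sum_ite_eq' Finset.univ i]
  simp

/-- The graph of a list of labels. -/
noncomputable def wordGraph (w : List (Fin (Fintype.card (Label T)))) :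
    SimpleGraph (Fin w.length) :=
  graph fun x => ofFin T (w.get x)

theorem card_fiber_get {α : Type} [DecidableEq α] (w : List α) (a : α) :
    Fintype.card {x : Fin w.length // w.get x = a} = w.count a := by
  rw [Fintype.card_subtype, ← Multiset.coe_count]
  conv_rhs => rw [← List.ofFn_get w, ← Fin.univ_val_map, Multiset.count_map]
  rw [Finset.card_def, Finset.filter_val]
  simp only [eq_comm]

/-- A vertex with an index lies in the core, and core vertices have neighbours. A vertex without an
index and with a label other than the isolated one has a registered neighbour. -/
theorem mem_support_graph {G : SimpleGraph (Fin n)} {u : Fin T → ℕ} {l : Fin n → Label T} {D : ℕ}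
    (hl : ∀ v, Fits G u v (l v)) (hc : ∀ v, v ∈ (graph l).core D ↔ (l v).1.isSome) (v : Fin n) :
    v ∈ (graph l).support ↔ l v ≠ isolated := by
  rw [SimpleGraph.mem_support]
  constructor
  · rintro ⟨w, h⟩ hv
    exact not_rel_isolated (l w) (hv ▸ h)
  · intro hv
    by_cases h : (l v).1.isSome
    · rcases (hc v).2 h with h | ⟨-, w, h, -⟩
      · have : ((graph l).neighborSet v).Nonempty := by
          rw [← Set.ncard_pos]
          exact (Nat.zero_le _).trans_lt h
        exact this
      · exact ⟨w, h⟩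
    · have hs : (l v).2.Nonempty := by
        by_contra hs
        refine hv (Prod.ext ?_ (Finset.not_nonempty_iff_eq_empty.1 hs))
        change (l v).1 = none
        simpa using h
      obtain ⟨i, hi⟩ := hs
      obtain ⟨⟨h', h''⟩, -⟩ := (mem_snd_iff hl v i).1 hi
      exact ⟨_, h''⟩

/-- For every label the two vertex sets have the same number of vertices with that label. Bijections
between these classes combine to an isomorphism, since adjacency is a relation between labels. -/
theorem wordGraph_iso {G : SimpleGraph (Fin n)} {u : Fin T → ℕ} {l : Fin n → Label T} {D : ℕ}
    (hl : ∀ v, Fits G u v (l v)) (hc : ∀ v, v ∈ (graph l).core D ↔ (l v).1.isSome) :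
    Nonempty (wordGraph (word (cnt l)) ≃g (graph l).induce (graph l).support) := by
  classical
  have hf : ∀ a, Nonempty ({x : Fin (word (cnt l)).length // ofFin T ((word (cnt l)).get x) = a} ≃
      {y : (graph l).support // l y = a}) := by
    intro a
    refine ⟨Fintype.equivOfCardEq ?_⟩
    have h1 : Fintype.card {x : Fin (word (cnt l)).length // ofFin T ((word (cnt l)).get x) = a} =
        cnt l a := by
      have := card_fiber_get (word (cnt l)) ((ofFin T).symm a)
      rw [count_word, Equiv.apply_symm_apply] at this
      rw [← this]
      exact Fintype.card_congr (Equiv.subtypeEquivRight fun x => by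
        rw [Equiv.eq_symm_apply])
    rw [h1, cnt]
    split_ifs with ha
    · rw [eq_comm, Fintype.card_eq_zero_iff]
      exact ⟨fun y => (mem_support_graph hl hc _).1 y.1.2 (y.2.trans ha)⟩
    · rw [← Fintype.card_subtype]
      exact Fintype.card_congr
        { toFun := fun v => ⟨⟨v, (mem_support_graph hl hc _).2 fun h => ha (v.2.symm.trans h)⟩, v.2⟩
          invFun := fun y => ⟨y.1, y.2⟩
          left_inv := fun _ => rfl
          right_inv := fun _ => rfl }
  let φ := Equiv.ofFiberEquiv (f := fun x : Fin (word (cnt l)).length =>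
    ofFin T ((word (cnt l)).get x)) (g := fun y : (graph l).support => l y)
    fun a => (hf a).some
  have hφ : ∀ x, l (φ x) = ofFin T ((word (cnt l)).get x) := fun x =>
    Equiv.ofFiberEquiv_map (f := fun x : Fin (word (cnt l)).length =>
      ofFin T ((word (cnt l)).get x)) (g := fun y : (graph l).support => l y)
      (fun a => (hf a).some) x
  refine ⟨⟨φ, ?_⟩⟩
  intro x y
  change Rel (l (φ x)) (l (φ y)) ↔ Rel _ _
  rw [hφ, hφ]

/-- The condition on label counts that describes the `k`-edge graphs with small core on which `Φ`
differs from its value on `k` disjoint edges. -/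
def Good (Φ : GraphProperty) (D k : ℕ) (c : Label T → ℕ) : Prop :=
  ∑ a, c a * deg c a = 2 * k ∧ CoreCond D c ∧
    ¬(Φ.Holds (wordGraph (word c)) ↔ Φ.Holds (SimpleGraph.edges k))

/-- All conditions on the subgraph become conditions on the multiplicities. The replacement of the
induced subgraph by `wordGraph` in `Φ` needs the core condition, which is available on either side.
-/
theorem describes_iff (Φ : GraphProperty) (G : SimpleGraph (Fin n)) (D k : ℕ)
    (p : (Fin T → ℕ) × (Fin n → Label T)) :
    Describes G D (fun H => H.edgeSet.ncard = k ∧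
      ¬(Φ.Holds (H.induce H.support) ↔ Φ.Holds (SimpleGraph.edges k))) p ↔
      ValidTuple n p.1 ∧ (∀ v, Fits G p.1 v (p.2 v)) ∧ Good Φ D k (cnt p.2) := by
  refine and_congr_right fun _ => and_congr_right fun hl => ?_
  rw [Good, coreCond_iff, two_mul_ncard_edgeSet]
  constructor
  · rintro ⟨h1, h2, h3⟩
    refine ⟨by rw [h2], h1, ?_⟩
    rwa [Φ.iso_invariant _ _ (wordGraph_iso hl h1)]
  · rintro ⟨h1, h2, h3⟩
    refine ⟨h2, by omega, ?_⟩
    rwa [← Φ.iso_invariant _ _ (wordGraph_iso hl h2)]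

end Label

/-! ### Counting by digits -/

theorem sum_mul_pow_lt {q K : ℕ} {c : Fin q → ℕ} (h : ∀ i, c i < K) :
    ∑ i, c i * K ^ (i : ℕ) < K ^ q := by
  have := (finFunctionFinEquiv fun i => (⟨c i, h i⟩ : Fin K)).2
  rwa [finFunctionFinEquiv_apply] at this

theorem sum_mul_pow_injective {q K : ℕ} {c c' : Fin q → ℕ} (h : ∀ i, c i < K) (h' : ∀ i, c' i < K)
    (he : ∑ i, c i * K ^ (i : ℕ) = ∑ i, c' i * K ^ (i : ℕ)) : c = c' := by
  have := finFunctionFinEquiv.injective (a₁ := fun i => (⟨c i, h i⟩ : Fin K))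
    (a₂ := fun i => (⟨c' i, h' i⟩ : Fin K)) (by
      ext
      rw [finFunctionFinEquiv_apply, finFunctionFinEquiv_apply]
      exact he)
  funext i
  exact congrArg Fin.val (congrFun this i)

theorem sum_digit_mul_pow {q K j : ℕ} (hj : j < K ^ q) :
    ∑ i : Fin q, j / K ^ (i : ℕ) % K * K ^ (i : ℕ) = j := by
  have := congrArg Fin.val (finFunctionFinEquiv.apply_symm_apply (⟨j, hj⟩ : Fin (K ^ q)))
  rw [finFunctionFinEquiv_apply] at this
  exact this

theorem sum_mul_pow_div_mod {q K : ℕ} {c : Fin q → ℕ} (h : ∀ i, c i < K) (i : Fin q) :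
    (∑ i, c i * K ^ (i : ℕ)) / K ^ (i : ℕ) % K = c i := by
  have hK : 0 < K := (Nat.zero_le _).trans_lt (h i)
  have := sum_mul_pow_injective (fun i => Nat.mod_lt _ hK) h (sum_digit_mul_pow (sum_mul_pow_lt h))
  exact congrFun this i

/-- The digits of a sum of powers of a large base count the summands. -/
theorem sum_pow_div_mod {ι : Type*} [DecidableEq ι] (I : Finset ι) (pos : ι → ℕ) {B : ℕ}
    (hB : I.card < B) (p : ℕ) :
    (∑ a ∈ I, B ^ pos a) / B ^ p % B = (I.filter fun a => pos a = p).card := by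
  have hB0 : 0 < B := (Nat.zero_le _).trans_lt hB
  -- The sum is split by exponents above, equal to and below `p`. The case `p = 0` needs its own
  -- clause, since `p - 1` is then `0` by truncation and the bound on `r` would not show that the
  -- lower part is less than `B ^ p`.
  have key : ∃ q r, ∑ a ∈ I, B ^ pos a =
      B ^ (p + 1) * q + B ^ p * (I.filter fun a => pos a = p).card + r ∧
      r ≤ (I.filter fun a => pos a < p).card * B ^ (p - 1) ∧
      (p = 0 → r = 0) := by
    refine ⟨∑ a ∈ I.filter fun a => p < pos a, B ^ (pos a - (p + 1)),
      ∑ a ∈ I.filter fun a => pos a < p, B ^ pos a, ?_, ?_, ?_⟩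
    · rw [← Finset.sum_filter_add_sum_filter_not I (fun a => pos a < p) fun a => B ^ pos a,
        ← Finset.sum_filter_add_sum_filter_not (I.filter fun a => ¬ pos a < p) (fun a => pos a = p)
          fun a => B ^ pos a, Finset.filter_filter, Finset.filter_filter]
      have h1 : I.filter (fun a => ¬ pos a < p ∧ pos a = p) = I.filter fun a => pos a = p :=
        Finset.filter_congr fun a _ => by omega
      have h2 : I.filter (fun a => ¬ pos a < p ∧ ¬ pos a = p) = I.filter fun a => p < pos a :=
        Finset.filter_congr fun a _ => by omega
      have h3 : ∑ a ∈ I.filter (fun a => pos a = p), B ^ pos a =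
          B ^ p * (I.filter fun a => pos a = p).card := by
        rw [Finset.sum_congr rfl fun a ha => by rw [(Finset.mem_filter.1 ha).2], Finset.sum_const,
          smul_eq_mul, mul_comm]
      have h4 : ∑ a ∈ I.filter (fun a => p < pos a), B ^ pos a =
          B ^ (p + 1) * ∑ a ∈ I.filter fun a => p < pos a, B ^ (pos a - (p + 1)) := by
        rw [Finset.mul_sum]
        refine Finset.sum_congr rfl fun a ha => ?_
        rw [← pow_add]
        congr 1
        have := (Finset.mem_filter.1 ha).2
        omega
      rw [h1, h2, h3, h4]
      ring
    · rw [← smul_eq_mul]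
      refine Finset.sum_le_card_nsmul _ _ _ fun a ha => ?_
      have := (Finset.mem_filter.1 ha).2
      exact Nat.pow_le_pow_right hB0 (by omega)
    · rintro rfl
      simp
  obtain ⟨q, r, h1, h2, h4⟩ := key
  have hr : r < B ^ p := by
    rcases p with _ | p
    · simp [h4 rfl]
    · refine h2.trans_lt ?_
      rw [Nat.add_sub_cancel, pow_succ, mul_comm]
      exact Nat.mul_lt_mul_of_pos_left ((Finset.card_filter_le _ _).trans_lt hB) (pow_pos hB0 p)
  have hc : (I.filter fun a => pos a = p).card < B := (Finset.card_filter_le _ _).trans_lt hB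
  rw [h1, show B ^ (p + 1) * q + B ^ p * (I.filter fun a => pos a = p).card + r =
    r + B ^ p * (B * q + (I.filter fun a => pos a = p).card) by ring,
    Nat.add_mul_div_left _ _ (pow_pos hB0 p), Nat.div_eq_of_lt hr, zero_add, Nat.mul_add_mod,
    Nat.mod_eq_of_lt hc]

/-! ### Counting edge subsets as subgraphs -/

-- Edge sets and subgraphs on the same vertices correspond to each other. If `b` holds, the `k`-edge
-- subgraphs with the property are all `k`-edge subgraphs except those on which `Φ` differs from
-- `b`. In the application, `b` is the value on `k` disjoint edges.
open Classical in
theorem ncard_edgeSubs (Φ : GraphProperty) (k : ℕ) {n : ℕ} (G : SimpleGraph (Fin n)) (b : Prop) :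
    (edgeSubs Φ k G).ncard =
      if b then G.edgeSet.ncard.choose k -
        {H | H ≤ G ∧ H.edgeSet.ncard = k ∧ ¬(Φ.Holds (H.induce H.support) ↔ b)}.ncard
      else {H | H ≤ G ∧ H.edgeSet.ncard = k ∧ ¬(Φ.Holds (H.induce H.support) ↔ b)}.ncard := by
  have hinj : Function.Injective fun H : SimpleGraph (Fin n) => H.edgeSet :=
    SimpleGraph.edgeSet_injective
  have h1 : edgeSubs Φ k G = (fun H : SimpleGraph (Fin n) => H.edgeSet) ''
      {H | H ≤ G ∧ H.edgeSet.ncard = k ∧ Φ.Holds (H.induce H.support)} := by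
    ext A
    constructor
    · rintro ⟨h1, h2, h3⟩
      have hA : (SimpleGraph.fromEdgeSet A).edgeSet = A := by
        rw [SimpleGraph.edgeSet_fromEdgeSet, sdiff_eq_left, Set.disjoint_left]
        exact fun e he hd => G.not_isDiag_of_mem_edgeSet (h1 he) hd
      refine ⟨SimpleGraph.fromEdgeSet A, ⟨?_, by rwa [hA], h3⟩, hA⟩
      rw [← SimpleGraph.edgeSet_subset_edgeSet, hA]
      exact h1
    · rintro ⟨H, ⟨h1, h2, h3⟩, rfl⟩
      refine ⟨SimpleGraph.edgeSet_subset_edgeSet.2 h1, h2, ?_⟩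
      have key : ∀ K : SimpleGraph (Fin n), K = H → Φ.Holds (K.induce K.support) := by
        rintro _ rfl
        exact h3
      exact key _ (SimpleGraph.fromEdgeSet_edgeSet H)
  have h2 : {H | H ≤ G ∧ H.edgeSet.ncard = k}.ncard = G.edgeSet.ncard.choose k := by
    have h : (fun H : SimpleGraph (Fin n) => H.edgeSet) '' {H | H ≤ G ∧ H.edgeSet.ncard = k} =
        (fun A : Finset (Sym2 (Fin n)) => (A : Set (Sym2 (Fin n)))) ''
          (G.edgeSet.toFinite.toFinset.powersetCard k : Finset (Finset (Sym2 (Fin n)))) := by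
      ext A
      constructor
      · rintro ⟨H, ⟨h1, h2⟩, rfl⟩
        refine ⟨H.edgeSet.toFinite.toFinset, ?_, by simp⟩
        rw [Finset.mem_coe, Finset.mem_powersetCard, ← Set.ncard_eq_toFinset_card]
        exact ⟨by simpa using h1, h2⟩
      · rintro ⟨A, hA, rfl⟩
        rw [Finset.mem_coe, Finset.mem_powersetCard] at hA
        have hAG : (A : Set (Sym2 (Fin n))) ⊆ G.edgeSet := fun e he => by simpa using hA.1 he
        have hA' : (SimpleGraph.fromEdgeSet (A : Set (Sym2 (Fin n)))).edgeSet = A := by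
          rw [SimpleGraph.edgeSet_fromEdgeSet, sdiff_eq_left, Set.disjoint_left]
          exact fun e he hd => G.not_isDiag_of_mem_edgeSet (hAG he) hd
        refine ⟨SimpleGraph.fromEdgeSet A, ⟨?_, ?_⟩, hA'⟩
        · rw [← SimpleGraph.edgeSet_subset_edgeSet, hA']
          exact hAG
        · rw [hA', Set.ncard_coe_finset, hA.2]
    rw [← Set.ncard_image_of_injective _ hinj, h, Set.ncard_image_of_injective _
      Finset.coe_injective, Set.ncard_coe_finset, Finset.card_powersetCard,
      ← Set.ncard_eq_toFinset_card]
  rw [h1, Set.ncard_image_of_injective _ hinj]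
  split_ifs with hb
  · simp only [hb, iff_true]
    rw [← h2, ← Set.ncard_sdiff]
    · congr 1
      ext H
      simp only [Set.mem_ofPred_eq, Set.mem_sdiff]
      tauto
    · rintro H ⟨h1, h2, -⟩
      exact ⟨h1, h2⟩
  · simp only [hb, iff_false, not_not]

/-! ### Counting labellings with given multiplicities by digits of one large number -/

namespace Label

variable {T n : ℕ}

/-- The number of a label. -/
noncomputable def idx (a : Label T) : ℕ := (ofFin T).symm a

/-- The label counts encoded by the digits of a number. -/
noncomputable def digits (K j : ℕ) (a : Label T) : ℕ := j / K ^ idx a % K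

/-- The number with the given label counts as digits. -/
noncomputable def number (K : ℕ) (c : Label T → ℕ) : ℕ := ∑ a, c a * K ^ idx a

theorem number_eq (K : ℕ) (c : Label T → ℕ) :
    number K c = ∑ i, c (ofFin T i) * K ^ (i : ℕ) := by
  rw [number, ← (ofFin T).sum_comp]
  simp [idx]

theorem number_lt {K : ℕ} {c : Label T → ℕ} (h : ∀ a, c a < K) :
    number K c < K ^ Fintype.card (Label T) := by
  rw [number_eq]
  exact sum_mul_pow_lt fun _ => h _

theorem number_injective {K : ℕ} {c c' : Label T → ℕ} (h : ∀ a, c a < K) (h' : ∀ a, c' a < K)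
    (he : number K c = number K c') : c = c' := by
  rw [number_eq, number_eq] at he
  have := sum_mul_pow_injective (fun i => h (ofFin T i)) (fun i => h' (ofFin T i)) he
  funext a
  simpa using congrFun this ((ofFin T).symm a)

theorem digits_number {K : ℕ} {c : Label T → ℕ} (h : ∀ a, c a < K) : digits K (number K c) = c := by
  funext a
  rw [number_eq, digits, idx, sum_mul_pow_div_mod fun i => h (ofFin T i)]
  simp

theorem number_digits {K j : ℕ} (hj : j < K ^ Fintype.card (Label T)) :
    number K (digits K j : Label T → ℕ) = j := by
  rw [number_eq]
  simpa [digits, idx] using sum_digit_mul_pow hj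

theorem digits_le (K j : ℕ) (a : Label T) : digits K j a ≤ j :=
  (Nat.mod_le _ _).trans (Nat.div_le_self _ _)

open Classical in
/-- The contribution of a label to the position of the digit that counts a labelling. -/
noncomputable def pos (N : ℕ) (a : Label T) : ℕ := if a = isolated then 0 else N ^ idx a

/-- Multiplying powers of `B` adds their exponents, so the exponent of a labelling is its vector of
multiplicities written in base `N`. Vertices with the isolated label contribute exponent zero. -/
theorem sum_pos (N : ℕ) (l : Fin n → Label T) : ∑ v, pos N (l v) = number N (cnt l) := by
  classical
  rw [number, ← Finset.sum_fiberwise_of_maps_to (s := Finset.univ) (t := Finset.univ) (g := l)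
    (by simp)]
  refine Finset.sum_congr rfl fun a _ => ?_
  rw [Finset.sum_congr rfl fun v hv => by rw [(Finset.mem_filter.1 hv).2], Finset.sum_const,
    smul_eq_mul, pos, cnt]
  split_ifs <;> simp

open Classical in
/-- A number whose digits in base `B` count the pairs of an enumeration and a fitting labelling. -/
noncomputable def kron (N B : ℕ) (T : ℕ) (G : SimpleGraph (Fin n)) : ℕ :=
  ∑ u ∈ Fintype.piFinset fun _ : Fin T => Finset.range N, (if ValidTuple n u then 1 else 0) *
    ∏ v ∈ Finset.range N, if h : v < n then
      ∑ a : Label T, (if Fits G u ⟨v, h⟩ a then B ^ pos N a else 0) else 1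

open Classical in
/-- The pairs of an enumeration and a fitting labelling. -/
noncomputable def pairs (N T : ℕ) (G : SimpleGraph (Fin n)) :
    Finset ((Fin T → ℕ) × (Fin n → Label T)) :=
  ((Fintype.piFinset fun _ : Fin T => Finset.range N) ×ˢ Finset.univ).filter fun p =>
    ValidTuple n p.1 ∧ ∀ v, Fits G p.1 v (p.2 v)

theorem mem_pairs {N : ℕ} (hN : n < N) {G : SimpleGraph (Fin n)}
    {p : (Fin T → ℕ) × (Fin n → Label T)} :
    p ∈ pairs N T G ↔ ValidTuple n p.1 ∧ ∀ v, Fits G p.1 v (p.2 v) := by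
  simp only [pairs, Finset.mem_filter, Finset.mem_product, Fintype.mem_piFinset, Finset.mem_range,
    Finset.mem_univ, and_true, and_iff_right_iff_imp]
  exact fun h i => (h.1.1 i).trans_lt hN

/-- A base `B` beyond this bound exceeds every digit, so no carries occur. -/
theorem card_pairs_le (N T : ℕ) (G : SimpleGraph (Fin n)) :
    (pairs N T G).card ≤ N ^ T * Fintype.card (Label T) ^ n := by
  classical
  refine (Finset.card_filter_le _ _).trans ?_
  rw [Finset.card_product, Fintype.card_piFinset_const, Finset.card_range, Finset.card_univ,
    Fintype.card_fun]
  simp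

/-- Expanding the product over the vertices of sums over labels gives a sum over labellings, in
which exactly the fitting ones survive. -/
theorem kron_eq {N : ℕ} (hN : n < N) (B : ℕ) (G : SimpleGraph (Fin n)) :
    kron N B T G = ∑ p ∈ pairs N T G, B ^ number N (cnt p.2) := by
  classical
  rw [kron, pairs, Finset.sum_filter, Finset.sum_product]
  refine Finset.sum_congr rfl fun u _ => ?_
  have h1 : (∏ v ∈ Finset.range N, if h : v < n then
      ∑ a : Label T, (if Fits G u ⟨v, h⟩ a then B ^ pos N a else 0) else 1) =
      ∏ v : Fin n, ∑ a : Label T, (if Fits G u v a then B ^ pos N a else 0) := by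
    rw [← Finset.prod_subset (Finset.range_subset_range.2 hN.le), Finset.prod_range]
    · exact Finset.prod_congr rfl fun v _ => by rw [dif_pos v.2]
    · intro v _ hv
      rw [dif_neg (by simpa using hv)]
  rw [h1, Finset.prod_univ_sum, Fintype.piFinset_univ, Finset.mul_sum]
  refine Finset.sum_congr rfl fun l _ => ?_
  simp only [Finset.prod_ite_zero, Finset.mem_univ, forall_true_left, Finset.prod_pow_eq_pow_sum,
    sum_pos]
  by_cases h1 : ValidTuple n u <;> simp [h1]

/-- A label that occurs, other than the isolated one, has positive degree, so its multiplicity is at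
most its contribution to the degree sum `2 * k`. This bound, which does not involve `n`, is what
keeps the table a function of `k`. -/
theorem cnt_le {D k : ℕ} {Φ : GraphProperty} {G : SimpleGraph (Fin n)} {u : Fin T → ℕ}
    {l : Fin n → Label T} (hl : ∀ v, Fits G u v (l v)) (hg : Good Φ D k (cnt l)) (a : Label T) :
    cnt l a ≤ 2 * k := by
  by_cases ha : 0 < cnt l a
  · have h1 : 0 < deg (cnt l) a := by
      obtain ⟨h2, v, rfl⟩ := cnt_pos_iff.1 ha
      rw [← ndeg_graph, SimpleGraph.ndeg, Set.ncard_pos]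
      exact (mem_support_graph hl ((coreCond_iff D l).1 hg.2.1) v).2 h2
    rw [← hg.1]
    refine (Nat.le_mul_of_pos_right _ h1).trans ?_
    exact Finset.single_le_sum (f := fun a => cnt l a * deg (cnt l) a)
      (fun _ _ => Nat.zero_le _) (Finset.mem_univ a)
  · omega

/-- Read off the number of subgraphs from the digits of `kron`. -/
theorem sum_kron_digits (Φ : GraphProperty) {D k N B : ℕ} (hk : 0 < k) (hN : n < N)
    (G : SimpleGraph (Fin n))
    (hD : ∀ H : SimpleGraph (Fin n), H.edgeSet.ncard = k →
      ¬(Φ.Holds (H.induce H.support) ↔ Φ.Holds (SimpleGraph.edges k)) → (H.core D).ncard ≤ T)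
    (hB : N ^ T * Fintype.card (Label T) ^ n < B) (tb : ℕ → Prop)
    (htb : ∀ j, tb j ↔ j < (4 ^ k) ^ Fintype.card (Label T) ∧
      ¬(Φ.Holds (wordGraph (word (digits (4 ^ k) j : Label T → ℕ))) ↔
        Φ.Holds (SimpleGraph.edges k)))
    (htN : ∀ j, tb j → j < N) [DecidablePred tb]
    [∀ j, Decidable (CoreCond D (digits (4 ^ k) j : Label T → ℕ))] :
    (∑ j ∈ Finset.range N, if tb j ∧ (digits (4 ^ k) j : Label T → ℕ) isolated = 0 ∧
        ∑ a : Label T, digits (4 ^ k) j a * deg (digits (4 ^ k) j) a = 2 * k ∧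
        CoreCond D (digits (4 ^ k) j : Label T → ℕ) then
      kron N B T G / B ^ number N (digits (4 ^ k) j : Label T → ℕ) % B else 0) =
    {H | H ≤ G ∧ H.edgeSet.ncard = k ∧
      ¬(Φ.Holds (H.induce H.support) ↔ Φ.Holds (SimpleGraph.edges k))}.ncard := by
  classical
  have hbij := bijOn_describes (T := T) G D (fun H => H.edgeSet.ncard = k ∧
      ¬(Φ.Holds (H.induce H.support) ↔ Φ.Holds (SimpleGraph.edges k))) fun H h => hD H h.1 h.2
  rw [← hbij.image_eq, hbij.injOn.ncard_image]
  let S := (pairs N T G).filter fun p => Good Φ D k (cnt p.2)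
  have hS : {p : (Fin T → ℕ) × (Fin n → Label T) | Describes G D (fun H => H.edgeSet.ncard = k ∧
      ¬(Φ.Holds (H.induce H.support) ↔ Φ.Holds (SimpleGraph.edges k))) p} = S := by
    ext p
    rw [Set.mem_ofPred_eq, describes_iff, Finset.mem_coe, Finset.mem_filter, mem_pairs hN, and_assoc]
  -- Two bases are in use. Base `4 ^ k` indexes the table and is large enough for the multiplicities
  -- of exceptional subgraphs, as `2 * k < 4 ^ k`. Base `N` gives the positions in `kron`, where the
  -- multiplicities of arbitrary labellings have to be kept apart.
  have hlt : ∀ p ∈ S, ∀ a, cnt p.2 a < 4 ^ k := by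
    intro p hp a
    obtain ⟨h1, h2⟩ := Finset.mem_filter.1 hp
    refine (cnt_le ((mem_pairs hN).1 h1).2 h2 a).trans_lt ?_
    calc 2 * k < 2 * 2 ^ k := by have := Nat.lt_two_pow_self (n := k); omega
      _ ≤ 2 ^ k * 2 ^ k := Nat.mul_le_mul_right _ (Nat.le_self_pow hk.ne' 2)
      _ = 4 ^ k := by rw [← mul_pow]; norm_num
  have hcN : ∀ l : Fin n → Label T, ∀ a, cnt l a < N := by
    intro l a
    refine lt_of_le_of_lt ?_ hN
    unfold cnt
    split_ifs
    · omega
    · exact (Finset.card_le_univ _).trans (by simp)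
  have htS : ∀ p ∈ S, tb (number (4 ^ k) (cnt p.2)) := by
    intro p hp
    rw [htb, digits_number (hlt p hp)]
    exact ⟨number_lt (hlt p hp), (Finset.mem_filter.1 hp).2.2.2⟩
  have hmap : ∀ p ∈ S, number (4 ^ k) (cnt p.2) ∈ Finset.range N := fun p hp =>
    Finset.mem_range.2 (htN _ (htS p hp))
  -- The pairs are grouped by the table index of their multiplicities; each group has the size of
  -- one digit of `kron`, or is empty if the condition on `j` fails.
  rw [hS, Set.ncard_coe_finset, Finset.card_eq_sum_card_fiberwise hmap]
  refine Finset.sum_congr rfl fun j _ => ?_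
  split_ifs with hj
  · rw [kron_eq hN, sum_pow_div_mod _ _ ((card_pairs_le N T G).trans_lt hB)]
    congr 1
    obtain ⟨h1, h2, h3, h4⟩ := hj
    obtain ⟨h5, h6⟩ := (htb j).1 h1
    ext p
    rw [Finset.mem_filter, Finset.mem_filter, Finset.mem_filter, and_assoc]
    refine and_congr_right fun hp => ?_
    constructor
    · intro he
      -- A digit of `j` is at most `j`, and `j < N`, so the vector with table index `j` is also
      -- valid in base `N`.
      have := number_injective (hcN p.2) (fun a => (digits_le _ _ a).trans_lt (htN j h1)) he
      rw [this]
      exact ⟨⟨h3, h4, h6⟩, number_digits h5⟩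
    · rintro ⟨h7, h8⟩
      rw [← h8, digits_number (hlt p (Finset.mem_filter.2 ⟨hp, h7⟩))]
  · rw [eq_comm, Finset.card_eq_zero, Finset.filter_eq_empty_iff]
    rintro p hp rfl
    refine hj ⟨htS p hp, ?_⟩
    rw [digits_number (hlt p hp)]
    obtain ⟨h1, h2, h3⟩ := (Finset.mem_filter.1 hp).2
    exact ⟨by simp [cnt], h1, h2⟩

end Label

/-! ### The computable part of the data -/

/-- The encoding of the graph on the entries of a list with the given adjacency relation. -/
def encodeRel {β : Type} (r : β → β → Bool) (w : List β) : List Bool :=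
  w.map (fun _ => true) ++ false :: w.flatMap fun a => w.map fun b => r a b

/-- Only strings can be fed to the algorithm for `Φ`. A graph given by a decidable relation on the
entries of a list has an encoding that `primrec_encodeRel` shows to be computable. -/
theorem encodeGraph_eq {n : ℕ} (G : SimpleGraph (Fin n)) {β : Type} (r : β → β → Bool)
    (f : Fin n → β) (h : ∀ x y, G.Adj x y ↔ r (f x) (f y) = true) :
    encodeGraph G = encodeRel r ((List.finRange n).map f) := by
  classical
  have h1 : adjBits G = (List.finRange n).flatMap fun x => (List.finRange n).map fun y =>
      r (f x) (f y) := by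
    rw [adjBits, List.product, List.map_flatMap]
    congr 1
    funext x
    rw [List.map_map]
    congr 1
    funext y
    rw [Function.comp, Bool.eq_iff_iff, decide_eq_true_iff, h]
  rw [encodeGraph, encodeRel, h1]
  congr 1
  · simp [List.map_const']
  · rw [List.flatMap_map]
    simp only [List.map_map]
    rfl

theorem primrec_encodeRel {β : Type} [Primcodable β] {r : β → β → Bool} (hr : Primrec₂ r) :
    Primrec (encodeRel r) := by
  refine Primrec.list_append.comp (Primrec.list_map Primrec.id (Primrec.const true).to₂)
    (Primrec.list_cons.comp (Primrec.const false) ?_)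
  refine Primrec.list_flatMap Primrec.id ?_
  exact Primrec.list_map Primrec.fst (hr.comp₂ (Primrec.snd.comp Primrec.fst).to₂ Primrec.snd.to₂)

theorem primrec_pow : Primrec₂ ((· ^ ·) : ℕ → ℕ → ℕ) := Primrec₂.unpaired'.1 Nat.Primrec.pow

theorem exists_computable_edges : ∃ g : ℕ → List Bool, Computable g ∧
    ∀ k, encodeGraph (SimpleGraph.edges k) = g k := by
  refine ⟨fun k => encodeRel (fun i j : ℕ => decide (i ≠ j ∧ i / 2 = j / 2)) (List.range (2 * k)),
    ?_, fun k => ?_⟩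
  · have hr : Primrec₂ fun i j : ℕ => decide (i ≠ j ∧ i / 2 = j / 2) := by
      have h1 : PrimrecPred fun p : ℕ × ℕ => p.1 = p.2 :=
        Primrec.eq.comp Primrec.fst Primrec.snd
      have h2 : PrimrecPred fun p : ℕ × ℕ => p.1 / 2 = p.2 / 2 :=
        Primrec.eq.comp (Primrec.nat_div.comp Primrec.fst (Primrec.const 2))
          (Primrec.nat_div.comp Primrec.snd (Primrec.const 2))
      exact (h1.not.and h2).decide
    exact ((primrec_encodeRel hr).comp (Primrec.list_range.comp
      (Primrec.nat_mul.comp (Primrec.const 2) Primrec.id))).to_comp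
  · rw [encodeGraph_eq _ (fun i j : ℕ => decide (i ≠ j ∧ i / 2 = j / 2)) Fin.val
      (fun x y => by simp [SimpleGraph.edges])]
    congr 1
    exact List.map_coe_finRange_eq_range

-- The label relation is a relation on a finite type and hence primitive recursive; only the list of
-- labels varies with `k` and `j`.
open Label in
theorem exists_computable_wordGraph (T : ℕ) : ∃ g : ℕ × ℕ → List Bool, Computable g ∧
    ∀ k j, encodeGraph (wordGraph (word (digits (4 ^ k) j : Label T → ℕ))) = g (k, j) := by
  classical
  let q := Fintype.card (Label T)
  let r : Fin q → Fin q → Bool := fun a b => decide (Rel (ofFin T a) (ofFin T b))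
  refine ⟨fun p => encodeRel r ((List.finRange q).flatMap fun i : Fin q =>
    (List.range (p.2 / (4 ^ p.1) ^ (i : ℕ) % 4 ^ p.1)).map fun _ => i :
      List (Fin q)), ?_, fun k j => ?_⟩
  · have hr : Primrec₂ r := Primrec.dom_finite _
    refine ((primrec_encodeRel hr).comp (Primrec.list_flatMap (Primrec.const _) ?_)).to_comp
    refine Primrec.list_map (Primrec.list_range.comp ?_) (Primrec.snd.comp Primrec.fst).to₂
    have h4 : Primrec fun p : (ℕ × ℕ) × Fin q => 4 ^ p.1.1 :=
      primrec_pow.comp (Primrec.const 4) (Primrec.fst.comp Primrec.fst)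
    exact Primrec.nat_mod.comp (Primrec.nat_div.comp (Primrec.snd.comp Primrec.fst)
      (primrec_pow.comp h4 (Primrec.fin_val.comp Primrec.snd))) h4
  · rw [encodeGraph_eq _ r (fun x => (word (digits (4 ^ k) j : Label T → ℕ)).get x) (fun x y => by
      simp [r, wordGraph, graph])]
    congr 1
    rw [List.map_get_finRange, word]
    congr 1
    funext i
    simp [digits, idx, List.map_const']

/-- The number whose binary digits are the first `n` values of `b`. -/
def ofBits (b : ℕ → Bool) : ℕ → ℕ
  | 0 => 0
  | n + 1 => ofBits b n + (b n).toNat * 2 ^ n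

theorem ofBits_lt (b : ℕ → Bool) (n : ℕ) : ofBits b n < 2 ^ n := by
  induction n with
  | zero => simp [ofBits]
  | succ n ih =>
    rw [ofBits, pow_succ]
    have : (b n).toNat * 2 ^ n ≤ 1 * 2 ^ n := Nat.mul_le_mul_right _ (Bool.toNat_le _)
    omega

theorem ofBits_div_mod (b : ℕ → Bool) (n j : ℕ) :
    ofBits b n / 2 ^ j % 2 = 1 ↔ j < n ∧ b j = true := by
  induction n with
  | zero => simp [ofBits]
  | succ n ih =>
    rcases lt_trichotomy j n with h | rfl | h
    · obtain ⟨d, rfl⟩ := Nat.exists_eq_add_of_lt h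
      rw [ofBits, show (b (j + d + 1)).toNat * 2 ^ (j + d + 1) =
        2 ^ j * (2 * ((b (j + d + 1)).toNat * 2 ^ d)) by ring,
        Nat.add_mul_div_left _ _ (by positivity), Nat.add_mul_mod_self_left, ih]
      simp only [h, true_and, show j < j + d + 1 + 1 by omega]
    · rw [ofBits, mul_comm, Nat.add_mul_div_left _ _ (by positivity),
        Nat.div_eq_of_lt (ofBits_lt b j)]
      cases b j <;> simp
    · rw [Nat.div_eq_of_lt ((ofBits_lt b (n + 1)).trans_le (Nat.pow_le_pow_right (by omega) h))]
      simp only [Nat.zero_mod, zero_ne_one, false_iff]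
      omega

/-- If bit `j` is set, the number is at least `2 ^ j`, which exceeds `j`. So a loop bound larger
than the table reaches all indices whose bit is set. -/
theorem lt_of_ofBits {b : ℕ → Bool} {n j : ℕ} (h : ofBits b n / 2 ^ j % 2 = 1) :
    j < ofBits b n := by
  by_contra! h'
  rw [Nat.div_eq_of_lt (h'.trans_lt Nat.lt_two_pow_self)] at h
  omega

open Label in
/-- The value of `Φ` on the finitely many graphs that are relevant for `k` is computable. -/
theorem exists_table (Φ : GraphProperty) (hΦ : Φ.IsComputable) (T : ℕ) :
    ∃ tab flag : ℕ → ℕ, Computable tab ∧ Computable flag ∧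
      (∀ k, flag k = 1 ∧ Φ.Holds (SimpleGraph.edges k) ∨
        flag k = 0 ∧ ¬ Φ.Holds (SimpleGraph.edges k)) ∧
      (∀ k j, tab k / 2 ^ j % 2 = 1 ↔ j < (4 ^ k) ^ Fintype.card (Label T) ∧
        ¬(Φ.Holds (wordGraph (word (digits (4 ^ k) j : Label T → ℕ))) ↔
          Φ.Holds (SimpleGraph.edges k))) ∧
      ∀ k j, tab k / 2 ^ j % 2 = 1 → j < tab k := by
  obtain ⟨f, hf, hfe⟩ := ComputablePred.computable_iff.1 hΦ
  have hfG : ∀ {n : ℕ} (G : SimpleGraph (Fin n)), f (encodeGraph G) = true ↔ Φ.Holds G := by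
    intro n G
    have : (∃ (n' : ℕ) (G' : SimpleGraph (Fin n')), encodeGraph G' = encodeGraph G ∧ Φ.Holds G') ↔
        f (encodeGraph G) = true := iff_of_eq (congrFun hfe (encodeGraph G))
    rw [← this]
    constructor
    · rintro ⟨n', G', h1, h2⟩
      obtain ⟨rfl, h3⟩ := replicate_true_append_inj h1
      rwa [← adjBits_injective h3]
    · exact fun h => ⟨n, G, rfl, h⟩
  obtain ⟨g₁, hg₁, he₁⟩ := exists_computable_edges
  obtain ⟨g₂, hg₂, he₂⟩ := exists_computable_wordGraph T
  -- Bit `j` says whether the graph with index `j` is exceptional.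
  let b : ℕ → ℕ → Bool := fun k j => xor (f (g₂ (k, j))) (f (g₁ k))
  have hb : Computable₂ b := by
    have hx : Primrec₂ xor := Primrec.dom_finite _
    exact hx.to_comp.comp (hf.comp hg₂) (hf.comp (hg₁.comp Computable.fst))
  have hbool : Computable Bool.toNat := (Primrec.dom_finite _).to_comp
  refine ⟨fun k => ofBits (b k) ((4 ^ k) ^ Fintype.card (Label T)), fun k => (f (g₁ k)).toNat,
    ?_, hbool.comp (hf.comp hg₁), fun k => ?_, fun k j => ?_, fun k j h => lt_of_ofBits h⟩
  · have h1 : Primrec fun k : ℕ => (4 ^ k) ^ Fintype.card (Label T) :=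
      primrec_pow.comp (primrec_pow.comp (Primrec.const 4) Primrec.id) (Primrec.const _)
    have h2 : Computable₂ fun (k : ℕ) (p : ℕ × ℕ) => p.2 + (b k p.1).toNat * 2 ^ p.1 := by
      have e1 : Computable fun a : ℕ × (ℕ × ℕ) => a.2.1 := Computable.fst.comp Computable.snd
      have e2 : Computable fun a : ℕ × (ℕ × ℕ) => (b a.1 a.2.1).toNat :=
        hbool.comp (hb.comp Computable.fst e1)
      exact Primrec.nat_add.to_comp.comp (Computable.snd.comp Computable.snd)
        (Primrec.nat_mul.to_comp.comp e2 (primrec_pow.to_comp.comp (Computable.const 2) e1))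
    refine (Computable.nat_rec h1.to_comp (Computable.const 0) h2).of_eq fun k => ?_
    induction (4 ^ k) ^ Fintype.card (Label T) with
    | zero => rfl
    | succ i ih => exact congrArg (· + (b k i).toNat * 2 ^ i) ih
  · simp only
    rw [← hfG, he₁]
    cases f (g₁ k) <;> simp
  · rw [ofBits_div_mod]
    refine and_congr_right fun _ => ?_
    rw [← hfG, ← hfG, he₁, he₂]
    simp only [b]
    cases f (g₁ k) <;> cases f (g₂ (k, j)) <;> simp

namespace Prog

/-! ### Closure properties of arithmetic functions -/

namespace Arith

variable {F G : ℕ → (ℕ → ℕ) → ℕ}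

theorem of_eq (hF : Arith F) (h : ∀ N e, G N e = F N e) : Arith G := by
  rwa [show G = F from funext fun N => funext fun e => h N e]

theorem bound : Arith fun N _ => N := ((const 1).sum 0).of_eq fun N _ => by simp

theorem pow_const (hF : Arith F) (c : ℕ) : Arith fun N e => F N e ^ c := by
  induction c with
  | zero => exact (const 1).of_eq fun _ _ => by simp
  | succ c ih => exact (ih.mul hF).of_eq fun _ _ => pow_succ _ _

/-- Each further product over `j < N` multiplies the exponent by `N`. The degree `i` must be a
constant; in the applications it depends on `T` only. -/
theorem two_pow_bound (c i : ℕ) : Arith fun N _ => 2 ^ (c * N ^ i) := by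
  induction i with
  | zero => exact (const (2 ^ c)).of_eq fun _ _ => by simp
  | succ i ih =>
    refine (ih.prod 0).of_eq fun N _ => ?_
    rw [Finset.prod_const, Finset.card_range, ← pow_mul, pow_succ, mul_assoc]

theorem finsetSum {ι : Type*} (s : Finset ι) {F : ι → ℕ → (ℕ → ℕ) → ℕ} (hF : ∀ i, Arith (F i)) :
    Arith fun N e => ∑ i ∈ s, F i N e := by
  classical
  induction s using Finset.induction_on with
  | empty => exact (const 0).of_eq fun _ _ => by simp
  | insert i s hi ih => exact ((hF i).add ih).of_eq fun _ _ => Finset.sum_insert hi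

theorem mod (hF : Arith F) (hG : Arith G) (h2 : Arith fun N e => 2 ^ G N e) :
    Arith fun N e => F N e % 2 ^ G N e := by
  refine (hF.sub ((hF.shr hG).mul h2)).of_eq fun N e => ?_
  rw [Nat.mod_eq_sub_div_mul]

end Arith

open Classical in
/-- A predicate whose indicator function is arithmetic. -/
def ArithPred (p : ℕ → (ℕ → ℕ) → Prop) : Prop := Arith fun N e => if p N e then 1 else 0

namespace ArithPred

variable {F G : ℕ → (ℕ → ℕ) → ℕ} {p q : ℕ → (ℕ → ℕ) → Prop}

theorem of_iff (hp : ArithPred p) (h : ∀ N e, q N e ↔ p N e) : ArithPred q := by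
  rwa [show q = p from funext fun N => funext fun e => propext (h N e)]

theorem const (P : Prop) : ArithPred fun _ _ => P := by
  classical exact Arith.const (if P then 1 else 0)

theorem lt (hF : Arith F) (hG : Arith G) : ArithPred fun N e => F N e < G N e := by
  -- With truncated subtraction, `1 - (1 - x)` is the indicator of `x > 0`, here for `x = G - F`.
  refine ((Arith.const 1).sub ((Arith.const 1).sub (hG.sub hF))).of_eq fun N e => ?_
  split_ifs <;> omega

theorem not (hp : ArithPred p) : ArithPred fun N e => ¬ p N e := by
  refine ((Arith.const 1).sub hp).of_eq fun N e => ?_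
  by_cases h : p N e <;> simp [h]

theorem and (hp : ArithPred p) (hq : ArithPred q) : ArithPred fun N e => p N e ∧ q N e := by
  refine (Arith.mul hp hq).of_eq fun N e => ?_
  by_cases h : p N e <;> by_cases h' : q N e <;> simp [h, h']

theorem or (hp : ArithPred p) (hq : ArithPred q) : ArithPred fun N e => p N e ∨ q N e :=
  (hp.not.and hq.not).not.of_iff fun N e => by tauto

theorem imp (hp : ArithPred p) (hq : ArithPred q) : ArithPred fun N e => p N e → q N e :=
  (hp.not.or hq).of_iff fun N e => by tauto

theorem iff (hp : ArithPred p) (hq : ArithPred q) : ArithPred fun N e => (p N e ↔ q N e) :=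
  ((hp.imp hq).and (hq.imp hp)).of_iff fun N e => by tauto

theorem le (hF : Arith F) (hG : Arith G) : ArithPred fun N e => F N e ≤ G N e :=
  (lt hG hF).not.of_iff fun N e => by omega

theorem eq (hF : Arith F) (hG : Arith G) : ArithPred fun N e => F N e = G N e :=
  ((le hF hG).and (le hG hF)).of_iff fun N e => by omega

theorem forall_fintype {ι : Type*} [Fintype ι] {p : ι → ℕ → (ℕ → ℕ) → Prop}
    (hp : ∀ i, ArithPred (p i)) : ArithPred fun N e => ∀ i, p i N e := by
  classical
  have h : ∀ s : Finset ι, ArithPred fun N e => ∀ i ∈ s, p i N e := by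
    intro s
    induction s using Finset.induction_on with
    | empty => exact (const True).of_iff fun _ _ => by simp
    | insert i s hi ih => exact ((hp i).and ih).of_iff fun _ _ => by simp
  exact (h Finset.univ).of_iff fun _ _ => by simp

theorem exists_fintype {ι : Type*} [Fintype ι] {p : ι → ℕ → (ℕ → ℕ) → Prop}
    (hp : ∀ i, ArithPred (p i)) : ArithPred fun N e => ∃ i, p i N e :=
  (forall_fintype fun i => (hp i).not).not.of_iff fun _ _ => by simp

end ArithPred

namespace Arith

variable {F G : ℕ → (ℕ → ℕ) → ℕ} {p : ℕ → (ℕ → ℕ) → Prop}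

open Classical in
theorem ite (hp : ArithPred p) (hF : Arith F) (hG : Arith G) :
    Arith fun N e => if p N e then F N e else G N e := by
  refine ((mul hp hF).add (((const 1).sub hp).mul hG)).of_eq fun N e => ?_
  by_cases h : p N e <;> simp [h]

/-- The power is a product over `j < N` in which exactly the factors with `j < F` are two. This
needs `F ≤ N`, and a loop variable on which `F` does not depend. -/
theorem two_pow (hF : Arith F) (i : ℕ) (hi : ∀ N e j, F N (Function.update e i j) = F N e)
    (hle : ∀ N e, F N e ≤ N) : Arith fun N e => 2 ^ F N e := by
  classical
  refine ((ite (ArithPred.lt (var i) hF) (const 2) (const 1)).prod i).of_eq fun N e => ?_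
  simp only [hi, Function.update_self]
  rw [← Finset.prod_filter, Finset.prod_const]
  congr 1
  have : (Finset.range N).filter (fun j => j < F N e) = Finset.range (F N e) := by
    ext j
    have := hle N e
    simp only [Finset.mem_filter, Finset.mem_range]
    omega
  rw [this, Finset.card_range]

/-- Sums over tuples, where the entries of the tuple are the variables from `b` on. -/
theorem sum_tuple (b T : ℕ) {H : ℕ → (ℕ → ℕ) → (Fin T → ℕ) → ℕ}
    (h : Arith fun N e => H N e fun i => e (b + i))
    (hH : ∀ N e i x u, b ≤ i → H N (Function.update e i x) u = H N e u) :
    Arith fun N e => ∑ u ∈ Fintype.piFinset fun _ : Fin T => Finset.range N, H N e u := by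
  induction T with
  | zero =>
    refine h.of_eq fun N e => ?_
    rw [Fintype.piFinset_of_isEmpty, Finset.univ_unique, Finset.sum_singleton]
    congr 1
    exact Subsingleton.elim _ _
  | succ T ih =>
    -- The last entry is summed first, as the variable `b + T`. By `hH` the summand depends on the
    -- tuple variables only through the tuple, so overwriting this variable has no side effect.
    have h1 : Arith fun N e =>
        ∑ x ∈ Finset.range N, H N e (Fin.snoc (fun i : Fin T => e (b + i)) x) := by
      refine (h.sum (b + T)).of_eq fun N e => Finset.sum_congr rfl fun x _ => ?_
      rw [hH _ _ _ _ _ (by omega)]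
      congr 1
      funext i
      refine Fin.lastCases ?_ (fun i => ?_) i
      · simp
      · have : b + (i : ℕ) ≠ b + T := by omega
        simp [Function.update_of_ne this]
    have h2 := ih (H := fun N e u => ∑ x ∈ Finset.range N, H N e (Fin.snoc u x)) h1
      fun N e i x u hi => by simp only [hH _ _ _ _ _ hi]
    refine h2.of_eq fun N e => ?_
    rw [← Finset.sum_product (f := fun p : (Fin T → ℕ) × ℕ =>
      H N e (Fin.snoc (α := fun _ => ℕ) p.1 p.2))]
    symm
    refine Finset.sum_nbij' (fun p => Fin.snoc (α := fun _ => ℕ) p.1 p.2)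
      (fun u => (fun i => u i.castSucc, u (Fin.last T))) ?_ ?_ ?_ ?_ ?_
    · rintro ⟨u, x⟩ hp
      simp only [Finset.mem_product, Fintype.mem_piFinset] at hp
      rw [Fintype.mem_piFinset]
      intro i
      refine Fin.lastCases ?_ (fun i => ?_) i
      · simpa using hp.2
      · simpa using hp.1 i
    · intro u hu
      rw [Fintype.mem_piFinset] at hu
      rw [Finset.mem_product, Fintype.mem_piFinset]
      exact ⟨fun i => hu _, hu _⟩
    · rintro ⟨u, x⟩ -
      simp
    · intro u _
      funext i
      refine Fin.lastCases ?_ (fun i => ?_) i <;> simp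
    · intro _ _
      rfl

end Arith

/-! ### Reading parameters and adjacencies off binary digits -/

/-- The number of ones among the last `N` binary digits. -/
def ones (N y : ℕ) : ℕ := ∑ i ∈ Finset.range N, y / 2 ^ i % 2

theorem ones_le (N y : ℕ) : ones N y ≤ N := by
  have : ones N y ≤ (Finset.range N).card • 1 :=
    Finset.sum_le_card_nsmul _ _ _ fun i _ => by omega
  simpa using this

theorem ones_two_pow_sub_one {N k : ℕ} (h : k ≤ N) : ones N (2 ^ k - 1) = k := by
  have h1 : ∀ i, (2 ^ k - 1) / 2 ^ i % 2 = if i < k then 1 else 0 := by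
    intro i
    have := Nat.testBit_two_pow_sub_one k i
    rw [Nat.testBit_eq_decide_div_mod_eq, decide_eq_decide] at this
    split_ifs with h <;> omega
  have h2 : (Finset.range N).filter (fun j => j < k) = Finset.range k := by
    ext j
    simp only [Finset.mem_filter, Finset.mem_range]
    omega
  rw [ones, Finset.sum_congr rfl fun i _ => h1 i, ← Finset.sum_filter, h2]
  simp

theorem Arith.mod_two {F : ℕ → (ℕ → ℕ) → ℕ} (hF : Arith F) : Arith fun N e => F N e % 2 :=
  (hF.mod (.const 1) (.const (2 ^ 1))).of_eq fun _ _ => by simp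

/-- Variable `4` is the summation variable here, so it cannot hold the argument. -/
theorem Arith.ones (i : ℕ) (hi : i ≠ 4) : Arith fun N e => ones N (e i) :=
  ((((Arith.var i).shr (.var 4)).mod_two).sum 4).of_eq fun N e => by simp [Prog.ones, hi]

theorem Arith.two_pow_ones (i : ℕ) (hi : i ≠ 4) : Arith fun N e => 2 ^ Prog.ones N (e i) :=
  (Arith.ones i hi).two_pow 4 (fun N e j => by simp [hi]) fun _ _ => ones_le _ _

theorem val_div_mod_two (l : List Bool) (i : ℕ) :
    val l / 2 ^ i % 2 = 1 ↔ getElem? l i = some true := by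
  induction l generalizing i with
  | nil => simp [val]
  | cons b l ih =>
    cases i with
    | zero => cases b <;> simp [val]
    | succ i =>
      rw [List.getElem?_cons_succ, ← ih, val, pow_succ', ← Nat.div_div_eq_div_mul]
      have : (b.toNat + 2 * val l) / 2 = val l := by cases b <;> simp; omega
      rw [this]

theorem getElem?_flatMap_of_length {α β : Type} {n : ℕ} {f : α → List β} (L : List α)
    (hf : ∀ a ∈ L, (f a).length = n) (v w : ℕ) (hw : w < n) :
    getElem? (L.flatMap f) (v * n + w) = (getElem? L v).bind fun a => getElem? (f a) w := by
  induction L generalizing v with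
  | nil => simp
  | cons a L ih =>
    have ha : (f a).length = n := hf a (by simp)
    rw [List.flatMap_cons]
    cases v with
    | zero => simp [List.getElem?_append_left, ha, hw]
    | succ v =>
      rw [List.getElem?_append_right (by rw [ha, add_mul]; omega), List.getElem?_cons_succ,
        ← ih fun a ha => hf a (by simp [ha])]
      congr 1
      rw [ha, add_mul]; omega

theorem val_adjBits {n : ℕ} (G : SimpleGraph (Fin n)) (v w : Fin n) :
    val (adjBits G) / 2 ^ ((v : ℕ) * n + w) % 2 = 1 ↔ G.Adj v w := by
  classical
  rw [val_div_mod_two, adjBits, List.product, List.map_flatMap,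
    getElem?_flatMap_of_length _ (by simp) _ _ w.2]
  simp

end Prog

/-! ### The count of exceptional subgraphs as an arithmetic function -/

namespace Label

variable {T : ℕ}

/-- `Label.Fits` for a graph with `n` vertices whose adjacency matrix is given by the binary digits
of `X`. -/
def FitsNat (n X : ℕ) (u : Fin T → ℕ) (v : ℕ) (a : Label T) : Prop :=
  (∀ j, a.1 = some j ↔ u j = v) ∧
    ∀ i, i ∈ a.2 → (u i < n ∧ X / 2 ^ (v * n + u i) % 2 = 1) ∧ ∀ j, a.1 = some j → i < j

theorem fitsNat_iff {n : ℕ} (G : SimpleGraph (Fin n)) (u : Fin T → ℕ) (v : Fin n) (a : Label T) :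
    FitsNat n (Prog.val (adjBits G)) u v a ↔ Fits G u v a := by
  refine and_congr_right fun _ => forall_congr' fun i => forall_congr' fun _ =>
    and_congr_left fun _ => ?_
  constructor
  · rintro ⟨h, h'⟩
    exact ⟨h, (Prog.val_adjBits G v ⟨u i, h⟩).1 h'⟩
  · rintro ⟨h, h'⟩
    exact ⟨h, (Prog.val_adjBits G v ⟨u i, h⟩).2 h'⟩

open Classical in
/-- `Label.kron` for a graph with `n` vertices whose adjacency matrix is given by the binary digits
of `X`. -/
noncomputable def kronNat (T N B n X : ℕ) : ℕ :=
  ∑ u ∈ Fintype.piFinset fun _ : Fin T => Finset.range N, (if ValidTuple n u then 1 else 0) *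
    ∏ v ∈ Finset.range N, if v < n then
      ∑ a : Label T, (if FitsNat n X u v a then B ^ pos N a else 0) else 1

theorem kronNat_eq (T N B : ℕ) {n : ℕ} (G : SimpleGraph (Fin n)) :
    kronNat T N B n (Prog.val (adjBits G)) = kron N B T G := by
  refine Finset.sum_congr rfl fun u _ => congrArg _ (Finset.prod_congr rfl fun v _ => ?_)
  by_cases h : v < n
  · rw [if_pos h, dif_pos h]
    refine Finset.sum_congr rfl fun a _ => ?_
    rw [← fitsNat_iff G u ⟨v, h⟩ a]
  · rw [if_neg h, dif_neg h]

open Classical in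
/-- The count of `Label.sum_kron_digits`, where the binary digits of `t` select the graphs. -/
noncomputable def cntNat (T D N B k n t X : ℕ) : ℕ :=
  ∑ j ∈ Finset.range N, if t / 2 ^ j % 2 = 1 ∧ (digits (4 ^ k) j : Label T → ℕ) isolated = 0 ∧
      ∑ a : Label T, digits (4 ^ k) j a * deg (digits (4 ^ k) j) a = 2 * k ∧
      CoreCond D (digits (4 ^ k) j : Label T → ℕ) then
    kronNat T N B n X / B ^ number N (digits (4 ^ k) j : Label T → ℕ) % B else 0

end Label

namespace Prog

open Label

theorem arithPred_fitsNat {T : ℕ} {n X v : ℕ → (ℕ → ℕ) → ℕ} {u : Fin T → ℕ → (ℕ → ℕ) → ℕ}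
    (hn : Arith n) (hX : Arith X) (hu : ∀ i, Arith (u i)) (hv : Arith v) (a : Label T) :
    ArithPred fun N e => FitsNat (n N e) (X N e) (fun i => u i N e) (v N e) a := by
  refine (ArithPred.forall_fintype fun j => (ArithPred.const (a.1 = some j)).iff
    (.eq (hu j) hv)).and (ArithPred.forall_fintype fun i => (ArithPred.const (i ∈ a.2)).imp
      (((ArithPred.lt (hu i) hn).and ?_).and (ArithPred.const (∀ j, a.1 = some j → i < j))))
  exact .eq (hX.shr ((hv.mul hn).add (hu i))).mod_two (.const 1)

theorem arithPred_validTuple {T : ℕ} {n : ℕ → (ℕ → ℕ) → ℕ} {u : Fin T → ℕ → (ℕ → ℕ) → ℕ}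
    (hn : Arith n) (hu : ∀ i, Arith (u i)) :
    ArithPred fun N e => ValidTuple (n N e) fun i => u i N e := by
  refine (ArithPred.forall_fintype fun i => .le (hu i) hn).and
    (ArithPred.forall_fintype fun i => ArithPred.forall_fintype fun j =>
      (ArithPred.const (i < j)).imp ((ArithPred.lt (hu i) (hu j)).or
        ((ArithPred.eq (hu i) hn).and (ArithPred.eq (hu j) hn))))

/-- Variable `0` holds the adjacency matrix, `2` the number of vertices in unary, `4` the current
vertex, and the variables from `6` on the enumeration of the core. -/
theorem arith_kronNat (T c : ℕ) :
    Arith fun N e => kronNat T N (2 ^ (c * N)) (ones N (e 2)) (e 0) := by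
  classical
  have hn : Arith fun N e => ones N (e 2) := .ones 2 (by norm_num)
  have hu : ∀ i : Fin T, Arith fun _ e => e (6 + i) := fun i => .var _
  -- The exponent is `c * N ^ (idx a + 1)`. Its degree is bounded because there are only finitely
  -- many labels for fixed `T`; this is where the bounded core size makes the evaluation polynomial.
  have hpos : ∀ a : Label T, Arith fun N _ => (2 ^ (c * N)) ^ pos N a := by
    intro a
    by_cases ha : a = isolated
    · exact (Arith.const 1).of_eq fun N _ => by simp [pos, ha]
    · refine (Arith.two_pow_bound c (idx a + 1)).of_eq fun N _ => ?_
      rw [pos, if_neg ha, ← pow_mul, pow_succ', mul_assoc]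
  have hinner : Arith fun N e => if e 4 < ones N (e 2) then
      ∑ a : Label T, (if FitsNat (ones N (e 2)) (e 0) (fun i : Fin T => e (6 + i)) (e 4) a then
        (2 ^ (c * N)) ^ pos N a else 0) else 1 := by
    refine (Arith.ite (.lt (.var 4) hn) (Arith.finsetSum Finset.univ fun a =>
      Arith.ite (arithPred_fitsNat hn (.var 0) hu (.var 4) a) (hpos a) (.const 0))
      (.const 1)).of_eq fun N e => ?_
    split_ifs <;> rfl
  have hprod := (hinner.prod 4)
  have hvalid := arithPred_validTuple (T := T) hn hu
  refine Arith.sum_tuple 6 T (H := fun N e u =>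
    (if ValidTuple (ones N (e 2)) u then 1 else 0) *
      ∏ v ∈ Finset.range N, if v < ones N (e 2) then
        ∑ a : Label T, (if FitsNat (ones N (e 2)) (e 0) u v a then
          (2 ^ (c * N)) ^ pos N a else 0) else 1) ?_ ?_
  · refine (Arith.mul hvalid hprod).of_eq fun N e => ?_
    congr 1
    refine Finset.prod_congr rfl fun v _ => ?_
    have h6 : ∀ i : Fin T, 6 + (i : ℕ) ≠ 4 := fun i => by omega
    simp [Function.update_of_ne (h6 _)]
  · intro N e i x u hi
    rw [Function.update_of_ne (by omega), Function.update_of_ne (by omega)]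

/-- Writing the base as `2 ^ (2 * k)` turns the extraction of a digit into a shift and a remainder
modulo a power of two. Variable `5` is the table index. -/
theorem arith_digits {T : ℕ} (a : Label T) :
    Arith fun N e => digits (4 ^ ones N (e 1)) (e 5) a := by
  have h2 : Arith fun N e => 2 ^ (2 * ones N (e 1)) :=
    ((Arith.two_pow_ones 1 (by norm_num)).pow_const 2).of_eq fun N e => by rw [← pow_mul, mul_comm]
  have hk : Arith fun N e => ones N (e 1) := .ones 1 (by norm_num)
  have h3 : Arith fun N e => 2 * ones N (e 1) := (Arith.const 2).mul hk
  refine (Arith.mod (((Arith.var 5)).shr (h3.mul (.const (idx a)))) h3 h2).of_eq fun N e => ?_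
  rw [digits, show 4 ^ ones N (e 1) = 2 ^ (2 * ones N (e 1)) by rw [pow_mul]; norm_num, ← pow_mul]

theorem arith_cntNat (T D c : ℕ) :
    Arith fun N e => cntNat T D N (2 ^ (c * N)) (ones N (e 1)) (ones N (e 2)) (ones N (e 3) / 2)
      (e 0) := by
  classical
  have hk : Arith fun N e => ones N (e 1) := .ones 1 (by norm_num)
  have hm : Arith fun N e => ones N (e 3) := .ones 3 (by norm_num)
  have hdeg : ∀ a : Label T, Arith fun N e =>
      deg (fun a : Label T => digits (4 ^ ones N (e 1)) (e 5) a) a := fun a =>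
    Arith.finsetSum Finset.univ fun b =>
      Arith.ite (ArithPred.const (Rel a b)) (arith_digits b) (.const 0)
  have hcore : ArithPred fun N e =>
      CoreCond D (fun a : Label T => digits (4 ^ ones N (e 1)) (e 5) a) :=
    ArithPred.forall_fintype fun a => (ArithPred.lt (.const 0) (arith_digits a)).imp
      (((ArithPred.lt (.const D) (hdeg a)).or ((ArithPred.le (hdeg a) (.const D)).and
        (ArithPred.exists_fintype fun b => (ArithPred.const (Rel a b)).and
          ((ArithPred.lt (.const 0) (arith_digits b)).and
            (ArithPred.le (hdeg b) (.const D)))))).iff (ArithPred.const (a.1.isSome = true)))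
  have hnum : Arith fun N e =>
      number N (fun a : Label T => digits (4 ^ ones N (e 1)) (e 5) a) :=
    Arith.finsetSum Finset.univ fun a => (arith_digits a).mul (Arith.bound.pow_const (idx a))
  have hcN : Arith fun N _ => c * N := (Arith.const c).mul .bound
  have h2 : Arith fun N _ => 2 ^ (c * N) := (Arith.two_pow_bound c 1).of_eq fun N _ => by simp
  have hcond := (ArithPred.eq ((hm.shr (.const 1)).shr (.var 5)).mod_two (.const 1)).and
    ((ArithPred.eq (arith_digits (isolated : Label T)) (.const 0)).and
      ((ArithPred.eq (Arith.finsetSum Finset.univ fun a => (arith_digits a).mul (hdeg a))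
        ((Arith.const 2).mul hk)).and hcore))
  have hbody := Arith.ite hcond (((arith_kronNat T c).shr (hcN.mul hnum)).mod hcN h2) (.const 0)
  refine (hbody.sum 5).of_eq fun N e => Finset.sum_congr rfl fun j _ => ?_
  simp only [Function.update_self, pow_one, pow_mul, ne_eq, Nat.reduceEqDiff,
    OfNat.zero_ne_ofNat, OfNat.one_ne_ofNat, not_false_eq_true, Function.update_of_ne]

end Prog

/-! ### The binomial coefficient as an arithmetic function -/

open Classical in
/-- The number of `k`-element sets of edges of the graph with `n` vertices whose adjacency matrix
is given by the binary digits of `X`. -/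
noncomputable def chooseNat (N k n X : ℕ) : ℕ :=
  (∏ v ∈ Finset.range N, ∏ w ∈ Finset.range N,
    if v < w ∧ w < n ∧ X / 2 ^ (v * n + w) % 2 = 1 then 1 + 2 ^ N ^ 2 else 1) /
      (2 ^ N ^ 2) ^ k % 2 ^ N ^ 2

/-- By the binomial theorem the base `B` digits of the power are binomial coefficients. They are at
most `2 ^ E`, so there are no carries. -/
theorem one_add_pow_div_mod {E B : ℕ} (hB : 2 ^ E < B) (k : ℕ) :
    (1 + B) ^ E / B ^ k % B = E.choose k := by
  have h := sum_pow_div_mod (Finset.range E).powerset Finset.card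
    (by rwa [Finset.card_powerset, Finset.card_range]) k
  rw [← Finset.powersetCard_eq_filter, Finset.card_powersetCard, Finset.card_range] at h
  rw [← h, ← Finset.card_range E, ← Finset.prod_const, Finset.prod_one_add]
  simp

theorem chooseNat_eq {N n : ℕ} (hN : n < N) (k : ℕ) (G : SimpleGraph (Fin n)) :
    chooseNat N k n (Prog.val (adjBits G)) = G.edgeSet.ncard.choose k := by
  classical
  set X := Prog.val (adjBits G)
  let S := (Finset.range N ×ˢ Finset.range N).filter fun p : ℕ × ℕ =>
    p.1 < p.2 ∧ p.2 < n ∧ X / 2 ^ (p.1 * n + p.2) % 2 = 1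
  have hS : S.card = G.edgeSet.ncard := by
    rw [← SimpleGraph.coe_edgeFinset, Set.ncard_coe_finset]
    have hlt : ∀ p ∈ S, p.1 < n ∧ p.2 < n := by
      intro p hp
      have := (Finset.mem_filter.1 hp).2
      omega
    refine Finset.card_bij (fun p hp => s((⟨p.1, (hlt p hp).1⟩ : Fin n), ⟨p.2, (hlt p hp).2⟩))
      ?_ ?_ ?_
    · intro p hp
      rw [SimpleGraph.mem_edgeFinset, SimpleGraph.mem_edgeSet]
      exact (Prog.val_adjBits G ⟨p.1, (hlt p hp).1⟩ ⟨p.2, (hlt p hp).2⟩).1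
        (Finset.mem_filter.1 hp).2.2.2
    · intro p hp p' hp' he
      have h1 := (Finset.mem_filter.1 hp).2.1
      have h2 := (Finset.mem_filter.1 hp').2.1
      simp only [Sym2.eq_iff, Fin.mk.injEq] at he
      exact Prod.ext (by omega) (by omega)
    · have key : ∀ v w : Fin n, v < w → G.Adj v w → ((v : ℕ), (w : ℕ)) ∈ S := by
        intro v w hvw h
        simp only [S, Finset.mem_filter, Finset.mem_product, Finset.mem_range]
        exact ⟨⟨v.2.trans hN, w.2.trans hN⟩, hvw, w.2, (Prog.val_adjBits G v w).2 h⟩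
      intro e he
      induction e with
      | _ v w =>
        rw [SimpleGraph.mem_edgeFinset, SimpleGraph.mem_edgeSet] at he
        rcases lt_trichotomy v w with h | h | h
        · exact ⟨_, key v w h he, rfl⟩
        · exact absurd h he.ne
        · exact ⟨_, key w v h he.symm, Sym2.eq_swap⟩
  -- The number of edges is less than `N ^ 2`, so `2 ^ N ^ 2` is an admissible base.
  have hle : S.card < N ^ 2 := by
    have : S ⊆ Finset.range n ×ˢ Finset.range n := by
      intro p hp
      have := (Finset.mem_filter.1 hp).2
      simp only [Finset.mem_product, Finset.mem_range]
      omega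
    have := Finset.card_le_card this
    rw [Finset.card_product, Finset.card_range] at this
    nlinarith
  rw [chooseNat, ← Finset.prod_product (f := fun p : ℕ × ℕ =>
    if p.1 < p.2 ∧ p.2 < n ∧ X / 2 ^ (p.1 * n + p.2) % 2 = 1 then 1 + 2 ^ N ^ 2 else 1)]
  rw [← Finset.prod_filter, Finset.prod_const, ← hS]
  exact one_add_pow_div_mod (Nat.pow_lt_pow_right (by norm_num) hle) k

namespace Prog

theorem arith_chooseNat :
    Arith fun N e => chooseNat N (ones N (e 1)) (ones N (e 2)) (e 0) := by
  classical
  have hk : Arith fun N e => ones N (e 1) := .ones 1 (by norm_num)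
  have hn : Arith fun N e => ones N (e 2) := .ones 2 (by norm_num)
  have h2 : Arith fun N _ => 2 ^ N ^ 2 := (Arith.two_pow_bound 1 2).of_eq fun N _ => by simp
  have hN : Arith fun N _ => N ^ 2 := Arith.bound.pow_const 2
  have hcond := (ArithPred.lt (.var 4) (.var 5)).and ((ArithPred.lt (.var 5) hn).and
    (ArithPred.eq (((Arith.var 0).shr (((Arith.var 4).mul hn).add (.var 5))).mod_two) (.const 1)))
  have hprod := ((Arith.ite hcond ((Arith.const 1).add h2) (.const 1)).prod 5).prod 4
  refine ((hprod.shr (hN.mul hk)).mod hN h2).of_eq fun N e => ?_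
  rw [chooseNat, ← pow_mul]
  simp only [Function.update_self, ne_eq, Nat.reduceEqDiff, OfNat.zero_ne_ofNat,
    not_false_eq_true, Function.update_of_ne]

end Prog

/-! ### The proposition -/

open Label Prog in
theorem mainTheorem11 (Φ : GraphProperty) (hΦ : Φ.IsComputable)
    (hM : ∃ M : ℕ, 0 < M ∧ ∀ k : ℕ,
      (∀ (V : Type) [Finite V] (H : SimpleGraph V),
        H.edgeSet.ncard = k → Φ.Holds H → matchingNumber H ≤ M) ∨
      (∀ (V : Type) [Finite V] (H : SimpleGraph V),
        H.edgeSet.ncard = k → ¬ Φ.Holds H → matchingNumber H ≤ M)) :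
    (sharpEdgeSub Φ).IsFPT := by
  obtain ⟨M, -, hM⟩ := hM
  -- `D` bounds the vertex cover formed by the endpoints of a maximum matching, and `T` the core.
  let D := 2 * M
  let T := D + D * D
  have hD : ∀ (k n : ℕ) (H : SimpleGraph (Fin n)), H.edgeSet.ncard = k →
      ¬(Φ.Holds (H.induce H.support) ↔ Φ.Holds (SimpleGraph.edges k)) → (H.core D).ncard ≤ T := by
    intro k n H hk hH
    obtain ⟨C, hC, hcov⟩ := (H.induce H.support).exists_cover
    have hm := matchingNumber_le_of_holds_ne Φ (hM k) (H.induce H.support)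
      (by rw [H.ncard_edgeSet_induce_support, hk]) hH
    refine H.ncard_core_le (C := Subtype.val '' C) ?_ fun v w h => ?_
    · exact (Set.ncard_image_le (Set.toFinite _)).trans (hC.trans (Nat.mul_le_mul_left 2 hm))
    · rcases hcov ⟨v, w, h⟩ ⟨w, v, h.symm⟩ h with h' | h'
      · exact .inl ⟨_, h', rfl⟩
      · exact .inr ⟨_, h', rfl⟩
  obtain ⟨tab, flag, htab, hflag, hf, htb, htlt⟩ := exists_table Φ hΦ T
  -- Chosen such that `2 ^ (c * N)` exceeds `N ^ T * Fintype.card (Label T) ^ n`, the bound on the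
  -- number of pairs.
  let c := T + Fintype.card (Label T)
  -- Table and flag are packed into the one number that the machine computes from `k`. Its parity
  -- decides between the count and its complement in the binomial coefficient, and its half is the
  -- table.
  have hm : Computable fun k => 2 * tab k + flag k :=
    Primrec.nat_add.to_comp.comp
      (Primrec.nat_mul.to_comp.comp (Computable.const 2) htab) hflag
  have hF := Arith.ite (ArithPred.eq (Arith.ones 3 (by norm_num)).mod_two (.const 1))
    (arith_chooseNat.sub (arith_cntNat T D c)) (arith_cntNat T D c)
  refine isFPT_of_arith Φ hF hm fun x => ?_
  obtain ⟨n, G, k, hk⟩ := x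
  simp only
  set N := 2 * tab k + flag k + 1 + n + k with hNdef
  have e0 : inputEnv k n (2 * tab k + flag k) (adjBits G) 0 = val (adjBits G) := rfl
  have e1 : ones N (inputEnv k n (2 * tab k + flag k) (adjBits G) 1) = k :=
    ones_two_pow_sub_one (by omega)
  have e2 : ones N (inputEnv k n (2 * tab k + flag k) (adjBits G) 2) = n :=
    ones_two_pow_sub_one (by omega)
  have e3 : ones N (inputEnv k n (2 * tab k + flag k) (adjBits G) 3) = 2 * tab k + flag k :=
    ones_two_pow_sub_one (by omega)
  have hflag_lt : flag k < 2 := by rcases hf k with h | h <;> omega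
  have e4 : (2 * tab k + flag k) / 2 = tab k := by omega
  have e5 : (2 * tab k + flag k) % 2 = flag k := by omega
  have hnN : n < N := by omega
  have hB : N ^ T * Fintype.card (Label T) ^ n < 2 ^ (c * N) := by
    have hq : 0 < Fintype.card (Label T) := Fintype.card_pos
    rw [show 2 ^ (c * N) = 2 ^ (T * N) * 2 ^ (Fintype.card (Label T) * N) by
      rw [← pow_add, ← add_mul]]
    refine Nat.mul_lt_mul_of_le_of_lt ?_ ?_ (by positivity)
    · calc N ^ T ≤ (2 ^ N) ^ T := Nat.pow_le_pow_left Nat.lt_two_pow_self.le _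
        _ = 2 ^ (T * N) := by rw [← pow_mul, mul_comm]
    · calc Fintype.card (Label T) ^ n ≤ (2 ^ Fintype.card (Label T)) ^ n :=
            Nat.pow_le_pow_left Nat.lt_two_pow_self.le _
        _ = 2 ^ (Fintype.card (Label T) * n) := by rw [pow_mul]
        _ < _ := Nat.pow_lt_pow_right (by norm_num) (Nat.mul_lt_mul_of_pos_left hnN hq)
  have hcnt : cntNat T D N (2 ^ (c * N)) k n (tab k) (val (adjBits G)) =
      {H | H ≤ G ∧ H.edgeSet.ncard = k ∧
        ¬(Φ.Holds (H.induce H.support) ↔ Φ.Holds (SimpleGraph.edges k))}.ncard := by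
    classical
    rw [cntNat, kronNat_eq]
    -- The loop bound `N` exceeds `tab k` and hence every index whose bit is set in the table.
    convert sum_kron_digits Φ hk hnN G (hD k n) hB (fun j => tab k / 2 ^ j % 2 = 1) (htb k)
      (fun j hj => (htlt k j hj).trans (by omega)) using 2
  rw [e0, e1, e2, e3, e4, e5, hcnt, chooseNat_eq hnN,
    ncard_edgeSubs Φ k G (Φ.Holds (SimpleGraph.edges k))]
  rcases hf k with ⟨h1, h2⟩ | ⟨h1, h2⟩
  · rw [if_pos h1, if_pos h2]
  · rw [if_neg (by omega), if_neg h2]
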